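/- Let $a,b,c\ge 1$ be integers, let $p$ be a prime and let $K$ be a field of order $q=p^e$. Let $$\Gamma_1=\mathcal H_{abc}(K)=\left\{\begin{bmatrix} I_a & U & W\\ 0& I_b & V\\ 0&0&I_c\end{bmatrix} : U\in \mathbb M_{a\times b}(K),\ V\in\mathbb M_{b\times c}(K),\ W\in\mathbb M_{a\times c}(K)\right\}\le \mathrm{GL}_{a+b+c}(K),$$ and let $\Gamma_2\le\Gamma_1$ be the subgroup of those matrices with $U=0$. A kind is a subgroup $Q$ with $\Gamma_2\le Q\le \Gamma_1$ (plural: kinder). An embedding of $Q$ as a kind is an injective homomorphism $\iota:Q\to\mathcal H_{abc}(K)$ whose image is again a kind, i.e. $\Gamma_2\le\iota(Q)$. There is an absolute constant $\delta>0$ and, for all $a,b,c$, a constant $C=C(a,b,c)$ such that the following holds for all $p$, $e$, $K$ as above with $abce>1$ and $ae>2$, and for every integer $\ell\geq 0$ with $\ell\approx abe/2$, in the sense that $|\ell-abe/2|\le\max(1/2,\ \delta\, abe)$. Let $Q$ be uniformly random among the kinder with $|Q/\Gamma_2|=p^\ell$. Then with probability at least $1-C/q$ both of the following hold. (1) For every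 embedding $\iota$ of $Q$ as a kind there is $\alpha\in\mathrm{Aut}(Q)$ with $\iota(\alpha(\Gamma_2))=\Gamma_2$. (2) The subgroups $\iota^{-1}(\Gamma_2)$ of $Q$, where $\iota$ ranges over the embeddings of $Q$ as a kind, form exactly one $\mathrm{Aut}(Q)$-orbit, the orbit of $\Gamma_2$. -/

import Mathlib

namespace HeisNursery

open Matrix

universe u

variable (a b c : ℕ) (K : Type u) [Field K]

/-- Row and column indices of the `(a + b + c) × (a + b + c)` matrices, grouped in blocks. -/
abbrev Idx : Type := Fin a ⊕ (Fin b ⊕ Fin c)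

variable {a b c K} in
/-- The block matrix with rows `[I U W]`, `[0 I V]`, `[0 0 I]`. -/
def blockMat (U : Matrix (Fin a) (Fin b) K) (V : Matrix (Fin b) (Fin c) K)
    (W : Matrix (Fin a) (Fin c) K) : Matrix (Idx a b c) (Idx a b c) K :=
  fromBlocks 1 (fromCols U W) 0 (fromBlocks 1 V 0 1)

variable {a b c K} in
theorem blockMat_mul (U U' : Matrix (Fin a) (Fin b) K) (V V' : Matrix (Fin b) (Fin c) K)
    (W W' : Matrix (Fin a) (Fin c) K) :
    blockMat U V W * blockMat U' V' W' = blockMat (U + U') (V + V') (W + W' + U * V') := by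
  ext i j
  rcases i with i | i | i <;> rcases j with j | j | j <;>
    simp [blockMat, fromBlocks_multiply, fromCols_mul_fromBlocks, add_comm, add_left_comm,
      add_assoc]

variable {a b c K} in
theorem blockMat_zero :
    blockMat (0 : Matrix (Fin a) (Fin b) K) (0 : Matrix (Fin b) (Fin c) K) 0 = 1 := by
  ext i j
  rcases i with i | i | i <;> rcases j with j | j | j <;> simp [blockMat, Matrix.one_apply]

variable {a b c K} in
theorem blockMat_inv {g : GL (Idx a b c) K} {U : Matrix (Fin a) (Fin b) K}
    {V : Matrix (Fin b) (Fin c) K} {W : Matrix (Fin a) (Fin c) K}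
    (h : (g : Matrix (Idx a b c) (Idx a b c) K) = blockMat U V W) :
    ((g⁻¹ : GL (Idx a b c) K) : Matrix (Idx a b c) (Idx a b c) K)
      = blockMat (-U) (-V) (-W + U * V) := by
  apply Units.inv_eq_of_mul_eq_one_right
  rw [h, blockMat_mul, ← blockMat_zero]
  congr 1 <;> simp

/-- The generalized Heisenberg group `H_{abc}(K)`, as a subgroup of `GL_{a+b+c}(K)`. -/
def heis : Subgroup (GL (Idx a b c) K) where
  carrier := {g | ∃ (U : Matrix (Fin a) (Fin b) K) (V : Matrix (Fin b) (Fin c) K)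
    (W : Matrix (Fin a) (Fin c) K), (g : Matrix (Idx a b c) (Idx a b c) K) = blockMat U V W}
  one_mem' := ⟨0, 0, 0, by rw [blockMat_zero]; rfl⟩
  mul_mem' := by
    rintro g g' ⟨U, V, W, h⟩ ⟨U', V', W', h'⟩
    exact ⟨_, _, _, by rw [Units.val_mul, h, h', blockMat_mul]⟩
  inv_mem' := by
    rintro g ⟨U, V, W, h⟩
    exact ⟨_, _, _, blockMat_inv h⟩

/-- The term `Γ₂` of the filtration of `Γ₁ = H_{abc}(K)`: the matrices with `U = 0`. -/
def Gamma₂ : Subgroup (heis a b c K) where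
  carrier := {g | ∃ (V : Matrix (Fin b) (Fin c) K) (W : Matrix (Fin a) (Fin c) K),
    ((g : GL (Idx a b c) K) : Matrix (Idx a b c) (Idx a b c) K) = blockMat 0 V W}
  one_mem' := ⟨0, 0, by rw [blockMat_zero]; rfl⟩
  mul_mem' := by
    rintro g g' ⟨V, W, h⟩ ⟨V', W', h'⟩
    refine ⟨V + V', W + W', ?_⟩
    rw [Subgroup.coe_mul, Units.val_mul, h, h', blockMat_mul]
    simp
  inv_mem' := by
    rintro g ⟨V, W, h⟩
    refine ⟨-V, -W, ?_⟩
    rw [Subgroup.coe_inv, blockMat_inv h]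
    simp

/-- The kinder `Q` (that is, `Γ₂ ≤ Q ≤ Γ₁ = H_{abc}(K)`) with `|Q / Γ₂| = m`. -/
def kinder (m : ℕ) : Set (Subgroup (heis a b c K)) :=
  {Q | Gamma₂ a b c K ≤ Q ∧ (Gamma₂ a b c K).relIndex Q = m}

variable {a b c K} in
/-- An embedding of `Q` into `H_{abc}(K)` as a kind: an injective homomorphism whose image
contains `Γ₂`. -/
def IsKindEmbedding {Q : Subgroup (heis a b c K)} (ι : Q →* heis a b c K) : Prop :=
  Function.Injective ι ∧ Gamma₂ a b c K ≤ ι.range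

variable {a b c K} in
/-- Each embedding `ι` of `Q` as a kind satisfies `ι(α(Γ₂)) = Γ₂` for some `α ∈ Aut(Q)`. -/
def EmbeddingsConjugate (Q : Subgroup (heis a b c K)) : Prop :=
  ∀ ι : Q →* heis a b c K, IsKindEmbedding ι →
    ∃ α : Q ≃* Q,
      (((Gamma₂ a b c K).subgroupOf Q).map α.toMonoidHom).map ι = Gamma₂ a b c K

variable {a b c K} in
/-- The subgroups `ι⁻¹(Γ₂)` of `Q` that arise from the embeddings of `Q` as a kind are exactly
the members of the `Aut(Q)`-orbit of `Γ₂`. -/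
def SingleOrbit (Q : Subgroup (heis a b c K)) : Prop :=
  {A : Subgroup Q | ∃ ι : Q →* heis a b c K, IsKindEmbedding ι ∧ A = (Gamma₂ a b c K).comap ι} =
    {A : Subgroup Q | ∃ α : Q ≃* Q, A = ((Gamma₂ a b c K).subgroupOf Q).map α.toMonoidHom}

end HeisNursery

/-! ### Double counting and elementary cardinality estimates -/

namespace HeisNursery
open Matrix Module

/-! A kind is determined by the additive group `S` of its blocks `U` (`kinder_eq_image`), so a
random kind is a random `ℓ`-dimensional subspace `S` of the space of `a × b` matrices over the prime
field F_p. Property (2) follows formally from (1) (`EmbeddingsConjugate.singleOrbit`), so it remains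
to see that (1) fails for a proportion O(1/q) of all `S`.

Algebra. If the elements of `S` have no common kernel vector, the centre of the kind is the block
`W`, and an embedding maps it to the centre. Modulo the centre the embedding becomes a pair `(u, v)`
of additive maps compatible with the commutator form [x, y] = U V' - U' V, and the preimage of Γ₂
becomes the image of a section `J` of `v` with values in ker `u` (`exists_kindData`). The idempotent
P = J ∘ v satisfies [Px, y] + [x, Py] = [x, y]. Read in blocks on S × M_{b×c}(K), this says for
generic `S` that the corner from S to M_{b×c}(K) vanishes and that the corner on M_{b×c}(K) is
multiplication by an idempotent T with S T ⊆ S, so that T is 0 or 1 (`KindData.isShear_or_isSwap`).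
If T = 1, the preimage of Γ₂ is the graph of a symmetric β, and the shear (U, V) ↦ (U + β V, V)
lifts to an automorphism after a quadratic correction of `W` (`exists_aut_of_isShear`). If T = 0,
the preimage is S × 0, and an automorphism exchanging the two factors is needed
(`exists_aut_of_isSwap`).

Swaps. In the second case S is identified with M_{b×c}(K), and right multiplication by M_c(K) turns
into left multiplication on `S` (`exists_antihom`). Hence c divides a, and |S| = q^{bc} being close
to the middle forces a = 2c. For b = 1 the exchanging automorphism is constructed, from a Galois
expansion (`hasSwap_of_two_mul`) or from a K-independent basis of `S` (`hasSwap_of_hasIndepBasis`).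
For b ≥ 2 such `S` are rare: they are stable under a family of nilpotents when c ≥ 2, and under a
field acting from the left when c = 1. The case a = 1 has its own argument
(`KindData.isShear_of_noLine`), as has one tiny set of parameters (`rare_of_three`).

Counting. Proportions of subgroups are replaced by proportions of linear maps `u` from F_p^ℓ
(`ncard_bad_mul_le`). Each failure of genericity provides a witness; the number of witnesses is
weighed against the number of conditions that each imposes on `u`. Usually the factor 1/q comes from
witnesses occurring in families of size q - 1. The idempotent condition instead has a numerical
margin, obtained from the closeness of ℓ to abe/2 (`NearHalf.noIdem`). -/

theorem ncard_mul_le_ncard_mul {ι α : Type*} [Finite ι] [Finite α] (R : ι → α → Prop)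
    (I : Set ι) (B : Set α) (m k : ℕ) (h1 : ∀ x ∈ B, m ≤ {i ∈ I | R i x}.ncard)
    (h2 : ∀ i ∈ I, {x | R i x}.ncard ≤ k) : B.ncard * m ≤ I.ncard * k := by
  classical
  have := Fintype.ofFinite ι
  have := Fintype.ofFinite α
  rw [Set.ncard_eq_toFinset_card' B, Set.ncard_eq_toFinset_card' I]
  refine Finset.card_mul_le_card_mul (fun x i => R i x) (fun x hx => ?_) (fun i hi => ?_)
  · refine (h1 x (by simpa using hx)).trans ?_
    rw [Set.ncard_eq_toFinset_card']
    refine Finset.card_le_card fun i hi => ?_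
    simpa [Finset.bipartiteAbove] using hi
  · refine le_trans ?_ (h2 i (by simpa using hi))
    rw [Set.ncard_eq_toFinset_card']
    refine Finset.card_le_card fun x hx => ?_
    simp only [Finset.bipartiteBelow, Finset.mem_filter] at hx
    simpa using hx.2

theorem natCard_ker_mul_of_surjective {A B : Type*} [AddCommGroup A] [AddCommGroup B]
    (f : A →+ B) (hf : Function.Surjective f) :
    Nat.card f.ker * Nat.card B = Nat.card A := by
  rw [← AddSubgroup.card_mul_index f.ker, AddSubgroup.index_ker, AddMonoidHom.range_eq_top.2 hf,
    Nat.card_congr AddSubgroup.topEquiv.toEquiv]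

theorem ncard_fiber_le_natCard_ker {A B : Type*} [AddCommGroup A] [Finite A] [AddCommGroup B]
    (f : A →+ B) (b : B) : {x | f x = b}.ncard ≤ Nat.card f.ker := by
  rcases Set.eq_empty_or_nonempty {x | f x = b} with h | ⟨x0, h0⟩
  · simp [h]
  · rw [← Nat.card_coe_set_eq]
    refine Nat.card_le_card_of_injective
      (fun x => (⟨x.1 - x0, by
        rw [AddMonoidHom.mem_ker, map_sub, show f x0 = b from h0, show f x.1 = b from x.2,
          sub_self]⟩ : f.ker)) ?_
    rintro ⟨x, hx⟩ ⟨y, hy⟩ h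
    simpa using h

/-- After division by (q^n)^(k+1) this is ∏ (1 - q^(i-n)) ≥ 1 - q^(k-n). With t = q^(k-n) the
induction step is (1 - t)² ≥ 1 - 2t ≥ 1 - qt; a constant lower bound would not be inductive. -/
theorem pow_mul_le_prod_pow_sub {q : ℕ} (hq : 2 ≤ q) (n k : ℕ) (hk : k ≤ n) :
    ((q : ℝ) ^ n) ^ k * (q ^ n - q ^ k) ≤ q ^ n * ∏ i ∈ Finset.range k, ((q : ℝ) ^ n - q ^ i) := by
  have hq' : (2 : ℝ) ≤ q := by exact_mod_cast hq
  induction k with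
  | zero => simp
  | succ k ih =>
    have h := ih (by omega)
    rw [Finset.prod_range_succ]
    set x : ℝ := (q : ℝ) ^ n
    have hx : 0 < x := by positivity
    have hy : (q : ℝ) ^ k ≤ x := pow_le_pow_right₀ (by linarith) (by omega)
    have hk0 : (0 : ℝ) < q ^ k := by positivity
    set y : ℝ := (q : ℝ) ^ k
    have h1 : x ^ k * (x - y) * (x - y) ≤ (x * ∏ i ∈ Finset.range k, (x - (q : ℝ) ^ i)) * (x - y) :=
      mul_le_mul_of_nonneg_right h (by linarith)
    have h2 : x ^ (k + 1) * (x - q ^ (k + 1)) ≤ x ^ k * (x - y) * (x - y) := by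
      have h3 : (q : ℝ) ^ (k + 1) = q * y := by rw [pow_succ, mul_comm]
      rw [h3, pow_succ, mul_assoc, mul_assoc]
      refine mul_le_mul_of_nonneg_left ?_ (by positivity)
      have := mul_pos hx hk0
      nlinarith [sq_nonneg y, mul_le_mul_of_nonneg_right hq' this.le]
    linarith

/-- Because k < n, the correction q^(k-n) is at most 1/2. -/
theorem pow_mul_le_two_mul_prod {q : ℕ} (hq : 2 ≤ q) (n k : ℕ) (hk : k < n) :
    q ^ (n * k) ≤ 2 * ∏ i : Fin k, (q ^ n - q ^ (i : ℕ)) := by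
  have h := pow_mul_le_prod_pow_sub hq n k hk.le
  have hq' : (2 : ℝ) ≤ q := by exact_mod_cast hq
  have h1 : (q : ℝ) * q ^ k ≤ q ^ n := by
    rw [← pow_succ']; exact pow_le_pow_right₀ (by linarith) (by omega)
  have hx : (0 : ℝ) < q ^ n := by positivity
  have hy : (0 : ℝ) < q ^ k := by positivity
  have h2 : (q : ℝ) ^ n ≤ 2 * (q ^ n - q ^ k) := by nlinarith
  have h3 : ((q : ℝ) ^ n) ^ k * q ^ n ≤
      2 * (∏ i ∈ Finset.range k, ((q : ℝ) ^ n - q ^ i)) * q ^ n := by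
    have := mul_le_mul_of_nonneg_left h2 (show 0 ≤ ((q : ℝ) ^ n) ^ k by positivity)
    linarith
  have h4 := le_of_mul_le_mul_right h3 hx
  rw [← pow_mul] at h4
  have h5 : ((∏ i : Fin k, (q ^ n - q ^ (i : ℕ)) : ℕ) : ℝ) =
      ∏ i ∈ Finset.range k, ((q : ℝ) ^ n - q ^ i) := by
    rw [Finset.prod_fin_eq_prod_range, Nat.cast_prod]
    refine Finset.prod_congr rfl fun i hi => ?_
    have hi' := Finset.mem_range.1 hi
    rw [dif_pos hi', Nat.cast_sub (Nat.pow_le_pow_right (by omega) (by omega))]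
    push_cast; rfl
  rw [← h5] at h4
  exact_mod_cast h4

theorem pow_mul_self_le_four_mul_card_GL (F : Type*) [Field F] [Finite F] (s : ℕ) :
    Nat.card F ^ (s * s) ≤ 4 * Nat.card (GL (Fin s) F) := by
  have := Fintype.ofFinite F
  rw [card_GL_field, Nat.card_eq_fintype_card]
  have hq : 2 ≤ Fintype.card F := Fintype.one_lt_card
  set q := Fintype.card F
  cases s with
  | zero => simp
  | succ k =>
    -- The last factor q^(k+1) - q^k lies outside the range k < n of the previous bound; it costs a
    -- second factor 2.
    rw [Fin.prod_univ_castSucc]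
    have h1 := pow_mul_le_two_mul_prod hq (k + 1) k (by omega)
    simp only [Fin.val_castSucc, Fin.val_last]
    have h2 : q ^ (k + 1) ≤ 2 * (q ^ (k + 1) - q ^ k) := by
      have : 2 * q ^ k ≤ q ^ (k + 1) := by
        rw [pow_succ']; exact Nat.mul_le_mul_right _ hq
      omega
    calc q ^ ((k + 1) * (k + 1)) = q ^ ((k + 1) * k) * q ^ (k + 1) := by rw [← pow_add]; ring_nf
      _ ≤ (2 * ∏ i : Fin k, (q ^ (k + 1) - q ^ (i : ℕ))) * (2 * (q ^ (k + 1) - q ^ k)) :=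
        Nat.mul_le_mul h1 h2
      _ = _ := by ring

/-! ### Matrices of given rank, idempotents and square-zero matrices -/

section Rank
variable {F : Type*} [Field F]

theorem exists_rank_factorization {m n : ℕ} (Z : Matrix (Fin m) (Fin n) F) :
    ∃ (x : Matrix (Fin m) (Fin Z.rank) F) (y : Matrix (Fin Z.rank) (Fin n) F), x * y = Z ∧
      (∃ x' : Matrix (Fin Z.rank) (Fin m) F, x' * x = 1) ∧
        ∃ y' : Matrix (Fin n) (Fin Z.rank) F, y * y' = 1 := by
  let f := Matrix.toLin' Z
  let R := LinearMap.range f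
  have hR : finrank F R = Z.rank := (Matrix.rank_eq_finrank_range_toLin Z (Pi.basisFun F _) (Pi.basisFun F _)).symm
  let e : R ≃ₗ[F] (Fin Z.rank → F) := LinearEquiv.ofFinrankEq _ _ (by simp [hR])
  let i : (Fin Z.rank → F) →ₗ[F] (Fin m → F) := R.subtype ∘ₗ e.symm.toLinearMap
  let r : (Fin n → F) →ₗ[F] (Fin Z.rank → F) := e.toLinearMap ∘ₗ f.rangeRestrict
  have hi : LinearMap.ker i = ⊥ := by
    rw [LinearMap.ker_eq_bot]
    exact R.injective_subtype.comp e.symm.injective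
  have hr : LinearMap.range r = ⊤ := by
    rw [LinearMap.range_eq_top]
    exact e.surjective.comp f.surjective_rangeRestrict
  obtain ⟨i', hi'⟩ := LinearMap.exists_leftInverse_of_injective i hi
  obtain ⟨r', hr'⟩ := LinearMap.exists_rightInverse_of_surjective r hr
  refine ⟨LinearMap.toMatrix' i, LinearMap.toMatrix' r, ?_, ⟨LinearMap.toMatrix' i', ?_⟩,
    ⟨LinearMap.toMatrix' r', ?_⟩⟩
  · rw [← LinearMap.toMatrix'_comp]
    have : i ∘ₗ r = f := by ext v; simp [i, r]
    rw [this]; simp [f]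
  · rw [← LinearMap.toMatrix'_comp, hi', LinearMap.toMatrix'_id]
  · rw [← LinearMap.toMatrix'_comp, hr', LinearMap.toMatrix'_id]

variable [Finite F]

omit [Field F] [Finite F] in
theorem natCard_matrix (m n : ℕ) : Nat.card (Matrix (Fin m) (Fin n) F) = Nat.card F ^ (m * n) := by
  rw [show Matrix (Fin m) (Fin n) F = (Fin m → Fin n → F) from rfl]
  simp [Nat.card_fun, ← pow_mul, mul_comm]

/-- GL_s acts freely on the full-rank factorizations Z = x y. The one-sided inverses are kept on the
right because conditions on Z will be turned into conditions on y x by cancelling. -/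
theorem ncard_rank_mul_card_GL_le {m n s : ℕ} (C : Set (Matrix (Fin m) (Fin n) F))
    (hC : ∀ Z ∈ C, Z.rank = s) :
    C.ncard * Nat.card (GL (Fin s) F) ≤
      {t : Matrix (Fin m) (Fin s) F × Matrix (Fin s) (Fin n) F |
        t.1 * t.2 ∈ C ∧ (∃ x' : Matrix (Fin s) (Fin m) F, x' * t.1 = 1) ∧
          ∃ y' : Matrix (Fin n) (Fin s) F, t.2 * y' = 1}.ncard := by
  refine (ncard_mul_le_ncard_mul (fun t Z => t.1 * t.2 = Z) _ C _ 1 ?_ ?_).trans_eq (mul_one _)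
  · rintro Z hZ
    obtain rfl := hC Z hZ
    obtain ⟨x, y, hxy, ⟨x', hx'⟩, ⟨y', hy'⟩⟩ := exists_rank_factorization Z
    rw [← Nat.card_coe_set_eq]
    refine Nat.card_le_card_of_injective (fun g : GL (Fin Z.rank) F =>
      ⟨(x * g.1, (g⁻¹).1 * y), ?_⟩) ?_
    · have h : x * g.1 * ((g⁻¹).1 * y) = Z := by
        rw [Matrix.mul_assoc, ← Matrix.mul_assoc g.1, Units.mul_inv, Matrix.one_mul, hxy]
      refine ⟨⟨by rw [h]; exact hZ, ⟨(g⁻¹).1 * x', ?_⟩, ⟨y' * g.1, ?_⟩⟩, h⟩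
      · rw [Matrix.mul_assoc, ← Matrix.mul_assoc x', hx', Matrix.one_mul, Units.inv_mul]
      · rw [Matrix.mul_assoc, ← Matrix.mul_assoc y, hy', Matrix.one_mul, Units.inv_mul]
    · intro g g' h
      simp only [Subtype.mk.injEq, Prod.mk.injEq] at h
      have := congrArg (x' * ·) h.1
      simp only [← Matrix.mul_assoc, hx', Matrix.one_mul] at this
      exact Units.ext this
  · rintro t -
    have : {x | t.1 * t.2 = x} = {t.1 * t.2} := by ext; simp [eq_comm]
    rw [this, Set.ncard_singleton]

theorem ncard_rank_mul_le (m n s : ℕ) :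
    {Z : Matrix (Fin m) (Fin n) F | Z.rank = s}.ncard * Nat.card F ^ (s * s) ≤
      4 * Nat.card F ^ (s * (m + n)) := by
  have h := ncard_rank_mul_card_GL_le {Z : Matrix (Fin m) (Fin n) F | Z.rank = s} (fun _ h => h)
  have h2 := pow_mul_self_le_four_mul_card_GL F s
  have h3 := h.trans (Set.ncard_le_card _)
  rw [Nat.card_prod, natCard_matrix, natCard_matrix, ← pow_add] at h3
  calc _ ≤ _ := Nat.mul_le_mul_left _ h2
    _ = 4 * ({Z : Matrix (Fin m) (Fin n) F | Z.rank = s}.ncard * Nat.card (GL (Fin s) F)) := by ring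
    _ ≤ 4 * _ := Nat.mul_le_mul_left _ h3
    _ = _ := by ring_nf

omit [Finite F] in
theorem natCard_annihilator_mul {n s : ℕ} (k : ℕ) (x : Matrix (Fin n) (Fin s) F)
    (hx : ∃ x' : Matrix (Fin s) (Fin n) F, x' * x = 1) :
    {Y : Matrix (Fin k) (Fin n) F | Y * x = 0}.ncard * Nat.card F ^ (k * s) =
      Nat.card F ^ (k * n) := by
  obtain ⟨x', hx'⟩ := hx
  let f : Matrix (Fin k) (Fin n) F →+ Matrix (Fin k) (Fin s) F :=
    { toFun := fun Y => Y * x, map_zero' := Matrix.zero_mul _, map_add' := fun _ _ => Matrix.add_mul _ _ _ }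
  have := natCard_ker_mul_of_surjective f (fun Y => ⟨Y * x', by
    change Y * x' * x = Y; rw [Matrix.mul_assoc, hx', Matrix.mul_one]⟩)
  rw [natCard_matrix, natCard_matrix] at this
  rw [← this, ← Nat.card_coe_set_eq]
  rfl

theorem ncard_mul_eq_le {n s : ℕ} (k : ℕ) (x : Matrix (Fin n) (Fin s) F)
    (c : Matrix (Fin k) (Fin s) F) :
    {Y : Matrix (Fin k) (Fin n) F | Y * x = c}.ncard ≤
      {Y : Matrix (Fin k) (Fin n) F | Y * x = 0}.ncard := by
  let f : Matrix (Fin k) (Fin n) F →+ Matrix (Fin k) (Fin s) F :=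
    { toFun := fun Y => Y * x, map_zero' := Matrix.zero_mul _, map_add' := fun _ _ => Matrix.add_mul _ _ _ }
  have := ncard_fiber_le_natCard_ker f c
  rw [← Nat.card_coe_set_eq {Y : Matrix (Fin k) (Fin n) F | Y * x = 0}]
  exact this

/-- Rank `s` matrices `x y` whose reversed product `y x` is prescribed. -/
theorem ncard_rank_of_swap_le {n s : ℕ} (C : Set (Matrix (Fin n) (Fin n) F))
    (hC : ∀ Z ∈ C, Z.rank = s) (c : Matrix (Fin s) (Fin s) F)
    (hc : ∀ (x : Matrix (Fin n) (Fin s) F) (y : Matrix (Fin s) (Fin n) F), x * y ∈ C →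
      (∃ x' : Matrix (Fin s) (Fin n) F, x' * x = 1) → (∃ y' : Matrix (Fin n) (Fin s) F, y * y' = 1) → y * x = c) :
    C.ncard * Nat.card F ^ (2 * s * s) ≤ 4 * Nat.card F ^ (2 * s * n) := by
  have h := ncard_rank_mul_card_GL_le C hC
  have h2 := pow_mul_self_le_four_mul_card_GL F s
  set Q := Nat.card F
  set T := {t : Matrix (Fin n) (Fin s) F × Matrix (Fin s) (Fin n) F |
        t.1 * t.2 ∈ C ∧ (∃ x' : Matrix (Fin s) (Fin n) F, x' * t.1 = 1) ∧
          ∃ y' : Matrix (Fin n) (Fin s) F, t.2 * y' = 1}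
  have h3 : T.ncard * Q ^ (s * s) ≤ Q ^ (n * s) * Q ^ (s * n) := by
    rcases Set.eq_empty_or_nonempty {x : Matrix (Fin n) (Fin s) F | ∃ x' : Matrix (Fin s) (Fin n) F, x' * x = 1} with he | ⟨x0, hx0⟩
    · have : T = ∅ := by
        ext t; simp only [Set.mem_empty_iff_false, iff_false]
        intro ht
        have : t.1 ∈ {x : Matrix (Fin n) (Fin s) F | ∃ x' : Matrix (Fin s) (Fin n) F, x' * x = 1} := ht.2.1
        rw [he] at this; exact this
      simp [this]
    · have hcard : ∀ x : Matrix (Fin n) (Fin s) F, (∃ x' : Matrix (Fin s) (Fin n) F, x' * x = 1) →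
          {Y : Matrix (Fin s) (Fin n) F | Y * x = 0}.ncard =
          {Y : Matrix (Fin s) (Fin n) F | Y * x0 = 0}.ncard := fun x hx => by
        have e1 := natCard_annihilator_mul s x hx
        have e2 := natCard_annihilator_mul s x0 hx0
        have : 0 < Nat.card F ^ (s * s) := pow_pos Nat.card_pos _
        exact Nat.eq_of_mul_eq_mul_right this (e1.trans e2.symm)
      have := ncard_mul_le_ncard_mul (fun (x : Matrix (Fin n) (Fin s) F)
          (t : Matrix (Fin n) (Fin s) F × Matrix (Fin s) (Fin n) F) => t.1 = x ∧ t ∈ T)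
          Set.univ T 1 {Y : Matrix (Fin s) (Fin n) F | Y * x0 = 0}.ncard
          (fun t ht => by
            have : {i ∈ (Set.univ : Set (Matrix (Fin n) (Fin s) F)) | t.1 = i ∧ t ∈ T} = {t.1} := by
              ext i; simp [ht, eq_comm]
            rw [this]; simp)
          (fun x _ => by
            -- For fixed `x` of full rank, `y` solves the inhomogeneous system y x = c, and the
            -- number of homogeneous solutions is the same for all such `x`; the fixed `x0`
            -- represents it.
            by_cases hx : ∃ x' : Matrix (Fin s) (Fin n) F, x' * x = 1
            · rw [← hcard x hx]
              refine le_trans ?_ (ncard_mul_eq_le s x c)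
              refine Set.ncard_le_ncard_of_injOn Prod.snd ?_ ?_
              · rintro t ⟨rfl, ht⟩
                exact hc _ _ ht.1 ht.2.1 ht.2.2
              · rintro t ⟨h1, _⟩ t' ⟨h1', _⟩ h
                exact Prod.ext (h1.trans h1'.symm) h
            · have : {t : Matrix (Fin n) (Fin s) F × Matrix (Fin s) (Fin n) F | t.1 = x ∧ t ∈ T} = ∅ := by
                ext t; simp only [Set.mem_empty_iff_false, iff_false]
                rintro ⟨rfl, ht⟩
                exact hx ht.2.1
              simp [this])
      rw [mul_one, Set.ncard_univ, natCard_matrix] at this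
      calc T.ncard * Q ^ (s * s) ≤ _ := Nat.mul_le_mul_right _ this
        _ = Q ^ (n * s) * ({Y : Matrix (Fin s) (Fin n) F | Y * x0 = 0}.ncard * Q ^ (s * s)) := by ring
        _ = _ := by rw [natCard_annihilator_mul s x0 hx0]
  calc C.ncard * Q ^ (2 * s * s) = C.ncard * Q ^ (s * s) * Q ^ (s * s) := by
        rw [show 2 * s * s = s * s + s * s by ring, pow_add, mul_assoc]
    _ ≤ C.ncard * (4 * Nat.card (GL (Fin s) F)) * Q ^ (s * s) := by gcongr
    _ = 4 * ((C.ncard * Nat.card (GL (Fin s) F)) * Q ^ (s * s)) := by ring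
    _ ≤ 4 * (T.ncard * Q ^ (s * s)) := by gcongr
    _ ≤ 4 * (Q ^ (n * s) * Q ^ (s * n)) := by gcongr
    _ = _ := by rw [← pow_add]; ring_nf

omit [Finite F] in
theorem cancel_of_inverses {n s : ℕ} {x : Matrix (Fin n) (Fin s) F} {y : Matrix (Fin s) (Fin n) F}
    {u v : Matrix (Fin s) (Fin s) F} (hx : ∃ x' : Matrix (Fin s) (Fin n) F, x' * x = 1) (hy : ∃ y' : Matrix (Fin n) (Fin s) F, y * y' = 1)
    (h : x * u * y = x * v * y) : u = v := by
  obtain ⟨x', hx⟩ := hx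
  obtain ⟨y', hy⟩ := hy
  have key : ∀ w : Matrix (Fin s) (Fin s) F, x' * (x * w * y) * y' = w := fun w => by
    rw [Matrix.mul_assoc, Matrix.mul_assoc, hy, Matrix.mul_one, ← Matrix.mul_assoc, hx,
      Matrix.one_mul]
  rw [← key u, h, key]

/-- In a full-rank factorization, x y x y = x y cancels to y x = 1. -/
theorem ncard_idempotent_le (n s : ℕ) :
    {Z : Matrix (Fin n) (Fin n) F | Z * Z = Z ∧ Z.rank = s}.ncard * Nat.card F ^ (2 * s * s) ≤
      4 * Nat.card F ^ (2 * s * n) := by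
  refine ncard_rank_of_swap_le _ (fun _ h => h.2) 1 fun x y h hx hy => ?_
  refine cancel_of_inverses hx hy ?_
  simpa [Matrix.mul_assoc] using h.1

/-- Here the cancellation gives y x = 0. -/
theorem ncard_sq_zero_le (n s : ℕ) :
    {Z : Matrix (Fin n) (Fin n) F | Z * Z = 0 ∧ Z.rank = s}.ncard * Nat.card F ^ (2 * s * s) ≤
      4 * Nat.card F ^ (2 * s * n) := by
  refine ncard_rank_of_swap_le _ (fun _ h => h.2) 0 fun x y h hx hy => ?_
  refine cancel_of_inverses hx hy ?_
  simpa [Matrix.mul_assoc] using h.1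

end Rank

/-! ### From additive subgroups to injective linear maps -/

section Subgroups
variable {p ℓ n : ℕ} [Fact p.Prime] {V : Type*} [AddCommGroup V] [Module (ZMod p) V] [Finite V]

instance finite_linearMap {V W : Type*} [AddCommGroup V] [Module (ZMod p) V] [AddCommGroup W]
    [Module (ZMod p) W] [Finite V] [Finite W] : Finite (V →ₗ[ZMod p] W) :=
  Finite.of_injective _ DFunLike.coe_injective

instance finite_linearEquiv {V W : Type*} [AddCommGroup V] [Module (ZMod p) V] [AddCommGroup W]
    [Module (ZMod p) W] [Finite V] [Finite W] : Finite (V ≃ₗ[ZMod p] W) :=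
  Finite.of_injective _ DFunLike.coe_injective

theorem finrank_of_natCard (hn : Nat.card V = p ^ n) : finrank (ZMod p) V = n := by
  have h := Module.natCard_eq_pow_finrank (K := ZMod p) (V := V)
  rw [hn, Nat.card_zmod] at h
  exact (Nat.pow_right_injective (Nat.Prime.two_le Fact.out) h).symm

theorem pow_le_two_mul_ncard_injective (hn : Nat.card V = p ^ n) (hℓ : ℓ < n) :
    p ^ (n * ℓ) ≤ 2 * {u : (Fin ℓ → ZMod p) →ₗ[ZMod p] V | Function.Injective u}.ncard := by
  have hp : p.Prime := Fact.out
  have hfin := finrank_of_natCard hn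
  refine (pow_mul_le_two_mul_prod hp.two_le n ℓ hℓ).trans ?_
  have h := card_linearIndependent (K := ZMod p) (V := V) (k := ℓ) (by omega)
  rw [ZMod.card, hfin] at h
  rw [← h, ← Nat.card_coe_set_eq]
  refine Nat.mul_le_mul_left _ (Nat.card_le_card_of_injective
    (fun s => ⟨(Pi.basisFun (ZMod p) (Fin ℓ)).constr (ZMod p) s.1, ?_⟩) ?_)
  · exact Module.Basis.injective_constr_of_linearIndependent _ s.2
  · intro s t h
    have h := congrArg Subtype.val h
    exact Subtype.ext ((Module.Basis.constr _ (ZMod p)).injective h)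

/-- Two injective maps with the same image differ by an automorphism of the source, so a subgroup
arises from at most as many maps as there are automorphisms. -/
theorem ncard_injective_le :
    {u : (Fin ℓ → ZMod p) →ₗ[ZMod p] V | Function.Injective u}.ncard ≤
      {S : AddSubgroup V | Nat.card S = p ^ ℓ}.ncard *
        Nat.card ((Fin ℓ → ZMod p) ≃ₗ[ZMod p] (Fin ℓ → ZMod p)) := by
  let X := Fin ℓ → ZMod p
  let I : Set (X →ₗ[ZMod p] V) := {u | Function.Injective u}
  have hcardS : ∀ u : X →ₗ[ZMod p] V, Function.Injective u →
      Nat.card u.toAddMonoidHom.range = p ^ ℓ := by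
    intro u hu
    have := Nat.card_congr (Equiv.ofInjective u hu)
    rw [show Nat.card u.toAddMonoidHom.range = Nat.card (Set.range u) from rfl, ← this]
    simp [X]
  refine (mul_one _).symm.trans_le (ncard_mul_le_ncard_mul (fun S u => u ∈ I ∧ u.toAddMonoidHom.range = S) _ _ _ _ ?_ ?_)
  · intro u hu
    have : {i ∈ {S : AddSubgroup V | Nat.card S = p ^ ℓ} | u ∈ I ∧ u.toAddMonoidHom.range = i} =
        {u.toAddMonoidHom.range} := by
      ext S
      simp only [Set.mem_ofPred_eq, Set.mem_singleton_iff]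
      exact ⟨fun h => h.2.2.symm, fun h => ⟨h ▸ hcardS u hu, hu, h.symm⟩⟩
    rw [this, Set.ncard_singleton]
  · intro S _
    rcases Set.eq_empty_or_nonempty {u : X →ₗ[ZMod p] V | u ∈ I ∧ u.toAddMonoidHom.range = S} with
      h | ⟨u0, hu0, hS0⟩
    · simp [h]
    rw [← Nat.card_coe_set_eq]
    have hrange : ∀ u : {u : X →ₗ[ZMod p] V | u ∈ I ∧ u.toAddMonoidHom.range = S},
        LinearMap.range u.1 = LinearMap.range u0 := fun u => by
      apply Submodule.toAddSubgroup_injective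
      exact u.2.2.trans hS0.symm
    refine Nat.card_le_card_of_injective (fun u =>
      ((LinearEquiv.ofInjective u.1 u.2.1).trans (LinearEquiv.ofEq _ _ (hrange u))).trans
        (LinearEquiv.ofInjective u0 hu0).symm) ?_
    intro u u' h
    apply Subtype.ext
    ext1 x
    have h := congrArg (fun f => u0 (f (Pi.single x 1))) h
    simp only [LinearEquiv.trans_apply] at h
    have key : ∀ y : LinearMap.range u0, u0 ((LinearEquiv.ofInjective u0 hu0).symm y) = y := by
      intro y
      have := congrArg Subtype.val ((LinearEquiv.ofInjective u0 hu0).apply_symm_apply y)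
      simp
    rw [key, key] at h
    ext
    simpa using h

/-- Bounding a family of additive subgroups by counting the injective linear maps onto them. -/
theorem ncard_subgroups_mul_le (hn : Nat.card V = p ^ n) (hℓ : ℓ < n)
    (B : Set ((Fin ℓ → ZMod p) →ₗ[ZMod p] V)) (bad : AddSubgroup V → Prop)
    (hB : ∀ S, bad S → ∀ u : (Fin ℓ → ZMod p) →ₗ[ZMod p] V, Function.Injective u →
      (∀ x, x ∈ S ↔ ∃ i, u i = x) → u ∈ B) :
    {S : AddSubgroup V | Nat.card S = p ^ ℓ ∧ bad S}.ncard * p ^ (n * ℓ) ≤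
      2 * B.ncard * {S : AddSubgroup V | Nat.card S = p ^ ℓ}.ncard := by
  let X := Fin ℓ → ZMod p
  let g := Nat.card (X ≃ₗ[ZMod p] X)
  have hg : 0 < g := Nat.card_pos
  let I : Set (X →ₗ[ZMod p] V) := {u | Function.Injective u}
  have hI : p ^ (n * ℓ) ≤ 2 * I.ncard := pow_le_two_mul_ncard_injective hn hℓ
  have hIg : I.ncard ≤ {S : AddSubgroup V | Nat.card S = p ^ ℓ}.ncard * g := ncard_injective_le
  have hBg : {S : AddSubgroup V | Nat.card S = p ^ ℓ ∧ bad S}.ncard * g ≤ B.ncard * 1 := by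
    refine ncard_mul_le_ncard_mul (fun (u : X →ₗ[ZMod p] V) S => Function.Injective u ∧ u.toAddMonoidHom.range = S) _ _ _ _ ?_ ?_
    · rintro S ⟨hS, hb⟩
      have hS' : finrank (ZMod p) (AddSubgroup.toZModSubmodule p S) = ℓ := by
        exact finrank_of_natCard hS
      let e : X ≃ₗ[ZMod p] AddSubgroup.toZModSubmodule p S :=
        LinearEquiv.ofFinrankEq _ _ (by simp [X, hS'])
      -- An additive subgroup is automatically a subspace over the prime field. Composing one
      -- parametrization with all automorphisms shows that a bad subgroup accounts for `g` elements
      -- of `B`.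
      let u : (X ≃ₗ[ZMod p] X) → (X →ₗ[ZMod p] V) := fun a =>
        (AddSubgroup.toZModSubmodule p S).subtype ∘ₗ (a.trans e).toLinearMap
      have hu : ∀ a, Function.Injective (u a) := fun a =>
        Subtype.val_injective.comp (a.trans e).injective
      have hmem : ∀ a x, x ∈ S ↔ ∃ i, u a i = x := fun a x => by
        constructor
        · intro hx
          obtain ⟨i, hi⟩ := (a.trans e).surjective ⟨x, hx⟩
          exact ⟨i, congrArg Subtype.val hi⟩
        · rintro ⟨i, rfl⟩
          exact ((a.trans e) i).2
      rw [← Nat.card_coe_set_eq]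
      refine Nat.card_le_card_of_injective (fun a => ⟨u a, hB S hb _ (hu a) (hmem a), hu a, ?_⟩) ?_
      · ext x
        rw [hmem a x]; rfl
      · intro a a' h
        have h := congrArg Subtype.val h
        ext1 x
        have h := LinearMap.congr_fun h x
        exact e.injective (Subtype.val_injective h)
    · intro u _
      refine (Set.ncard_le_ncard (t := {u.toAddMonoidHom.range}) ?_).trans_eq (Set.ncard_singleton _)
      rintro S ⟨_, h⟩
      exact h.symm
  refine Nat.le_of_mul_le_mul_right ?_ hg
  set N := {S : AddSubgroup V | Nat.card S = p ^ ℓ}.ncard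
  set b := {S : AddSubgroup V | Nat.card S = p ^ ℓ ∧ bad S}.ncard
  calc b * p ^ (n * ℓ) * g ≤ b * (2 * I.ncard) * g := by gcongr
    _ = 2 * (b * g) * I.ncard := by ring
    _ ≤ 2 * (B.ncard * 1) * (N * g) := by gcongr
    _ = _ := by ring

end Subgroups

end HeisNursery

/-! ### Genericity conditions on S and first union bounds -/

namespace HeisNursery
open Matrix Module

/-- Kinder parameters: additive subgroups of the matrix space, of order `p ^ ℓ`. -/
abbrev Gr (a b : ℕ) (K : Type*) [Field K] (m : ℕ) : Set (AddSubgroup (Matrix (Fin a) (Fin b) K)) :=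
  {S | Nat.card S = m}

section
variable {a b : ℕ} {K : Type*} [Field K]

/-- Ensures that the central elements of the kind lie in the block `W`, so that embeddings respect
this block. -/
def KerTrivial (S : AddSubgroup (Matrix (Fin a) (Fin b) K)) : Prop :=
  ∀ v : Fin b → K, (∀ U ∈ S, U *ᵥ v = 0) → v = 0

/-- Dual form of the statement that the vectors U v span K^a; it lets a matrix be recovered from its
left action on `S`. -/
def SpanTop (S : AddSubgroup (Matrix (Fin a) (Fin b) K)) : Prop :=
  ∀ y : Fin a → K, (∀ U ∈ S, y ᵥ* U = 0) → y = 0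

/-- Serves the case a = 1, where the first components of the preimage of Γ₂ turn out to form a
K-subspace inside `S`. -/
def NoLine (S : AddSubgroup (Matrix (Fin a) (Fin b) K)) : Prop :=
  ∀ U : Matrix (Fin a) (Fin b) K, (∀ k : K, k • U ∈ S) → U = 0

/-- Such a γ is one column of the corner S → M_{b×c}(K) of the projection `J ∘ v` attached to an
embedding. -/
def NoGamma (S : AddSubgroup (Matrix (Fin a) (Fin b) K)) : Prop :=
  ∀ γ : S →+ (Fin b → K), (∀ U U' : S, U.1 *ᵥ γ U' = U'.1 *ᵥ γ U) → γ = 0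

/-- The opposite diagonal corner of that projection is multiplication by such a `d`; the two allowed
values are the swap and the shear. -/
def NoIdem (S : AddSubgroup (Matrix (Fin a) (Fin b) K)) : Prop :=
  ∀ d : Matrix (Fin b) (Fin b) K, d * d = d → (∀ U ∈ S, U * d ∈ S) → d = 0 ∨ d = 1

/-- `S` has a basis over the prime field that is linearly independent over `K`. -/
def HasIndepBasis (p ℓ : ℕ) [Algebra (ZMod p) K] (S : AddSubgroup (Matrix (Fin a) (Fin b) K)) :
    Prop :=
  ∃ u : (Fin ℓ → ZMod p) →ₗ[ZMod p] Matrix (Fin a) (Fin b) K, (∀ x, x ∈ S ↔ ∃ i, u i = x) ∧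
    LinearIndependent K fun i => u (Pi.single i 1)

end

/-- Witnesses come in free orbits of Kˣ, so every `x` that has one has at least q - 1 ≥ q/2 of them.
In the union bounds below this supplies the factor 1/q. -/
theorem ncard_exists_smul_le {K Y α : Type*} [Field K] [Finite K] [AddCommGroup Y] [Module K Y]
    [Finite Y] [Finite α] (I : Set Y) (h0 : (0 : Y) ∉ I)
    (hI : ∀ k : K, k ≠ 0 → ∀ y ∈ I, k • y ∈ I) (R : Y → α → Prop)
    (hR : ∀ k : K, k ≠ 0 → ∀ y x, R y x → R (k • y) x) (m : ℕ)
    (hm : ∀ y ∈ I, {x | R y x}.ncard ≤ m) :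
    {x | ∃ y ∈ I, R y x}.ncard * Nat.card K ≤ 2 * (I.ncard * m) := by
  have h := ncard_mul_le_ncard_mul R I {x | ∃ y ∈ I, R y x} (Nat.card Kˣ) m ?_ hm
  · have h1 : Nat.card K ≤ 2 * Nat.card Kˣ := by
      rw [Nat.card_units]
      have : 1 < Nat.card K := Finite.one_lt_card
      omega
    calc _ ≤ {x | ∃ y ∈ I, R y x}.ncard * (2 * Nat.card Kˣ) := Nat.mul_le_mul_left _ h1
      _ = 2 * ({x | ∃ y ∈ I, R y x}.ncard * Nat.card Kˣ) := by ring
      _ ≤ _ := Nat.mul_le_mul_left _ h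
  · rintro x ⟨y, hy, hx⟩
    rw [← Nat.card_coe_set_eq]
    refine Nat.card_le_card_of_injective (fun k : Kˣ =>
      ⟨k.1 • y, hI _ k.ne_zero _ hy, hR _ k.ne_zero _ _ hx⟩) ?_
    intro k k' h
    have h : (k.1 : K) • y = k'.1 • y := congrArg Subtype.val h
    have hy0 : y ≠ 0 := fun h => h0 (h ▸ hy)
    exact Units.ext (smul_left_injective K hy0 h)

section
variable {p ℓ : ℕ} [Fact p.Prime]

theorem ncard_linearMap_mem_le {V : Type*} [AddCommGroup V] [Module (ZMod p) V] [Finite V]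
    (N : Set V) :
    {u : (Fin ℓ → ZMod p) →ₗ[ZMod p] V | ∀ x, u x ∈ N}.ncard ≤ N.ncard ^ ℓ := by
  have h : Nat.card (Fin ℓ → N) = N.ncard ^ ℓ := by simp [Nat.card_fun]
  rw [← h, ← Nat.card_coe_set_eq]
  refine Nat.card_le_card_of_injective (fun u i => ⟨u.1 (Pi.single i 1), u.2 _⟩) ?_
  intro u u' huu
  apply Subtype.ext
  refine LinearMap.pi_ext' fun i => LinearMap.ext_ring ?_
  exact congrArg Subtype.val (congrFun huu i)

variable {a b e : ℕ} {K : Type*} [Field K] [Finite K] [Algebra (ZMod p) K]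

omit [Fact p.Prime] [Field K] [Finite K] [Algebra (ZMod p) K] in
theorem natCard_matrix_pow (hK : Nat.card K = p ^ e) :
    Nat.card (Matrix (Fin a) (Fin b) K) = p ^ (a * b * e) := by
  rw [natCard_matrix, hK, ← pow_mul]; ring_nf

/-- q^(abℓ) is the number of all linear maps from F_p^ℓ to the matrix space, so `hC` bounds the
share of `B` among them by C/q; passing to subgroups costs the factor 2. -/
theorem ncard_bad_mul_le (hK : Nat.card K = p ^ e) (hℓ : ℓ < a * b * e)
    (bad : AddSubgroup (Matrix (Fin a) (Fin b) K) → Prop)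
    (B : Set ((Fin ℓ → ZMod p) →ₗ[ZMod p] Matrix (Fin a) (Fin b) K))
    (hB : ∀ S, bad S → ∀ u : (Fin ℓ → ZMod p) →ₗ[ZMod p] Matrix (Fin a) (Fin b) K,
      Function.Injective u → (∀ x, x ∈ S ↔ ∃ i, u i = x) → u ∈ B) (C : ℕ)
    (hC : B.ncard * Nat.card K ≤ C * Nat.card K ^ (a * b * ℓ)) :
    {S ∈ Gr a b K (p ^ ℓ) | bad S}.ncard * Nat.card K ≤ 2 * C * (Gr a b K (p ^ ℓ)).ncard := by
  have h := ncard_subgroups_mul_le (natCard_matrix_pow hK) hℓ B bad hB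
  have e1 : Nat.card K ^ (a * b * ℓ) = p ^ (a * b * e * ℓ) := by
    rw [hK, ← pow_mul]; ring_nf
  rw [e1] at hC
  have hp : 0 < p ^ (a * b * e * ℓ) := pow_pos (Nat.Prime.pos Fact.out) _
  refine Nat.le_of_mul_le_mul_right ?_ hp
  set P := p ^ (a * b * e * ℓ)
  set G := (Gr a b K (p ^ ℓ)).ncard
  change {S : AddSubgroup _ | Nat.card S = p ^ ℓ ∧ bad S}.ncard * P ≤ 2 * B.ncard * G at h
  change {S : AddSubgroup _ | Nat.card S = p ^ ℓ ∧ bad S}.ncard * _ * P ≤ _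
  calc _ = {S : AddSubgroup _ | Nat.card S = p ^ ℓ ∧ bad S}.ncard * P * Nat.card K := by ring
    _ ≤ 2 * B.ncard * G * Nat.card K := by gcongr
    _ = 2 * G * (B.ncard * Nat.card K) := by ring
    _ ≤ 2 * G * (C * P) := by gcongr
    _ = _ := by ring

/-- The events where a nonzero vector satisfies linear conditions with each element of `S`. -/
theorem ncard_bad_vector_mul_le (hK : Nat.card K = p ^ e) (hℓ : ℓ < a * b * e) {d r : ℕ}
    (f : (Fin d → K) → Matrix (Fin a) (Fin b) K →+ (Fin r → K))
    (hf : ∀ v ≠ 0, Function.Surjective (f v))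
    (hsmul : ∀ (k : K) v U, f v U = 0 → f (k • v) U = 0) (hd : d ≤ r * ℓ) :
    {S ∈ Gr a b K (p ^ ℓ) | ∃ v ≠ 0, ∀ U ∈ S, f v U = 0}.ncard * Nat.card K ≤
      4 * (Gr a b K (p ^ ℓ)).ncard := by
  refine ncard_bad_mul_le hK hℓ _ {u | ∃ v ∈ ({0}ᶜ : Set (Fin d → K)), ∀ x, u x ∈ {U | f v U = 0}}
    ?_ 2 ?_
  · rintro S ⟨v, hv, h⟩ u - hu
    exact ⟨v, hv, fun x => h _ ((hu _).2 ⟨x, rfl⟩)⟩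
  · have hq : 0 < Nat.card K := Nat.card_pos
    have h := ncard_exists_smul_le (K := K) ({0}ᶜ : Set (Fin d → K)) (by simp)
      (fun k hk y hy => by simpa [hk] using hy)
      (fun v (u : (Fin ℓ → ZMod p) →ₗ[ZMod p] Matrix (Fin a) (Fin b) K) => ∀ x, u x ∈ {U | f v U = 0})
      (fun k _ v u h x => hsmul k v _ (h x)) (Nat.card K ^ (a * b * ℓ) / Nat.card K ^ (r * ℓ))
      (fun v hv => by
        refine (ncard_linearMap_mem_le _).trans ?_
        rw [Nat.le_div_iff_mul_le (pow_pos hq _), pow_mul, pow_mul, ← mul_pow]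
        have h1 := natCard_ker_mul_of_surjective _ (hf v hv)
        rw [natCard_matrix, Nat.card_fun, Nat.card_fin] at h1
        rw [← h1, ← Nat.card_coe_set_eq]
        rfl)
    refine h.trans (Nat.mul_le_mul_left _ ?_)
    -- There are at most q^d witnesses, while each cuts the number of maps by q^(rℓ); `hd` lets the
    -- union bound close.
    have h2 : ({0}ᶜ : Set (Fin d → K)).ncard ≤ Nat.card K ^ (r * ℓ) := by
      refine (Set.ncard_le_card _).trans ?_
      rw [Nat.card_fun, Nat.card_fin]
      exact Nat.pow_le_pow_right hq hd
    exact (Nat.mul_le_mul_right _ h2).trans (Nat.mul_div_le _ _)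

theorem ncard_not_kerTrivial_mul_le (hK : Nat.card K = p ^ e) (hℓ : ℓ < a * b * e)
    (h : b ≤ a * ℓ) :
    {S ∈ Gr a b K (p ^ ℓ) | ¬ KerTrivial S}.ncard * Nat.card K ≤
      4 * (Gr a b K (p ^ ℓ)).ncard := by
  refine le_trans ?_ (ncard_bad_vector_mul_le hK hℓ (d := b) (r := a)
    (fun v => { toFun := fun U => U *ᵥ v, map_zero' := zero_mulVec _,
                map_add' := fun _ _ => add_mulVec _ _ _ }) ?_ ?_ h)
  · refine Nat.mul_le_mul_right _ (Set.ncard_le_ncard ?_)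
    rintro S ⟨hS, hb⟩
    simp only [KerTrivial, not_forall] at hb
    obtain ⟨v, hv, h0⟩ := hb
    exact ⟨hS, v, h0, hv⟩
  · intro v hv w
    obtain ⟨i, hi⟩ := Function.ne_iff.1 hv
    refine ⟨vecMulVec w (Pi.single i (v i)⁻¹), ?_⟩
    simp only [AddMonoidHom.coe_mk, ZeroHom.coe_mk]
    rw [vecMulVec_mulVec]
    ext j
    simp only [Pi.zero_apply] at hi
    simp [hi]
  · intro k v U hU
    simp only [AddMonoidHom.coe_mk, ZeroHom.coe_mk] at hU ⊢
    rw [mulVec_smul, hU, smul_zero]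

theorem ncard_not_spanTop_mul_le (hK : Nat.card K = p ^ e) (hℓ : ℓ < a * b * e)
    (h : a ≤ b * ℓ) :
    {S ∈ Gr a b K (p ^ ℓ) | ¬ SpanTop S}.ncard * Nat.card K ≤
      4 * (Gr a b K (p ^ ℓ)).ncard := by
  refine le_trans ?_ (ncard_bad_vector_mul_le hK hℓ (d := a) (r := b)
    (fun v => { toFun := fun U => v ᵥ* U, map_zero' := vecMul_zero _,
                map_add' := fun _ _ => vecMul_add _ _ _ }) ?_ ?_ h)
  · refine Nat.mul_le_mul_right _ (Set.ncard_le_ncard ?_)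
    rintro S ⟨hS, hb⟩
    simp only [SpanTop, not_forall] at hb
    obtain ⟨v, hv, h0⟩ := hb
    exact ⟨hS, v, h0, hv⟩
  · intro v hv w
    obtain ⟨i, hi⟩ := Function.ne_iff.1 hv
    refine ⟨vecMulVec (Pi.single i (v i)⁻¹) w, ?_⟩
    simp only [AddMonoidHom.coe_mk, ZeroHom.coe_mk]
    rw [vecMul_vecMulVec]
    ext j
    simp only [Pi.zero_apply] at hi
    simp [hi]
  · intro k v U hU
    simp only [AddMonoidHom.coe_mk, ZeroHom.coe_mk] at hU ⊢
    rw [smul_vecMul, hU, smul_zero]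

theorem ncard_not_noLine_mul_le (hK : Nat.card K = p ^ e) (hℓ : ℓ + a * b ≤ a * b * e)
    (hab : 0 < a * b) :
    {S ∈ Gr a b K (p ^ ℓ) | ¬ NoLine S}.ncard * Nat.card K ≤
      4 * (Gr a b K (p ^ ℓ)).ncard := by
  classical
  have hp : p.Prime := Fact.out
  let V := Matrix (Fin a) (Fin b) K
  let X := Fin ℓ → ZMod p
  have hcK : Nat.card (K →ₗ[ZMod p] X) = p ^ (ℓ * e) := by
    have hfin : finrank (ZMod p) K = e := by
      have h := Module.natCard_eq_pow_finrank (K := ZMod p) (V := K)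
      rw [hK, Nat.card_zmod] at h
      exact (Nat.pow_right_injective hp.two_le h).symm
    rw [Module.natCard_eq_pow_finrank (K := ZMod p), Nat.card_zmod, Module.finrank_linearMap, hfin]
    simp [X, mul_comm]
  have hcKV : Nat.card (K →ₗ[ZMod p] V) = p ^ (a * b * e * e) := by
    have hfin : finrank (ZMod p) K = e := by
      have h := Module.natCard_eq_pow_finrank (K := ZMod p) (V := K)
      rw [hK, Nat.card_zmod] at h
      exact (Nat.pow_right_injective hp.two_le h).symm
    have hfinV : finrank (ZMod p) V = a * b * e := by
      have h := Module.natCard_eq_pow_finrank (K := ZMod p) (V := V)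
      rw [natCard_matrix_pow hK, Nat.card_zmod] at h
      exact (Nat.pow_right_injective hp.two_le h).symm
    rw [Module.natCard_eq_pow_finrank (K := ZMod p), Nat.card_zmod, Module.finrank_linearMap, hfin, hfinV]
    ring_nf
  have hcXV : Nat.card (X →ₗ[ZMod p] V) = p ^ (a * b * e * ℓ) := by
    have hfinV : finrank (ZMod p) V = a * b * e := by
      have h := Module.natCard_eq_pow_finrank (K := ZMod p) (V := V)
      rw [natCard_matrix_pow hK, Nat.card_zmod] at h
      exact (Nat.pow_right_injective hp.two_le h).symm
    rw [Module.natCard_eq_pow_finrank (K := ZMod p), Nat.card_zmod, Module.finrank_linearMap, hfinV]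
    simp [X, mul_comm]
  -- A witness is a nonzero U with an injective A : K → F_p^ℓ locating the line K U in the source.
  -- It prescribes `u` on an e-dimensional subspace, against at most p^((ℓ+ab)e) pairs; this is the
  -- use of `hℓ`. The group Kˣ acts on the pairs by rescaling U and precomposing A.
  let R : (V × (K →ₗ[ZMod p] X)) → (X →ₗ[ZMod p] V) → Prop := fun t u => ∀ k : K, u (t.2 k) = k • t.1
  let I : Set (V × (K →ₗ[ZMod p] X)) := {t | t.1 ≠ 0 ∧ Function.Injective t.2}
  let B : Set (X →ₗ[ZMod p] V) := {u | Function.Injective u ∧ ∃ t ∈ I, R t u}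
  refine ncard_bad_mul_le hK (by omega) _ B ?_ 2 ?_
  · rintro S hb u hu hS
    simp only [NoLine, not_forall] at hb
    obtain ⟨U, hU, hU0⟩ := hb
    let L : K →ₗ[ZMod p] V := LinearMap.toSpanSingleton K V U |>.restrictScalars (ZMod p)
    let A : K →ₗ[ZMod p] X := (LinearEquiv.ofInjective u hu).symm.toLinearMap ∘ₗ
      L.codRestrict (LinearMap.range u) (fun k => (hS _).1 (hU k))
    have hA : ∀ k, u (A k) = k • U := by
      intro k
      have := congrArg Subtype.val ((LinearEquiv.ofInjective u hu).apply_symm_apply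
        (L.codRestrict (LinearMap.range u) (fun k => (hS _).1 (hU k)) k))
      exact this
    refine ⟨hu, (U, A), ⟨hU0, fun k k' h => ?_⟩, hA⟩
    have : k • U = k' • U := by rw [← hA, ← hA]; exact congrArg u h
    exact smul_left_injective K hU0 this
  · have h := ncard_mul_le_ncard_mul R I B (Nat.card Kˣ) (p ^ (a * b * e * ℓ) / p ^ (a * b * e * e)) ?_ ?_
    · have h1 : Nat.card K ≤ 2 * Nat.card Kˣ := by
        rw [Nat.card_units]
        have : 1 < Nat.card K := Finite.one_lt_card
        omega
      have h2 : I.ncard ≤ p ^ (a * b * e * e) := by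
        refine (Set.ncard_le_card _).trans ?_
        rw [Nat.card_prod, natCard_matrix_pow hK, hcK, ← pow_add]
        refine Nat.pow_le_pow_right hp.pos ?_
        calc a * b * e + ℓ * e = (ℓ + a * b) * e := by ring
          _ ≤ _ := Nat.mul_le_mul_right _ hℓ
      have h3 : Nat.card K ^ (a * b * ℓ) = p ^ (a * b * e * ℓ) := by
        rw [hK, ← pow_mul]; ring_nf
      calc _ ≤ B.ncard * (2 * Nat.card Kˣ) := Nat.mul_le_mul_left _ h1
        _ = 2 * (B.ncard * Nat.card Kˣ) := by ring
        _ ≤ 2 * (p ^ (a * b * e * e) * (p ^ (a * b * e * ℓ) / p ^ (a * b * e * e))) :=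
          Nat.mul_le_mul_left _ (h.trans (Nat.mul_le_mul_right _ h2))
        _ ≤ 2 * _ := Nat.mul_le_mul_left _ ((Nat.mul_div_le _ _).trans_eq h3.symm)
    · rintro u ⟨hu, ⟨U, A⟩, ⟨hU0, hA⟩, hR⟩
      rw [← Nat.card_coe_set_eq]
      refine Nat.card_le_card_of_injective (fun k : Kˣ =>
        ⟨(k.1 • U, A ∘ₗ (LinearMap.mulLeft K k.1).restrictScalars (ZMod p)), ⟨⟨?_, ?_⟩, ?_⟩⟩) ?_
      · simpa using hU0
      · exact hA.comp (mul_right_injective₀ k.ne_zero)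
      · intro c
        change u (A (k.1 * c)) = c • k.1 • U
        rw [hR, smul_smul, mul_comm]
      · intro k k' h
        have h : (k.1 : K) • U = k'.1 • U := congrArg (fun t => t.1.1) h
        exact Units.ext (smul_left_injective K hU0 h)
    · rintro ⟨U, A⟩ ⟨hU0, hA⟩
      rw [Nat.le_div_iff_mul_le (pow_pos hp.pos _)]
      let f : (X →ₗ[ZMod p] V) →+ (K →ₗ[ZMod p] V) :=
        { toFun := fun u => u ∘ₗ A, map_zero' := LinearMap.zero_comp _,
          map_add' := fun _ _ => LinearMap.add_comp _ _ _ }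
      have hf : Function.Surjective f := by
        intro w
        obtain ⟨A', hA'⟩ := LinearMap.exists_leftInverse_of_injective A (LinearMap.ker_eq_bot.2 hA)
        refine ⟨w ∘ₗ A', ?_⟩
        change (w ∘ₗ A') ∘ₗ A = w
        rw [LinearMap.comp_assoc, hA', LinearMap.comp_id]
      have h1 := natCard_ker_mul_of_surjective f hf
      rw [hcKV, hcXV] at h1
      rw [← h1]
      refine Nat.mul_le_mul_right _ (le_trans ?_ (ncard_fiber_le_natCard_ker f
        ((LinearMap.toSpanSingleton K V U).restrictScalars (ZMod p))))
      refine Set.ncard_le_ncard ?_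
      intro u hu
      ext1 k
      exact hu k

/-- A dependency is a nonzero `c` in K^ℓ, taken up to scaling, and it confines `u` to a fraction
q^(-ab) of all maps; ℓ ≤ ab balances the two. -/
theorem ncard_not_hasIndepBasis_mul_le (hK : Nat.card K = p ^ e) (hℓ : ℓ < a * b * e)
    (hab : ℓ ≤ a * b) :
    {S ∈ Gr a b K (p ^ ℓ) | ¬ HasIndepBasis p ℓ S}.ncard * Nat.card K ≤
      4 * (Gr a b K (p ^ ℓ)).ncard := by
  classical
  let V := Matrix (Fin a) (Fin b) K
  let X := Fin ℓ → ZMod p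
  let f : (Fin ℓ → K) → (X →ₗ[ZMod p] V) →+ V := fun c =>
    { toFun := fun u => ∑ i, c i • u (Pi.single i 1), map_zero' := by simp,
      map_add' := fun u v => by simp [Finset.sum_add_distrib] }
  refine ncard_bad_mul_le hK hℓ _ {u | ∃ c ∈ ({0}ᶜ : Set (Fin ℓ → K)), f c u = 0} ?_ 2 ?_
  · intro S hb u hu hS
    have : ¬ LinearIndependent K fun i => u (Pi.single i 1) := fun h => hb ⟨u, hS, h⟩
    rw [Fintype.linearIndependent_iff] at this
    push Not at this
    obtain ⟨c, hc, i, hi⟩ := this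
    exact ⟨c, fun h0 => hi (by rw [h0]; rfl), hc⟩
  · have hq : 0 < Nat.card K := Nat.card_pos
    have hcXV : Nat.card (X →ₗ[ZMod p] V) = Nat.card K ^ (a * b * ℓ) := by
      rw [Nat.card_congr ((Pi.basisFun (ZMod p) (Fin ℓ)).constr (ZMod p)).symm.toEquiv]
      rw [Nat.card_fun, Nat.card_fin, natCard_matrix, ← pow_mul]
    have h := ncard_exists_smul_le (K := K) ({0}ᶜ : Set (Fin ℓ → K)) (by simp)
      (fun k hk y hy => by simpa [hk] using hy) (fun c u => f c u = 0)
      (fun k _ c u h => by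
        change ∑ i, (k • c) i • u (Pi.single i 1) = 0
        simp only [Pi.smul_apply, smul_assoc]
        rw [← Finset.smul_sum]
        exact (congrArg (k • ·) h).trans (smul_zero k))
      (Nat.card K ^ (a * b * ℓ) / Nat.card K ^ (a * b))
      (fun c hc => by
        rw [Nat.le_div_iff_mul_le (pow_pos hq _)]
        have hs : Function.Surjective (f c) := by
          intro w
          obtain ⟨i, hi⟩ := Function.ne_iff.1 hc
          refine ⟨(Pi.basisFun (ZMod p) (Fin ℓ)).constr (ZMod p) (Pi.single i ((c i)⁻¹ • w)), ?_⟩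
          change ∑ j, c j • ((Pi.basisFun (ZMod p) (Fin ℓ)).constr (ZMod p) (Pi.single i ((c i)⁻¹ • w))) (Pi.single j 1) = w
          have : ∀ j, ((Pi.basisFun (ZMod p) (Fin ℓ)).constr (ZMod p) (Pi.single i ((c i)⁻¹ • w)))
              (Pi.single j 1) = (Pi.single i ((c i)⁻¹ • w) : Fin ℓ → V) j := by
            intro j
            rw [← Pi.basisFun_apply, Module.Basis.constr_basis]
          simp only [this]
          rw [Finset.sum_eq_single i (fun j _ hj => by simp [hj]) (by simp)]
          rw [Pi.single_eq_same, smul_smul, mul_inv_cancel₀ hi, one_smul]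
        have h1 := natCard_ker_mul_of_surjective _ hs
        rw [natCard_matrix, hcXV] at h1
        rw [← h1, ← Nat.card_coe_set_eq]
        rfl)
    refine h.trans (Nat.mul_le_mul_left _ ?_)
    have h2 : ({0}ᶜ : Set (Fin ℓ → K)).ncard ≤ Nat.card K ^ (a * b) := by
      refine (Set.ncard_le_card _).trans ?_
      rw [Nat.card_fun, Nat.card_fin]
      exact Nat.pow_le_pow_right hq hab
    exact (Nat.mul_le_mul_right _ h2).trans (Nat.mul_div_le _ _)

end
end HeisNursery

/-! ### Symmetric products and the rarity of nonzero γ -/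

namespace HeisNursery
open Matrix Module

section Sym
variable {F : Type*} [Field F] [Finite F]

omit [Field F] in
theorem ncard_symmetric_le (s : ℕ) :
    {z : Matrix (Fin s) (Fin s) F | zᵀ = z}.ncard ≤ Nat.card F ^ (s + 1).choose 2 := by
  have h : Nat.card (Sym2 (Fin s) → F) = Nat.card F ^ (s + 1).choose 2 := by
    rw [Nat.card_fun, Nat.card_eq_fintype_card (α := Sym2 (Fin s)), Sym2.card, Fintype.card_fin]
  rw [← h, ← Nat.card_coe_set_eq]
  refine Nat.card_le_card_of_injective (fun z => Sym2.lift ⟨fun i j => z.1 i j, fun i j => ?_⟩) ?_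
  · exact congrFun (congrFun z.2.symm i) j
  · intro z z' h
    apply Subtype.ext
    ext i j
    exact congrFun h s(i, j)

/-- Write G = x y with y y' = 1. Symmetry of w G forces w x = yᵀ zᵀ for the symmetric matrix z = y'ᵀ
w x, so w x is confined to q^(s(s+1)/2) values, where s is the rank of G. -/
theorem ncard_mul_symmetric_le {b ℓ : ℕ} (G : Matrix (Fin b) (Fin ℓ) F) :
    {w : Matrix (Fin ℓ) (Fin b) F | (w * G)ᵀ = w * G}.ncard * Nat.card F ^ (ℓ * G.rank) ≤
      Nat.card F ^ (ℓ * b + (G.rank + 1).choose 2) := by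
  obtain ⟨x, y, hG, hx, ⟨y', hy'⟩⟩ := exists_rank_factorization G
  let N0 := {Y : Matrix (Fin ℓ) (Fin b) F | Y * x = 0}.ncard
  have key : ∀ w : Matrix (Fin ℓ) (Fin b) F, (w * G)ᵀ = w * G →
      w * x = yᵀ * (y'ᵀ * (w * x))ᵀ := by
    intro w hw
    rw [← hG, ← Matrix.mul_assoc] at hw
    calc w * x = w * x * y * y' := by rw [Matrix.mul_assoc, hy', Matrix.mul_one]
      _ = (w * x * y)ᵀ * y' := by rw [hw]
      _ = _ := by simp only [transpose_mul, transpose_transpose, Matrix.mul_assoc]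
  have h := ncard_mul_le_ncard_mul
    (fun (z : Matrix (Fin G.rank) (Fin G.rank) F) (w : Matrix (Fin ℓ) (Fin b) F) =>
      (w * G)ᵀ = w * G ∧ y'ᵀ * (w * x) = z) {z | zᵀ = z}
    {w : Matrix (Fin ℓ) (Fin b) F | (w * G)ᵀ = w * G} 1 N0 ?_ ?_
  · have h1 := natCard_annihilator_mul ℓ x hx
    have h2 := ncard_symmetric_le (F := F) G.rank
    rw [mul_one] at h
    calc _ ≤ {z : Matrix (Fin G.rank) (Fin G.rank) F | zᵀ = z}.ncard * N0 * Nat.card F ^ (ℓ * G.rank) :=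
          Nat.mul_le_mul_right _ h
      _ = {z : Matrix (Fin G.rank) (Fin G.rank) F | zᵀ = z}.ncard * (N0 * Nat.card F ^ (ℓ * G.rank)) := by ring
      _ ≤ Nat.card F ^ (G.rank + 1).choose 2 * Nat.card F ^ (ℓ * b) := by
          rw [h1]; exact Nat.mul_le_mul_right _ h2
      _ = _ := by rw [← pow_add, add_comm]
  · intro w hw
    rw [Nat.one_le_iff_ne_zero, ← Nat.pos_iff_ne_zero, Set.ncard_pos]
    refine ⟨y'ᵀ * (w * x), ?_, hw, rfl⟩
    have h3 : y'ᵀ * (w * x) = y'ᵀ * (w * G) * y' := by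
      have h4 : w * G = w * x * y := by rw [Matrix.mul_assoc, hG]
      rw [h4, Matrix.mul_assoc, Matrix.mul_assoc (w * x), hy', Matrix.mul_one]
    change (y'ᵀ * (w * x))ᵀ = _
    rw [h3, transpose_mul, transpose_mul, transpose_transpose, show (w * G)ᵀ = w * G from hw,
      ← Matrix.mul_assoc]
  · intro z _
    refine le_trans (Set.ncard_le_ncard ?_) (ncard_mul_eq_le ℓ x (yᵀ * zᵀ))
    rintro w ⟨hw, rfl⟩
    exact key w hw

end Sym

section
variable {p ℓ : ℕ} [Fact p.Prime] {a b e : ℕ} {K : Type*} [Field K] [Finite K] [Algebra (ZMod p) K]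

/-- Let G have the columns γ(u e_i). For each of the `a` row indices, the corresponding rows of the
matrices u e_i form an ℓ × b matrix w with w G symmetric, so the bound for one w is raised to the
power a. The matrices G are then summed rank by rank. -/
theorem ncard_not_noGamma_mul_le (hK : Nat.card K = p ^ e) (hℓ : ℓ < a * b * e)
    (ha : 2 ≤ a) (h : a * (b + 1) + 2 * ℓ ≤ 2 * a * ℓ) :
    {S ∈ Gr a b K (p ^ ℓ) | ¬ NoGamma S}.ncard * Nat.card K ≤
      16 * b * (Gr a b K (p ^ ℓ)).ncard := by
  classical
  let V := Matrix (Fin a) (Fin b) K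
  let X := Fin ℓ → ZMod p
  let R : Matrix (Fin b) (Fin ℓ) K → (X →ₗ[ZMod p] V) → Prop := fun G u =>
    ∀ i j, u (Pi.single i 1) *ᵥ (fun k => G k j) = u (Pi.single j 1) *ᵥ (fun k => G k i)
  let I : ℕ → Set (Matrix (Fin b) (Fin ℓ) K) := fun s => {G | G.rank = s}
  let B : ℕ → Set (X →ₗ[ZMod p] V) := fun s => {u | ∃ G ∈ I s, R G u}
  have hq : 0 < Nat.card K := Nat.card_pos
  set q := Nat.card K with hqdef
  have hB : ∀ s ∈ Finset.Icc 1 b, (B s).ncard * q ≤ 8 * q ^ (a * b * ℓ) := by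
    intro s hs
    rw [Finset.mem_Icc] at hs
    have hfib : ∀ G ∈ I s, {u | R G u}.ncard ≤
        q ^ (a * (ℓ * b + (s + 1).choose 2)) / q ^ (a * (ℓ * s)) := by
      rintro G rfl
      rw [Nat.le_div_iff_mul_le (pow_pos hq _)]
      have h1 := ncard_mul_symmetric_le G
      have h2 : {u | R G u}.ncard ≤
          {w : Matrix (Fin ℓ) (Fin b) K | (w * G)ᵀ = w * G}.ncard ^ a := by
        have h3 : Nat.card (Fin a → {w : Matrix (Fin ℓ) (Fin b) K | (w * G)ᵀ = w * G}) =
          {w : Matrix (Fin ℓ) (Fin b) K | (w * G)ᵀ = w * G}.ncard ^ a := by simp [Nat.card_fun]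
        rw [← h3, ← Nat.card_coe_set_eq]
        refine Nat.card_le_card_of_injective
          (fun u α => ⟨Matrix.of fun i k => u.1 (Pi.single i 1) α k, ?_⟩) ?_
        · ext i j
          exact congrFun (u.2 j i) α
        · intro u u' huu
          apply Subtype.ext
          refine LinearMap.pi_ext' fun i => LinearMap.ext_ring ?_
          ext α k
          exact congrFun (congrFun (congrArg Subtype.val (congrFun huu α)) i) k
      calc _ ≤ _ := Nat.mul_le_mul_right _ h2
        _ = ({w : Matrix (Fin ℓ) (Fin b) K | (w * G)ᵀ = w * G}.ncard * q ^ (ℓ * G.rank)) ^ a := by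
          rw [mul_pow, ← pow_mul q]; ring_nf
        _ ≤ _ := Nat.pow_le_pow_left h1 _
        _ = _ := by rw [← pow_mul, ← hqdef]; ring_nf
    have h1 := ncard_exists_smul_le (K := K) (I s) (by
        simp only [I, Set.mem_ofPred_eq, Matrix.rank_zero]; omega)
      (fun k hk G hG => by
        simp only [I, Set.mem_ofPred_eq] at hG ⊢
        rw [← hG]
        rw [smul_eq_diagonal_mul]
        exact rank_mul_eq_right_of_isUnit_det _ _ (by simp [hk]))
      R (fun k _ G u hu i j => by
        have := congrArg (k • ·) (hu i j)
        simp only [← mulVec_smul] at this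
        exact this) _ hfib
    have h2 := ncard_rank_mul_le (F := K) b ℓ s
    refine Nat.le_of_mul_le_mul_right ?_ (show 0 < q ^ (s * s) * q ^ (a * (ℓ * s)) by positivity)
    have h3 : s * (b + ℓ) + a * (s + 1).choose 2 ≤ s * s + a * (ℓ * s) := by
      have h5 : 2 * (s + 1).choose 2 = s * (s + 1) := by
        rw [Nat.choose_two_right, Nat.add_sub_cancel, Nat.mul_div_cancel' ]
        · ring
        · rw [mul_comm]; exact (Nat.even_mul_succ_self s).two_dvd
      -- As a ≥ 2, the extreme case is s = b, where the inequality is exactly `h`.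
      have h6 : 2 * (b + ℓ) + a * (s + 1) ≤ 2 * s + 2 * a * ℓ := by
        obtain ⟨a', rfl⟩ := Nat.exists_eq_add_of_le ha
        nlinarith [Nat.mul_le_mul_left a' hs.2]
      nlinarith [Nat.mul_le_mul_left s h6]
    calc (B s).ncard * q * (q ^ (s * s) * q ^ (a * (ℓ * s)))
        ≤ 2 * ((I s).ncard * (q ^ (a * (ℓ * b + (s + 1).choose 2)) / q ^ (a * (ℓ * s)))) *
          (q ^ (s * s) * q ^ (a * (ℓ * s))) := Nat.mul_le_mul_right _ h1
      _ = 2 * ((I s).ncard * q ^ (s * s)) *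
          (q ^ (a * (ℓ * b + (s + 1).choose 2)) / q ^ (a * (ℓ * s)) * q ^ (a * (ℓ * s))) := by ring
      _ ≤ 2 * (4 * q ^ (s * (b + ℓ))) * q ^ (a * (ℓ * b + (s + 1).choose 2)) :=
        Nat.mul_le_mul (Nat.mul_le_mul_left _ h2) (Nat.div_mul_le_self _ _)
      _ = 8 * q ^ (s * (b + ℓ) + a * (s + 1).choose 2 + a * b * ℓ) := by
        rw [pow_add, pow_add, mul_add, pow_add]; ring_nf
      _ ≤ 8 * q ^ (s * s + a * (ℓ * s) + a * b * ℓ) := by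
        gcongr
      _ = _ := by rw [pow_add, pow_add]; ring
  have := ncard_bad_mul_le hK hℓ (fun S => ¬ NoGamma S) (⋃ s ∈ Finset.Icc 1 b, B s) ?_ (8 * b) ?_
  · rw [show 16 * b = 2 * (8 * b) by ring]; exact this
  · intro S hb u hu hS
    simp only [NoGamma, not_forall] at hb
    obtain ⟨γ, hγ, h0⟩ := hb
    have hmem : ∀ x, u x ∈ S := fun x => (hS _).2 ⟨x, rfl⟩
    let G : Matrix (Fin b) (Fin ℓ) K := Matrix.of fun k i => γ ⟨u (Pi.single i 1), hmem _⟩ k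
    have hG : G ≠ 0 := by
      intro hG
      apply h0
      let g : X →+ (Fin b → K) := γ.comp (u.toAddMonoidHom.codRestrict S hmem)
      have hg : ∀ x, g x = 0 := by
        have : g.toZModLinearMap p = 0 := by
          refine LinearMap.pi_ext' fun i => LinearMap.ext_ring ?_
          ext k
          exact congrFun (congrFun hG k) i
        intro x
        exact LinearMap.congr_fun this x
      ext ⟨U, hU⟩ : 1
      obtain ⟨x, rfl⟩ := (hS U).1 hU
      exact hg x
    simp only [Set.mem_iUnion]
    refine ⟨G.rank, Finset.mem_Icc.2 ⟨?_, ?_⟩, G, rfl, ?_⟩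
    · rw [Nat.one_le_iff_ne_zero]
      intro h0
      obtain ⟨x, y, hxy, -⟩ := exists_rank_factorization G
      apply hG
      rw [← hxy]
      ext i j
      rw [mul_apply]
      apply Finset.sum_eq_zero
      intro t
      exact (Fin.cast h0 t).elim0
    · simpa using G.rank_le_card_height
    · intro i j
      exact hγ ⟨u (Pi.single i 1), hmem _⟩ ⟨u (Pi.single j 1), hmem _⟩
  · calc _ ≤ (∑ s ∈ Finset.Icc 1 b, (B s).ncard) * q :=
          Nat.mul_le_mul_right _ (Finset.set_ncard_biUnion_le _ _)
      _ ≤ ∑ s ∈ Finset.Icc 1 b, 8 * q ^ (a * b * ℓ) := by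
          rw [Finset.sum_mul]; exact Finset.sum_le_sum hB
      _ = _ := by simp; ring

end
end HeisNursery

/-! ### Idempotents and nilpotents that preserve S -/

namespace HeisNursery
open Matrix Module

/-- `c` nilpotent operators of rank two, one for each nonzero scalar, all preserving `S`. -/
def HasNilpotents {a b : ℕ} {K : Type*} [Field K] (m k : ℕ)
    (S : AddSubgroup (Matrix (Fin a) (Fin b) K)) : Prop :=
  ∃ Z : Kˣ → Matrix (Fin a) (Fin a) K, Function.Injective Z ∧ ∀ t, Z t * Z t = 0 ∧
    (Z t).rank = 2 ∧ (∀ U ∈ S, Z t * U ∈ S) ∧ {U | U ∈ S ∧ Z t * U = 0}.ncard * k = m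

section
variable {p ℓ : ℕ} [Fact p.Prime]

/-- The two subspaces need not span: `h3` only asks that the restrictions determine `u` within `T`.
The nilpotent count uses this freedom. -/
theorem ncard_linearMap_le_of_pair {V : Type*} [AddCommGroup V] [Module (ZMod p) V] [Finite V]
    (T : Set ((Fin ℓ → ZMod p) →ₗ[ZMod p] V)) (P P' : Submodule (ZMod p) (Fin ℓ → ZMod p))
    (N N' : Set V) (h1 : ∀ u ∈ T, ∀ x ∈ P, u x ∈ N) (h2 : ∀ u ∈ T, ∀ x ∈ P', u x ∈ N')
    (h3 : ∀ u ∈ T, ∀ u' ∈ T, (∀ x ∈ P, u x = u' x) → (∀ x ∈ P', u x = u' x) → u = u') :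
    T.ncard ≤ N.ncard ^ finrank (ZMod p) P * N'.ncard ^ finrank (ZMod p) P' := by
  have h : Nat.card ((Fin (finrank (ZMod p) P) → N) × (Fin (finrank (ZMod p) P') → N')) =
      N.ncard ^ finrank (ZMod p) P * N'.ncard ^ finrank (ZMod p) P' := by
    simp [Nat.card_fun, Nat.card_prod]
  let v := finBasis (ZMod p) P
  let v' := finBasis (ZMod p) P'
  rw [← h, ← Nat.card_coe_set_eq]
  refine Nat.card_le_card_of_injective (fun u =>
    (fun i => ⟨u.1 (v i), h1 _ u.2 _ (v i).2⟩, fun i => ⟨u.1 (v' i), h2 _ u.2 _ (v' i).2⟩)) ?_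
  rintro ⟨u, hu⟩ ⟨u', hu'⟩ huu
  simp only [Prod.mk.injEq] at huu
  apply Subtype.ext
  refine h3 u hu u' hu' (fun x hx => ?_) (fun x hx => ?_)
  · have : u ∘ₗ P.subtype = u' ∘ₗ P.subtype :=
      v.ext fun i => congrArg Subtype.val (congrFun huu.1 i)
    exact LinearMap.congr_fun this ⟨x, hx⟩
  · have : u ∘ₗ P'.subtype = u' ∘ₗ P'.subtype :=
      v'.ext fun i => congrArg Subtype.val (congrFun huu.2 i)
    exact LinearMap.congr_fun this ⟨x, hx⟩

theorem rank_eq_finrank_range_mulVecLin {F : Type*} [Field F] {n : ℕ} (A : Matrix (Fin n) (Fin n) F) :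
    finrank F (LinearMap.range A.mulVecLin) = A.rank := rfl

theorem finrank_ker_mulVecLin {F : Type*} [Field F] {n : ℕ} (A : Matrix (Fin n) (Fin n) F) :
    finrank F (LinearMap.ker A.mulVecLin) + A.rank = n := by
  have := LinearMap.finrank_range_add_finrank_ker A.mulVecLin
  rw [rank_eq_finrank_range_mulVecLin] at this
  simp at this
  omega

variable {a b e : ℕ} {K : Type*} [Field K] [Finite K] [Algebra (ZMod p) K]

theorem ncard_mul_rank_le {r : ℕ} {d : Matrix (Fin b) (Fin b) K}
    (hr : d.rank = r) :
    {U : Matrix (Fin a) (Fin b) K | U * d = U}.ncard ≤ Nat.card K ^ (a * r) ∧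
    {U : Matrix (Fin a) (Fin b) K | U * d = 0}.ncard * Nat.card K ^ (a * r) =
      Nat.card K ^ (a * b) := by
  subst hr
  obtain ⟨x, y, hxy, hx, ⟨y', hy⟩⟩ := exists_rank_factorization d
  constructor
  · rw [← natCard_matrix (F := K), ← Nat.card_coe_set_eq]
    refine Nat.card_le_card_of_injective (fun U => U.1 * x) ?_
    rintro ⟨U, hU⟩ ⟨U', hU'⟩ h
    simp only [Set.mem_ofPred_eq] at hU hU'
    have h : U * x = U' * x := h
    apply Subtype.ext
    change U = U'
    have h5 : U * d = U' * d := by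
      calc U * d = U * (x * y) := by rw [hxy]
        _ = U' * (x * y) := by rw [← Matrix.mul_assoc, h, Matrix.mul_assoc]
        _ = U' * d := by rw [hxy]
    rw [← hU, ← hU', h5]
  · rw [← natCard_annihilator_mul a x hx]
    congr 2
    ext U
    simp only [Set.mem_ofPred_eq]
    constructor
    · intro h
      have h6 : U * x = U * (x * y) * y' := by
        rw [Matrix.mul_assoc, Matrix.mul_assoc x, hy, Matrix.mul_one]
      rw [h6, hxy, h, Matrix.zero_mul]
    · intro h
      have h6 : U * d = U * (x * y) := by rw [hxy]
      rw [h6, ← Matrix.mul_assoc, h, Matrix.zero_mul]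

omit [Finite K] in
theorem ncard_mul_left_ker {r : ℕ} {Z : Matrix (Fin a) (Fin a) K} (hr : Z.rank = r) :
    {U : Matrix (Fin a) (Fin b) K | Z * U = 0}.ncard * Nat.card K ^ (b * r) =
      Nat.card K ^ (a * b) := by
  subst hr
  obtain ⟨x, y, hxy, ⟨x', hx⟩, ⟨y', hy⟩⟩ := exists_rank_factorization Z
  have h := natCard_annihilator_mul b yᵀ ⟨y'ᵀ, by rw [← transpose_mul, hy, transpose_one]⟩
  rw [mul_comm a b, ← h, ← Set.ncard_image_of_injective _ transpose_injective]
  congr 2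
  ext U
  simp only [Set.mem_image, Set.mem_ofPred_eq]
  constructor
  · rintro ⟨U, hU, rfl⟩
    have h7 : y * U = x' * (x * y * U) := by
      rw [Matrix.mul_assoc x, ← Matrix.mul_assoc x', hx, Matrix.one_mul]
    rw [← transpose_mul, h7, hxy, hU, Matrix.mul_zero, transpose_zero]
  · intro h
    refine ⟨Uᵀ, ?_, transpose_transpose U⟩
    have h8 : y * Uᵀ = 0 := by
      rw [← transpose_inj, transpose_mul, transpose_transpose, transpose_zero, h]
    have h9 : Z * Uᵀ = x * y * Uᵀ := by rw [hxy]
    rw [h9, Matrix.mul_assoc, h8, Matrix.mul_zero]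

/-- An additive operator on `V` preserving the image of `u` is given by a matrix. -/
theorem exists_matrix_conj {V : Type*} [AddCommGroup V] [Module (ZMod p) V]
    (u : (Fin ℓ → ZMod p) →ₗ[ZMod p] V) (hu : Function.Injective u) (f : V →+ V)
    (hf : ∀ x, ∃ y, u y = f (u x)) :
    ∃ A : Matrix (Fin ℓ) (Fin ℓ) (ZMod p), ∀ x, u (A *ᵥ x) = f (u x) := by
  choose g hg using hf
  let G : (Fin ℓ → ZMod p) →+ (Fin ℓ → ZMod p) :=
    { toFun := g
      map_zero' := hu (by rw [hg]; simp)
      map_add' := fun x y => hu (by simp [hg]) }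
  refine ⟨LinearMap.toMatrix' (G.toZModLinearMap p), fun x => ?_⟩
  rw [LinearMap.toMatrix'_mulVec]
  exact hg x

theorem matrix_ext_mulVec {F : Type*} [Field F] {n : ℕ} {A B : Matrix (Fin n) (Fin n) F}
    (h : ∀ x, A *ᵥ x = B *ᵥ x) : A = B :=
  Matrix.toLin'.injective (LinearMap.ext h)

/-- If right multiplication by `d` preserves `S`, it pulls back along `u` to an idempotent A of
F_p^ℓ. Then `u` sends im A to matrices fixed by `d` and ker A to matrices killed by `d`. The maps
are counted for each pair of ranks (r, t). Injectivity is part of the relation because it forces the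
inequalities t ≤ are and ℓ - t ≤ a(b - r)e, without which the numerical hypothesis could not be
invoked. -/
theorem ncard_not_noIdem_mul_le (hK : Nat.card K = p ^ e) (hℓ : ℓ < a * b * e)
    (hnum : ∀ r t, 1 ≤ r → r < b → t ≤ ℓ → t ≤ a * r * e → ℓ ≤ t + a * (b - r) * e →
      2 * r * b * e + 2 * t * ℓ + a * r * t * e + a * b * (ℓ - t) * e + e + (e + 1) / 2 ≤
        2 * r * r * e + 2 * t * t + a * r * (ℓ - t) * e + a * b * ℓ * e) :
    {S ∈ Gr a b K (p ^ ℓ) | ¬ NoIdem S}.ncard * Nat.card K ≤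
      64 * (a * b * b) * (Gr a b K (p ^ ℓ)).ncard := by
  classical
  have hp : p.Prime := Fact.out
  let V := Matrix (Fin a) (Fin b) K
  let X := Fin ℓ → ZMod p
  let I : ℕ → Set (Matrix (Fin b) (Fin b) K) := fun r => {d | d * d = d ∧ d.rank = r}
  let J : ℕ → Set (Matrix (Fin ℓ) (Fin ℓ) (ZMod p)) := fun t => {A | A * A = A ∧ A.rank = t}
  let R : Matrix (Fin b) (Fin b) K × Matrix (Fin ℓ) (Fin ℓ) (ZMod p) → (X →ₗ[ZMod p] V) → Prop :=
    fun t u => Function.Injective u ∧ ∀ x, u (t.2 *ᵥ x) = u x * t.1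
  let B : ℕ × ℕ → Set (X →ₗ[ZMod p] V) := fun s => {u | ∃ t ∈ I s.1 ×ˢ J s.2, R t u}
  have hq : 0 < Nat.card K := Nat.card_pos
  set q := Nat.card K with hqdef
  have hB : ∀ s ∈ Finset.Ico 1 b ×ˢ Finset.range (ℓ + 1),
      (B s).ncard * q * p ^ ((e + 1) / 2) ≤ 16 * q ^ (a * b * ℓ) := by
    rintro ⟨r, t⟩ hs
    simp only [Finset.mem_product, Finset.mem_Ico, Finset.mem_range] at hs
    obtain ⟨⟨hr1, hrb⟩, ht⟩ := hs
    -- inequalities forced by the existence of such a map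
    rcases Set.eq_empty_or_nonempty (B (r, t)) with he | ⟨u0, ⟨d0, A0⟩, ⟨⟨hd0, hdr⟩, hA0, hAr⟩, hu0, hR0⟩
    · rw [he]; simp
    dsimp only at hd0 hdr hA0 hAr hu0 hR0
    have hN := ncard_mul_rank_le (a := a) hdr
    have hN0 : {U : V | U * d0 = 0}.ncard * q ^ (a * r) = q ^ (a * b) := hN.2
    have ht1 : t ≤ a * r * e := by
      have h1 : Nat.card (LinearMap.range A0.mulVecLin) ≤ {U : V | U * d0 = U}.ncard := by
        rw [← Nat.card_coe_set_eq]
        refine Nat.card_le_card_of_injective (fun x => ⟨u0 x.1, ?_⟩) ?_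
        · obtain ⟨x, y, rfl⟩ := x
          change u0 (A0 *ᵥ y) * d0 = u0 (A0 *ᵥ y)
          rw [← hR0, mulVec_mulVec, hA0]
        · intro x y h
          exact Subtype.ext (hu0 (congrArg Subtype.val h))
      rw [Module.natCard_eq_pow_finrank (K := ZMod p), rank_eq_finrank_range_mulVecLin, hAr,
        Nat.card_zmod] at h1
      have h2 := h1.trans hN.1
      rw [← hqdef, hK, ← pow_mul] at h2
      have := (Nat.pow_le_pow_iff_right hp.one_lt).1 h2
      linarith
    have hkerA := finrank_ker_mulVecLin A0
    have ht2 : ℓ ≤ t + a * (b - r) * e := by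
      have h1 : Nat.card (LinearMap.ker A0.mulVecLin) ≤ {U : V | U * d0 = 0}.ncard := by
        rw [← Nat.card_coe_set_eq]
        refine Nat.card_le_card_of_injective (fun x => ⟨u0 x.1, ?_⟩) ?_
        · change u0 x.1 * d0 = 0
          rw [← hR0, show A0 *ᵥ x.1 = 0 from x.2, map_zero]
        · intro x y h
          exact Subtype.ext (hu0 (congrArg Subtype.val h))
      rw [Module.natCard_eq_pow_finrank (K := ZMod p), Nat.card_zmod] at h1
      have h2 := (Nat.mul_le_mul_right (q ^ (a * r)) h1).trans_eq hN0
      rw [hK, ← pow_mul, ← pow_mul, ← pow_add] at h2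
      have h3 := (Nat.pow_le_pow_iff_right hp.one_lt).1 h2
      obtain ⟨b', rfl⟩ := Nat.exists_eq_add_of_lt hrb
      rw [show r + b' + 1 - r = b' + 1 by omega]
      have : a * (r + b' + 1) * e = a * r * e + a * (b' + 1) * e := by ring
      have h4 : e * (a * r) = a * r * e := by ring
      have h5 : a * (r + b' + 1) * e = e * (a * (r + b' + 1)) := by ring
      have h6 : a * r * e = e * (a * r) := by ring
      omega
    have hnum' := hnum r t hr1 hrb (by omega) ht1 ht2
    have hfib : ∀ s ∈ I r ×ˢ J t, {u | R s u}.ncard ≤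
        q ^ (a * r * t) * (q ^ (a * b) / q ^ (a * r)) ^ (ℓ - t) := by
      rintro ⟨d, A⟩ ⟨⟨hd, hdr⟩, hA, hAr⟩
      dsimp only at hd hdr hA hAr
      have hN := ncard_mul_rank_le (a := a) hdr
      have hkA := finrank_ker_mulVecLin A
      refine (ncard_linearMap_le_of_pair {u | R (d, A) u} (LinearMap.range A.mulVecLin)
        (LinearMap.ker A.mulVecLin) {U : V | U * d = U} {U : V | U * d = 0} ?_ ?_ ?_).trans ?_
      · rintro u ⟨-, hu⟩ x ⟨y, rfl⟩
        change u (A *ᵥ y) * d = u (A *ᵥ y)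
        rw [← hu, mulVec_mulVec, hA]
      · rintro u ⟨-, hu⟩ x hx
        change u x * d = 0
        rw [← hu, show A *ᵥ x = 0 from hx, map_zero]
      · rintro u - u' - h1 h2
        refine LinearMap.ext fun z => ?_
        have e1 := h1 (A *ᵥ z) ⟨z, rfl⟩
        have e2 := h2 (z - A *ᵥ z) (by
          change A *ᵥ (z - A *ᵥ z) = 0
          rw [mulVec_sub, mulVec_mulVec, hA, sub_self])
        rw [map_sub, map_sub, e1] at e2
        exact sub_left_injective e2
      · rw [rank_eq_finrank_range_mulVecLin, hAr, show finrank (ZMod p) (LinearMap.ker A.mulVecLin) = ℓ - t by omega,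
          pow_mul]
        refine Nat.mul_le_mul (Nat.pow_le_pow_left hN.1 _) (Nat.pow_le_pow_left ?_ _)
        rw [Nat.le_div_iff_mul_le (pow_pos hq _)]
        exact hN.2.le
    have h1 := ncard_mul_le_ncard_mul R (I r ×ˢ J t) (B (r, t)) 1 _ (fun u hu => by
      rw [Nat.one_le_iff_ne_zero, ← Nat.pos_iff_ne_zero, Set.ncard_pos]
      obtain ⟨s, hs, hRs⟩ := hu
      exact ⟨s, hs, hRs⟩) hfib
    rw [mul_one, Set.ncard_prod] at h1
    have hI := ncard_idempotent_le (F := K) b r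
    have hJ := ncard_idempotent_le (F := ZMod p) ℓ t
    rw [Nat.card_zmod] at hJ
    refine Nat.le_of_mul_le_mul_right ?_ (show 0 < q ^ (2 * r * r) * p ^ (2 * t * t) *
      (q ^ (a * r)) ^ (ℓ - t) from by have := hp.pos; positivity)
    calc _ = (B (r, t)).ncard * (q * p ^ ((e + 1) / 2) * (q ^ (2 * r * r) * p ^ (2 * t * t) *
            (q ^ (a * r)) ^ (ℓ - t))) := by ring
      _ ≤ ((I r).ncard * (J t).ncard * (q ^ (a * r * t) * (q ^ (a * b) / q ^ (a * r)) ^ (ℓ - t))) *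
          (q * p ^ ((e + 1) / 2) * (q ^ (2 * r * r) * p ^ (2 * t * t) *
            (q ^ (a * r)) ^ (ℓ - t))) := Nat.mul_le_mul_right _ h1
      _ = ((I r).ncard * q ^ (2 * r * r)) * ((J t).ncard * p ^ (2 * t * t)) *
          (q ^ (a * r * t) * (q ^ (a * b) / q ^ (a * r) * q ^ (a * r)) ^ (ℓ - t)) *
            (q * p ^ ((e + 1) / 2)) := by rw [mul_pow]; ring
      _ ≤ (4 * q ^ (2 * r * b)) * (4 * p ^ (2 * t * ℓ)) *
          (q ^ (a * r * t) * (q ^ (a * b)) ^ (ℓ - t)) * (q * p ^ ((e + 1) / 2)) := by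
          gcongr
          exact Nat.div_mul_le_self _ _
      _ = 16 * p ^ (2 * r * b * e + 2 * t * ℓ + a * r * t * e + a * b * (ℓ - t) * e + e + (e + 1) / 2) := by
          rw [hK]; simp only [← pow_mul, pow_add]
          rw [mul_comm e (2 * r * b), mul_comm e (a * r * t), mul_comm e (a * b), mul_right_comm (a * b) e]
          ring
      _ ≤ 16 * p ^ (2 * r * r * e + 2 * t * t + a * r * (ℓ - t) * e + a * b * ℓ * e) :=
          Nat.mul_le_mul_left _ (Nat.pow_le_pow_right hp.pos hnum')
      _ = _ := by
          rw [hK]; simp only [← pow_mul, pow_add]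
          rw [mul_comm e (2 * r * r), mul_comm e (a * r), mul_right_comm (a * r) e, mul_comm e (a * b * ℓ)]
          ring
  have := ncard_bad_mul_le hK hℓ (fun S => ¬ NoIdem S)
    (⋃ s ∈ Finset.Ico 1 b ×ˢ Finset.range (ℓ + 1), B s) ?_ (32 * (a * b * b)) ?_
  · rw [show 64 * (a * b * b) = 2 * (32 * (a * b * b)) by ring]; exact this
  · intro S hb u hu hS
    simp only [NoIdem, not_forall, not_or] at hb
    obtain ⟨d, hd, hdS, hd0, hd1⟩ := hb
    obtain ⟨A, hA⟩ := exists_matrix_conj u hu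
      { toFun := fun U => U * d, map_zero' := Matrix.zero_mul _,
        map_add' := fun _ _ => Matrix.add_mul _ _ _ }
      (fun x => (hS _).1 (hdS _ ((hS _).2 ⟨x, rfl⟩)))
    have hA : ∀ x, u (A *ᵥ x) = u x * d := hA
    have hAA : A * A = A := matrix_ext_mulVec fun x => hu (by
      rw [← mulVec_mulVec, hA, hA, Matrix.mul_assoc, hd])
    simp only [Set.mem_iUnion]
    refine ⟨(d.rank, A.rank), ?_, (d, A), ⟨⟨hd, rfl⟩, hAA, rfl⟩, hu, hA⟩
    simp only [Finset.mem_product, Finset.mem_Ico, Finset.mem_range]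
    refine ⟨⟨?_, ?_⟩, ?_⟩
    · rw [Nat.one_le_iff_ne_zero]
      intro h0
      obtain ⟨x, y, hxy, -⟩ := exists_rank_factorization d
      apply hd0
      rw [← hxy]
      ext i j
      rw [mul_apply]
      exact Finset.sum_eq_zero fun t _ => (Fin.cast h0 t).elim0
    · refine lt_of_le_of_ne (by simpa using d.rank_le_card_height) fun h => hd1 ?_
      have hk := finrank_ker_mulVecLin d
      have hk0 : finrank K (LinearMap.ker d.mulVecLin) = 0 := by omega
      rw [Submodule.finrank_eq_zero, LinearMap.ker_eq_bot] at hk0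
      refine matrix_ext_mulVec fun x => hk0 ?_
      change d *ᵥ (d *ᵥ x) = d *ᵥ (1 *ᵥ x)
      rw [mulVec_mulVec, hd, one_mulVec]
    · have : A.rank ≤ ℓ := by simpa using A.rank_le_card_height
      omega
  · have hpk : 0 < p ^ ((e + 1) / 2) := pow_pos hp.pos _
    refine Nat.le_of_mul_le_mul_right ?_ hpk
    -- The number of possible ranks t grows with e. This growth is absorbed by p^((e+1)/2), for
    -- which `hnum` reserves the term (e+1)/2.
    have h1 : ℓ + 1 ≤ a * b * (2 * p ^ ((e + 1) / 2)) := by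
      have : (e + 1) / 2 < p ^ ((e + 1) / 2) := Nat.lt_pow_self hp.one_lt
      have h2 : e ≤ 2 * p ^ ((e + 1) / 2) := by omega
      calc ℓ + 1 ≤ a * b * e := hℓ
        _ ≤ _ := Nat.mul_le_mul_left _ h2
    calc _ ≤ (∑ s ∈ Finset.Ico 1 b ×ˢ Finset.range (ℓ + 1), (B s).ncard) * q * p ^ ((e + 1) / 2) := by
          gcongr; exact Finset.set_ncard_biUnion_le _ _
      _ = ∑ s ∈ Finset.Ico 1 b ×ˢ Finset.range (ℓ + 1), (B s).ncard * q * p ^ ((e + 1) / 2) := by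
          rw [Finset.sum_mul, Finset.sum_mul]
      _ ≤ ∑ s ∈ Finset.Ico 1 b ×ˢ Finset.range (ℓ + 1), 16 * q ^ (a * b * ℓ) :=
          Finset.sum_le_sum hB
      _ = (b - 1) * (ℓ + 1) * (16 * q ^ (a * b * ℓ)) := by simp
      _ ≤ b * (a * b * (2 * p ^ ((e + 1) / 2))) * (16 * q ^ (a * b * ℓ)) := by
          gcongr; omega
      _ = _ := by ring

/-- Each Z t pulls back along `u` to a square-zero matrix A of rank κ over the prime field. The maps
intertwining A with Z are counted, then the pairs (Z, A). -/
theorem ncard_hasNilpotents_mul_le (hK : Nat.card K = p ^ e) (hℓ : ℓ < a * b * e) (κ : ℕ)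
    (hκ : 2 * κ ≤ ℓ)
    (hnum : 4 * a * e + 2 * κ * ℓ + a * b * (ℓ - κ) * e ≤
      8 * e + 2 * κ * κ + 2 * b * (ℓ - 2 * κ) * e + a * b * ℓ * e) :
    {S ∈ Gr a b K (p ^ ℓ) | HasNilpotents (p ^ ℓ) (p ^ κ) S}.ncard * Nat.card K ≤
      64 * (Gr a b K (p ^ ℓ)).ncard := by
  classical
  have hp : p.Prime := Fact.out
  let V := Matrix (Fin a) (Fin b) K
  let X := Fin ℓ → ZMod p
  let I : Set (Matrix (Fin a) (Fin a) K) := {Z | Z * Z = 0 ∧ Z.rank = 2}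
  let J : Set (Matrix (Fin ℓ) (Fin ℓ) (ZMod p)) := {A | A * A = 0 ∧ A.rank = κ}
  let R : Matrix (Fin a) (Fin a) K × Matrix (Fin ℓ) (Fin ℓ) (ZMod p) → (X →ₗ[ZMod p] V) → Prop :=
    fun t u => ∀ x, u (t.2 *ᵥ x) = t.1 * u x
  -- A multiple of Z need not preserve `S`, so scaling gives no orbits of witnesses. The
  -- multiplicity q - 1 comes from the index t in `HasNilpotents` and is built into `B`.
  let B : Set (X →ₗ[ZMod p] V) := {u | Nat.card Kˣ ≤ {t ∈ I ×ˢ J | R t u}.ncard}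
  have hq : 0 < Nat.card K := Nat.card_pos
  set q := Nat.card K with hqdef
  refine ncard_bad_mul_le hK hℓ _ B ?_ 32 ?_
  · rintro S ⟨Z, hZi, hZ⟩ u hu hS
    have hex : ∀ t, ∃ A : Matrix (Fin ℓ) (Fin ℓ) (ZMod p), ∀ x, u (A *ᵥ x) = Z t * u x := fun t =>
      exists_matrix_conj u hu
        { toFun := fun U => Z t * U, map_zero' := Matrix.mul_zero _,
          map_add' := fun _ _ => Matrix.mul_add _ _ _ }
        (fun x => (hS _).1 ((hZ t).2.2.1 _ ((hS _).2 ⟨x, rfl⟩)))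
    choose A hA using hex
    change Nat.card Kˣ ≤ _
    rw [← Nat.card_coe_set_eq]
    refine Nat.card_le_card_of_injective (fun t => ⟨(Z t, A t),
      ⟨⟨(hZ t).1, (hZ t).2.1⟩, ?_, ?_⟩, hA t⟩) ?_
    · refine matrix_ext_mulVec fun x => hu ?_
      change u (_ *ᵥ x) = u (0 *ᵥ x)
      rw [← mulVec_mulVec, hA, hA, ← Matrix.mul_assoc, (hZ t).1, Matrix.zero_mul, zero_mulVec, map_zero]
    · have h1 : Nat.card (LinearMap.ker (A t).mulVecLin) = {U | U ∈ S ∧ Z t * U = 0}.ncard := by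
        rw [← Nat.card_coe_set_eq]
        refine Nat.card_congr (Equiv.ofBijective (fun x => ⟨u x.1, (hS _).2 ⟨_, rfl⟩, ?_⟩) ⟨?_, ?_⟩)
        · rw [← hA, show A t *ᵥ x.1 = 0 from x.2, map_zero]
        · intro x y h
          exact Subtype.ext (hu (congrArg Subtype.val h))
        · rintro ⟨U, hU, hU0⟩
          obtain ⟨x, rfl⟩ := (hS U).1 hU
          refine ⟨⟨x, ?_⟩, rfl⟩
          change A t *ᵥ x = 0
          apply hu
          rw [hA, hU0, map_zero]
      have h2 := (hZ t).2.2.2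
      rw [← h1, Module.natCard_eq_pow_finrank (K := ZMod p), Nat.card_zmod, ← pow_add] at h2
      have h3 := Nat.pow_right_injective hp.two_le h2
      have h4 := finrank_ker_mulVecLin (A t)
      change (A t).rank = κ
      omega
    · intro t t' h
      exact hZi (congrArg (fun s => s.1.1) h)
  · have hfib : ∀ s ∈ I ×ˢ J, {u | R s u}.ncard ≤
        (q ^ (a * b)) ^ κ * (q ^ (a * b) / q ^ (b * 2)) ^ (ℓ - 2 * κ) := by
      rintro ⟨Z, A⟩ ⟨⟨hZ, hZr⟩, hA, hAr⟩
      dsimp only at hZ hZr hA hAr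
      have hN := ncard_mul_left_ker (b := b) hZr
      have hkA := finrank_ker_mulVecLin A
      -- On `C` the map is free; on im A = A C it is forced by u A = Z u; on a complement `D` of im
      -- A in ker A its values are killed by Z.
      obtain ⟨C, hC⟩ := Submodule.exists_isCompl (LinearMap.ker A.mulVecLin)
      have hle : LinearMap.range A.mulVecLin ≤ LinearMap.ker A.mulVecLin := by
        rintro x ⟨y, rfl⟩
        change A *ᵥ (A *ᵥ y) = 0
        rw [mulVec_mulVec, hA, zero_mulVec]
      obtain ⟨D, hD⟩ := Submodule.exists_isCompl
        ((LinearMap.range A.mulVecLin).submoduleOf (LinearMap.ker A.mulVecLin))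
      let D' := D.map (LinearMap.ker A.mulVecLin).subtype
      have hD' : finrank (ZMod p) D' = finrank (ZMod p) D :=
        Submodule.finrank_map_subtype_eq _ _
      have hCf : finrank (ZMod p) C = κ := by
        have := Submodule.finrank_add_eq_of_isCompl hC
        simp at this
        omega
      have hDf : finrank (ZMod p) D = ℓ - 2 * κ := by
        have h1 := Submodule.finrank_add_eq_of_isCompl hD
        have h2 : finrank (ZMod p) ((LinearMap.range A.mulVecLin).submoduleOf (LinearMap.ker A.mulVecLin)) =
            A.rank := (Submodule.submoduleOfEquivOfLe hle).finrank_eq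
        omega
      refine (ncard_linearMap_le_of_pair {u | R (Z, A) u} C D' Set.univ {U : V | Z * U = 0} ?_ ?_ ?_).trans ?_
      · exact fun _ _ _ _ => trivial
      · rintro u hu x ⟨⟨x, hx⟩, -, rfl⟩
        change Z * u x = 0
        rw [← hu x, show A *ᵥ x = 0 from hx, map_zero]
      · rintro u hu u' hu' h1 h2
        have key : ∀ z, (u - u') z = 0 := by
          have hCz : ∀ z ∈ C, (u - u') z = 0 := fun z hz => sub_eq_zero.2 (h1 z hz)
          have hDz : ∀ z ∈ D', (u - u') z = 0 := fun z hz => sub_eq_zero.2 (h2 z hz)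
          have hAz : ∀ z, (u - u') (A *ᵥ z) = Z * (u - u') z := fun z => by
            change u _ - u' _ = Z * (u z - u' z)
            rw [hu, hu', Matrix.mul_sub]
          have hZA : ∀ z ∈ LinearMap.ker A.mulVecLin, (u - u') z = 0 := by
            intro z hz
            obtain ⟨r, hr, d, hd, hrd⟩ := Submodule.mem_sup.1
              (hD.sup_eq_top ▸ Submodule.mem_top (x := (⟨z, hz⟩ : LinearMap.ker A.mulVecLin)))
            obtain ⟨w, hw⟩ : ∃ w, A *ᵥ w = r.1 := hr
            obtain ⟨n, hn, c, hc, hnc⟩ := Submodule.mem_sup.1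
              (hC.sup_eq_top ▸ Submodule.mem_top (x := w))
            have e1 : z = A *ᵥ c + d.1 := by
              have : z = r.1 + d.1 := (congrArg Subtype.val hrd).symm
              rw [this, ← hw, ← hnc, mulVec_add, show A *ᵥ n = 0 from hn, zero_add]
            rw [e1, map_add, hAz, hCz c hc, hDz d.1 ⟨d, hd, rfl⟩, Matrix.mul_zero, add_zero]
          intro z
          obtain ⟨n, hn, c, hc, rfl⟩ := Submodule.mem_sup.1
            (hC.sup_eq_top ▸ Submodule.mem_top (x := z))
          rw [map_add, hZA n hn, hCz c hc, add_zero]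
        exact sub_eq_zero.1 (LinearMap.ext key)
      · rw [hD', hDf, hCf, Set.ncard_univ, natCard_matrix]
        refine Nat.mul_le_mul_left _ (Nat.pow_le_pow_left ?_ _)
        rw [Nat.le_div_iff_mul_le (pow_pos hq _)]
        exact hN.le
    have h1 := ncard_mul_le_ncard_mul R (I ×ˢ J) B (Nat.card Kˣ) _ (fun u hu => hu) hfib
    rw [Set.ncard_prod] at h1
    have hu1 : q ≤ 2 * Nat.card Kˣ := by
      rw [Nat.card_units]
      have : 1 < Nat.card K := Finite.one_lt_card
      omega
    have hI := ncard_sq_zero_le (F := K) a 2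
    have hJ := ncard_sq_zero_le (F := ZMod p) ℓ κ
    rw [Nat.card_zmod] at hJ
    refine Nat.le_of_mul_le_mul_right ?_ (show 0 < q ^ (2 * 2 * 2) * p ^ (2 * κ * κ) *
      (q ^ (b * 2)) ^ (ℓ - 2 * κ) from by have := hp.pos; positivity)
    calc _ ≤ (B.ncard * (2 * Nat.card Kˣ)) * (q ^ (2 * 2 * 2) * p ^ (2 * κ * κ) *
            (q ^ (b * 2)) ^ (ℓ - 2 * κ)) := by gcongr
      _ = 2 * (B.ncard * Nat.card Kˣ) * (q ^ (2 * 2 * 2) * p ^ (2 * κ * κ) *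
            (q ^ (b * 2)) ^ (ℓ - 2 * κ)) := by ring
      _ ≤ 2 * (I.ncard * J.ncard * ((q ^ (a * b)) ^ κ * (q ^ (a * b) / q ^ (b * 2)) ^ (ℓ - 2 * κ))) *
          (q ^ (2 * 2 * 2) * p ^ (2 * κ * κ) * (q ^ (b * 2)) ^ (ℓ - 2 * κ)) := by gcongr
      _ = 2 * (I.ncard * q ^ (2 * 2 * 2)) * (J.ncard * p ^ (2 * κ * κ)) *
          ((q ^ (a * b)) ^ κ * (q ^ (a * b) / q ^ (b * 2) * q ^ (b * 2)) ^ (ℓ - 2 * κ)) := by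
          rw [mul_pow]; ring
      _ ≤ 2 * (4 * q ^ (2 * 2 * a)) * (4 * p ^ (2 * κ * ℓ)) *
          ((q ^ (a * b)) ^ κ * (q ^ (a * b)) ^ (ℓ - 2 * κ)) := by
          gcongr
          exact Nat.div_mul_le_self _ _
      _ = 32 * p ^ (4 * a * e + 2 * κ * ℓ + a * b * (ℓ - κ) * e) := by
          rw [← pow_add, show κ + (ℓ - 2 * κ) = ℓ - κ by omega, hK]
          simp only [← pow_mul, pow_add]
          rw [mul_comm e (2 * 2 * a), mul_comm e (a * b), mul_right_comm (a * b) e]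
          ring
      _ ≤ 32 * p ^ (8 * e + 2 * κ * κ + 2 * b * (ℓ - 2 * κ) * e + a * b * ℓ * e) :=
          Nat.mul_le_mul_left _ (Nat.pow_le_pow_right hp.pos hnum)
      _ = _ := by
          rw [← hqdef, hK]; simp only [← pow_mul, pow_add]
          rw [mul_comm e (b * 2), mul_right_comm (b * 2) e, mul_comm b 2, mul_comm e (a * b * ℓ),
            mul_comm e (2 * 2 * 2)]
          ring

end
end HeisNursery

/-! ### Subgroups of 2 × b matrices with a K-structure from the left -/

namespace HeisNursery
open Matrix Module

/-- `S` is the image of a `K`-space under a map carrying scalars to left multiplications. -/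
def HasFieldStructure {a b : ℕ} {K : Type*} [Field K]
    (S : AddSubgroup (Matrix (Fin a) (Fin b) K)) : Prop :=
  ∃ (Z : K → Matrix (Fin a) (Fin a) K) (w : (Fin b → K) →+ Matrix (Fin a) (Fin b) K),
    Function.Injective w ∧ (∀ U, U ∈ S ↔ ∃ x, w x = U) ∧ ∀ k x, w (k • x) = Z k * w x

theorem exists_pow_generator (K : Type*) [Field K] [Finite K] :
    ∃ θ : K, ∀ k : K, k ≠ 0 → ∃ i : ℕ, θ ^ i = k := by
  obtain ⟨θ, hθ⟩ := IsCyclic.exists_monoid_generator (α := Kˣ)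
  refine ⟨θ, fun k hk => ?_⟩
  obtain ⟨i, hi⟩ := hθ (Units.mk0 k hk)
  exact ⟨i, by simpa using congrArg Units.val hi⟩

section
variable {p ℓ : ℕ} [Fact p.Prime] {a b e : ℕ} {K : Type*} [Field K] [Finite K] [Algebra (ZMod p) K]

/-- The roots in `K` of the minimal polynomial of `θ` over the prime field. -/
noncomputable def conjRoots (p : ℕ) [Fact p.Prime] {K : Type*} [Field K] [Algebra (ZMod p) K]
    (θ : K) : Set K :=
  {x | Polynomial.aeval x (minpoly (ZMod p) θ) = 0}

theorem ncard_conjRoots_le (hK : Nat.card K = p ^ e) (θ : K) : (conjRoots p θ).ncard ≤ e := by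
  classical
  let f := (minpoly (ZMod p) θ).map (algebraMap (ZMod p) K)
  have hf : f ≠ 0 := Polynomial.map_ne_zero (minpoly.ne_zero (Algebra.IsIntegral.isIntegral θ))
  have h1 : conjRoots p θ ⊆ f.roots.toFinset := by
    intro x hx
    simp only [Finset.mem_coe, Multiset.mem_toFinset, Polynomial.mem_roots hf]
    rw [Polynomial.IsRoot, Polynomial.eval_map_algebraMap]
    exact hx
  calc _ ≤ (f.roots.toFinset : Set K).ncard := Set.ncard_le_ncard h1
    _ = f.roots.toFinset.card := Set.ncard_coe_finset _
    _ ≤ f.roots.card := Multiset.toFinset_card_le _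
    _ ≤ f.natDegree := Polynomial.card_roots' _
    _ = (minpoly (ZMod p) θ).natDegree := Polynomial.natDegree_map _
    _ ≤ finrank (ZMod p) K := minpoly.natDegree_le _
    _ = e := finrank_of_natCard hK

/-- The minimal polynomial of Z over K divides that of θ, which splits in K. So one eigenvalue s is
a conjugate of θ, and so is the other one, trace - s, because minimal and characteristic polynomial
have the same roots. -/
theorem exists_trace_det_of_aeval {θ : K} {Z : Matrix (Fin 2) (Fin 2) K}
    (hZ : Polynomial.aeval Z (minpoly (ZMod p) θ) = 0) :
    ∃ s ∈ conjRoots p θ, ∃ t ∈ conjRoots p θ, Z.trace = s + t ∧ Z.det = s * t := by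
  let f := (minpoly (ZMod p) θ).map (algebraMap (ZMod p) K)
  have hf : f ≠ 0 := Polynomial.map_ne_zero (minpoly.ne_zero (Algebra.IsIntegral.isIntegral θ))
  have hfs : f.Splits := Normal.splits inferInstance θ
  have hd : minpoly K Z ∣ f := minpoly.dvd K Z (by rw [Polynomial.aeval_map_algebraMap]; exact hZ)
  have hroot : ∀ x, (minpoly K Z).IsRoot x → x ∈ conjRoots p θ := by
    intro x hx
    have := hx.dvd hd
    rw [Polynomial.IsRoot, Polynomial.eval_map_algebraMap] at this
    exact this
  have hiff : ∀ x, (minpoly K Z).IsRoot x ↔ Z.charpoly.IsRoot x := by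
    intro x
    rw [← minpoly_toLin', ← Matrix.charpoly_toLin', ← Module.End.hasEigenvalue_iff_isRoot,
      Module.End.hasEigenvalue_iff_isRoot_charpoly]
  obtain ⟨s, hs⟩ := (hfs.of_dvd hf hd).exists_eval_eq_zero
    (minpoly.degree_pos (Matrix.isIntegral Z)).ne'
  have hs' := (hiff s).1 hs
  have hev : ∀ x, Z.charpoly.IsRoot x ↔ x ^ 2 - Z.trace * x + Z.det = 0 := by
    intro x
    rw [charpoly_fin_two, Polynomial.IsRoot]
    simp
  rw [hev] at hs'
  have hdet : Z.det = s * (Z.trace - s) := by linear_combination hs'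
  refine ⟨s, hroot s hs, Z.trace - s, hroot _ ((hiff _).2 ((hev _).2 ?_)), by ring, hdet⟩
  rw [hdet]; ring

/-- For fixed s and t, the entry Z 0 0 fixes Z 1 1 through the trace, and the determinant then fixes
the product of the off-diagonal entries. Either Z 0 1 is nonzero and determines Z 1 0, or it is zero
and Z 1 0 is arbitrary; hence 2q². -/
theorem ncard_trace_det_le (R : Set K) :
    {Z : Matrix (Fin 2) (Fin 2) K | ∃ s ∈ R, ∃ t ∈ R, Z.trace = s + t ∧ Z.det = s * t}.ncard ≤
      R.ncard * R.ncard * (2 * Nat.card K ^ 2) := by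
  classical
  have h := ncard_mul_le_ncard_mul
    (fun (st : K × K) (Z : Matrix (Fin 2) (Fin 2) K) => Z.trace = st.1 + st.2 ∧ Z.det = st.1 * st.2)
    (R ×ˢ R) {Z | ∃ s ∈ R, ∃ t ∈ R, Z.trace = s + t ∧ Z.det = s * t} 1 (2 * Nat.card K ^ 2) ?_ ?_
  · rwa [mul_one, Set.ncard_prod] at h
  · rintro Z ⟨s, hs, t, ht, h⟩
    rw [Nat.one_le_iff_ne_zero, ← Nat.pos_iff_ne_zero, Set.ncard_pos]
    exact ⟨(s, t), ⟨hs, ht⟩, h⟩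
  · rintro ⟨s, t⟩ -
    have hc : Nat.card (K × (K ⊕ K)) = 2 * Nat.card K ^ 2 := by
      rw [Nat.card_prod, Nat.card_sum]; ring
    rw [← hc, ← Nat.card_coe_set_eq]
    refine Nat.card_le_card_of_injective
      (fun Z => (Z.1 0 0, if Z.1 0 1 = 0 then Sum.inr (Z.1 1 0) else Sum.inl (Z.1 0 1))) ?_
    rintro ⟨Z, hZ1, hZ2⟩ ⟨Z', hZ1', hZ2'⟩ h
    rw [trace_fin_two, det_fin_two] at *
    simp only [Prod.mk.injEq] at h
    obtain ⟨h00, h⟩ := h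
    have h11 : Z 1 1 = Z' 1 1 := by
      have := hZ1.trans hZ1'.symm
      rw [h00] at this
      exact add_left_cancel this
    have h01 : Z 0 1 = Z' 0 1 ∧ Z 1 0 = Z' 1 0 := by
      by_cases h0 : Z 0 1 = 0 <;> by_cases h0' : Z' 0 1 = 0
      · rw [if_pos h0, if_pos h0'] at h
        exact ⟨h0.trans h0'.symm, Sum.inr_injective h⟩
      · rw [if_pos h0, if_neg h0'] at h; cases h
      · rw [if_neg h0, if_pos h0'] at h; cases h
      · rw [if_neg h0, if_neg h0'] at h
        have h1 : Z 0 1 = Z' 0 1 := Sum.inl_injective h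
        refine ⟨h1, mul_left_cancel₀ h0 ?_⟩
        have := hZ2.trans hZ2'.symm
        rw [h00, h11, sub_right_inj] at this
        rw [this, h1]
    apply Subtype.ext
    ext i j
    fin_cases i <;> fin_cases j
    · exact h00
    · exact h01.1
    · exact h01.2
    · exact h11

omit [Finite K] in
theorem map_pow_smul {V : Type*} [AddCommGroup V] [Module K V] {Z : Matrix (Fin a) (Fin a) K}
    {θ : K} (w : V →+ Matrix (Fin a) (Fin b) K) (hw : ∀ x, w (θ • x) = Z * w x) (n : ℕ) (x : V) :
    w (θ ^ n • x) = Z ^ n * w x := by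
  induction n generalizing x with
  | zero => rw [pow_zero, pow_zero, one_smul, Matrix.one_mul]
  | succ n ih => rw [pow_succ, mul_smul, ih, hw, pow_succ, Matrix.mul_assoc]

omit [Finite K] in
theorem map_aeval_smul {V : Type*} [AddCommGroup V] [Module K V] {Z : Matrix (Fin a) (Fin a) K}
    {θ : K} (w : V →+ Matrix (Fin a) (Fin b) K) (hw : ∀ x, w (θ • x) = Z * w x)
    (f : Polynomial (ZMod p)) (x : V) :
    w (Polynomial.aeval θ f • x) = Polynomial.aeval Z f * w x := by
  induction f using Polynomial.induction_on' with
  | add f g hf hg => rw [map_add, map_add, add_smul, map_add, hf, hg, Matrix.add_mul]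
  | monomial n c =>
    obtain ⟨m, rfl⟩ := ZMod.intCast_surjective c
    rw [Polynomial.aeval_monomial, Polynomial.aeval_monomial, map_intCast, map_intCast, mul_smul,
      Int.cast_smul_eq_zsmul, map_zsmul, map_pow_smul w hw, Matrix.mul_assoc, ← zsmul_one, Matrix.smul_mul, Matrix.one_mul]

/-- The factor e² will count pairs of conjugates of θ. It is at most 16 for e ≤ 4; from e = 5 on, e²
≤ 2·2^e is paid for by one more power of q, provided by `h4`. -/
theorem pow_sq_mul_le {q e m : ℕ} (hq2 : 2 ^ e ≤ q) (hm : 3 ≤ m * (e - 1)) (h4 : 5 ≤ e → 4 ≤ m * (e - 1)) :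
    e * e * q ^ 3 ≤ 16 * q ^ (m * (e - 1)) := by
  have hq : 0 < q := lt_of_lt_of_le (by positivity) hq2
  rcases Nat.lt_or_ge e 5 with he | he
  · have h1 : e * e ≤ 16 := by nlinarith
    exact Nat.mul_le_mul h1 (Nat.pow_le_pow_right hq hm)
  · have h1 : e * e ≤ 2 * 2 ^ e := by
      clear hq2 hm h4
      induction e, he using Nat.le_induction with
      | base => norm_num
      | succ n hn ih => rw [pow_succ]; nlinarith
    calc e * e * q ^ 3 ≤ 16 * q * q ^ 3 := Nat.mul_le_mul_right _ (by omega)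
      _ = 16 * q ^ 4 := by ring
      _ ≤ _ := Nat.mul_le_mul_left _ (Nat.pow_le_pow_right hq (h4 he))

/-- With θ a generator of Kˣ, the structure is encoded by Z θ and the values of `w` on the standard
basis. Each `S` has at least |GL_b(K)| encodings, by precomposition of `w`, and each encoding
determines `S`. The result is compared with a lower bound of order q^(b²e) for the number of all
subgroups. -/
theorem ncard_hasFieldStructure_mul_le (hK : Nat.card K = p ^ e) (hb : 0 < b) (he : 2 ≤ e)
    (hbe : 4 ≤ b * b * e) :
    {S ∈ Gr 2 b K (p ^ (b * e)) | SpanTop S ∧ HasFieldStructure S}.ncard * Nat.card K ≤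
      256 * (Gr 2 b K (p ^ (b * e))).ncard := by
  classical
  have hp : p.Prime := Fact.out
  let V := Matrix (Fin 2) (Fin b) K
  obtain ⟨θ, hθ⟩ := exists_pow_generator K
  let 𝒵 := {Z : Matrix (Fin 2) (Fin 2) K | ∃ s ∈ conjRoots p θ, ∃ t ∈ conjRoots p θ,
    Z.trace = s + t ∧ Z.det = s * t}
  have : Finite ((Fin b → K) →+ V) := Finite.of_injective _ DFunLike.coe_injective
  let I : Set (Matrix (Fin 2) (Fin 2) K × ((Fin b → K) →+ V)) :=
    {t | t.1 ∈ 𝒵 ∧ ∀ x, t.2 (θ • x) = t.1 * t.2 x}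
  let R : Matrix (Fin 2) (Fin 2) K × ((Fin b → K) →+ V) → AddSubgroup V → Prop :=
    fun t S => ∀ U, U ∈ S ↔ ∃ x, t.2 x = U
  set q := Nat.card K with hqdef
  have hq : 0 < q := Nat.card_pos
  have hI : I.ncard ≤ e * e * (2 * q ^ 2) * q ^ (2 * b * b) := by
    have h1 : 𝒵.ncard ≤ e * e * (2 * q ^ 2) := (ncard_trace_det_le _).trans
      (Nat.mul_le_mul_right _ (Nat.mul_le_mul (ncard_conjRoots_le hK θ) (ncard_conjRoots_le hK θ)))
    have h2 : Nat.card (𝒵 × (Fin b → V)) = 𝒵.ncard * q ^ (2 * b * b) := by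
      rw [Nat.card_prod, Nat.card_fun, natCard_matrix, Nat.card_fin, ← pow_mul,
        Nat.card_coe_set_eq]
    refine le_trans ?_ (Nat.mul_le_mul_right _ h1)
    rw [← h2, ← Nat.card_coe_set_eq]
    refine Nat.card_le_card_of_injective (fun t => (⟨t.1.1, t.2.1⟩, fun i => t.1.2 (Pi.single i 1))) ?_
    rintro ⟨⟨Z, w⟩, hZ, hw⟩ ⟨⟨Z', w'⟩, hZ', hw'⟩ h
    simp only [Prod.mk.injEq, Subtype.mk.injEq] at h hw hw'
    obtain ⟨rfl, h⟩ := h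
    -- Since θ generates Kˣ, compatibility with θ alone propagates the values on basis vectors to
    -- all multiples.
    have hww : w = w' := by
      refine DFunLike.ext _ _ fun x => ?_
      have hx : x = ∑ i, x i • (Pi.single i 1 : Fin b → K) := by
        ext j; simp [Finset.sum_apply, Pi.single_apply]
      rw [hx, map_sum, map_sum]
      refine Finset.sum_congr rfl fun i _ => ?_
      by_cases h0 : x i = 0
      · simp [h0]
      · obtain ⟨n, hn⟩ := hθ _ h0
        rw [← hn, map_pow_smul w hw, map_pow_smul w' hw', congrFun h i]
    subst hww; rfl
  have h := ncard_mul_le_ncard_mul R I {S ∈ Gr 2 b K (p ^ (b * e)) | SpanTop S ∧ HasFieldStructure S}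
    (Nat.card (GL (Fin b) K)) 1 ?_ ?_
  · have hGL := pow_mul_self_le_four_mul_card_GL K b
    set bad := {S ∈ Gr 2 b K (p ^ (b * e)) | SpanTop S ∧ HasFieldStructure S}.ncard
    have hlt : b * e < 2 * b * e := by
      have : 0 < b * e := by positivity
      linarith
    have hG1 := pow_le_two_mul_ncard_injective (natCard_matrix_pow (a := 2) (b := b) hK) hlt
    have hG2 := ncard_injective_le (p := p) (ℓ := b * e) (V := V)
    set N := (Gr 2 b K (p ^ (b * e))).ncard
    have hg : Nat.card ((Fin (b * e) → ZMod p) ≃ₗ[ZMod p] (Fin (b * e) → ZMod p)) ≤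
        q ^ (b * b * e) := by
      have h1 : Nat.card ((Fin (b * e) → ZMod p) →ₗ[ZMod p] (Fin (b * e) → ZMod p)) = q ^ (b * b * e) := by
        rw [Module.natCard_eq_pow_finrank (K := ZMod p), Nat.card_zmod, Module.finrank_linearMap, hK,
          ← pow_mul]
        simp only [finrank_fintype_fun_eq_card, Fintype.card_fin]
        ring_nf
      rw [← h1]
      exact Nat.card_le_card_of_injective (fun f => f.toLinearMap) LinearEquiv.toLinearMap_injective
    have hN : q ^ (b * b * e) ≤ 2 * N := by
      refine Nat.le_of_mul_le_mul_right ?_ (show 0 < q ^ (b * b * e) by positivity)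
      calc q ^ (b * b * e) * q ^ (b * b * e) = p ^ (2 * b * e * (b * e)) := by
            rw [hK, ← pow_mul, ← pow_add]; ring_nf
        _ ≤ 2 * (N * _) := hG1.trans (Nat.mul_le_mul_left _ hG2)
        _ ≤ 2 * (N * q ^ (b * b * e)) := by gcongr
        _ = _ := by ring
    have hbad : bad * q ^ (b * b) ≤ 8 * (e * e) * q ^ 2 * q ^ (2 * b * b) := by
      calc bad * q ^ (b * b) ≤ bad * (4 * Nat.card (GL (Fin b) K)) := Nat.mul_le_mul_left _ hGL
        _ = 4 * (bad * Nat.card (GL (Fin b) K)) := by ring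
        _ ≤ 4 * (e * e * (2 * q ^ 2) * q ^ (2 * b * b)) :=
          Nat.mul_le_mul_left _ (h.trans ((mul_one _).trans_le hI))
        _ = _ := by ring
    have hnum := pow_sq_mul_le (q := q) (e := e) (m := b * b)
      (by rw [hK]; exact Nat.pow_le_pow_left hp.two_le e)
      (by
        obtain ⟨e', rfl⟩ := Nat.exists_eq_add_of_le he
        rw [show 2 + e' - 1 = e' + 1 by omega]
        rcases Nat.lt_or_ge b 2 with h2 | h2
        · obtain rfl : b = 1 := by omega
          omega
        · nlinarith)
      (fun he5 => by
        have : 0 < b * b := by positivity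
        calc 4 ≤ 1 * (e - 1) := by omega
          _ ≤ _ := Nat.mul_le_mul_right _ this)
    refine Nat.le_of_mul_le_mul_right ?_ (show 0 < q ^ (b * b) by positivity)
    calc bad * q * q ^ (b * b) = bad * q ^ (b * b) * q := by ring
      _ ≤ 8 * (e * e) * q ^ 2 * q ^ (2 * b * b) * q := Nat.mul_le_mul_right _ hbad
      _ = 8 * (e * e * q ^ 3) * q ^ (2 * b * b) := by ring
      _ ≤ 8 * (16 * q ^ (b * b * (e - 1))) * q ^ (2 * b * b) := by gcongr
      _ = 128 * q ^ (b * b * e) * q ^ (b * b) := by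
        obtain ⟨e', rfl⟩ := Nat.exists_eq_add_of_le he
        rw [show 2 + e' - 1 = e' + 1 by omega]; ring
      _ ≤ 128 * (2 * N) * q ^ (b * b) := by gcongr
      _ = _ := by ring
  · rintro S ⟨-, hspan, Z, w, hw, hS, hZ⟩
    -- The minimal polynomial of θ, evaluated at Z θ, kills `S` from the left, so it vanishes
    -- because of `SpanTop`.
    have hZθ : Z θ ∈ 𝒵 := by
      refine exists_trace_det_of_aeval ?_
      have h0 : ∀ U ∈ S, Polynomial.aeval (Z θ) (minpoly (ZMod p) θ) * U = 0 := by
        intro U hU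
        obtain ⟨x, rfl⟩ := (hS U).1 hU
        rw [← map_aeval_smul w (hZ θ), minpoly.aeval, zero_smul, map_zero]
      ext i j
      refine congrFun (hspan (Polynomial.aeval (Z θ) (minpoly (ZMod p) θ) i) fun U hU => ?_) j
      exact congrFun (h0 U hU) i
    rw [← Nat.card_coe_set_eq]
    refine Nat.card_le_card_of_injective (fun g : GL (Fin b) K =>
      ⟨(Z θ, w.comp (g.1.mulVecLin.toAddMonoidHom)), ⟨hZθ, fun x => ?_⟩, fun U => ?_⟩) ?_
    · change w (g.1 *ᵥ (θ • x)) = Z θ * w (g.1 *ᵥ x)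
      rw [mulVec_smul, hZ]
    · rw [hS]
      constructor
      · rintro ⟨x, rfl⟩
        refine ⟨(g⁻¹).1 *ᵥ x, ?_⟩
        change w (g.1 *ᵥ ((g⁻¹).1 *ᵥ x)) = w x
        rw [mulVec_mulVec, Units.mul_inv, one_mulVec]
      · rintro ⟨x, rfl⟩
        exact ⟨_, rfl⟩
    · intro g g' hgg
      have h1 := congrArg (fun t => t.1.2) hgg
      refine Units.ext (matrix_ext_mulVec fun x => hw ?_)
      exact DFunLike.congr_fun h1 x
  · rintro ⟨Z, w⟩ -
    refine (Set.ncard_le_one (Set.toFinite _)).2 fun S hS S' hS' => ?_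
    ext U
    rw [hS U, hS' U]

end
end HeisNursery

/-! ### Linear data of an embedding: shears and swaps -/

namespace HeisNursery
open Matrix Module

/-- The linear data carried by an embedding of the kind of `S` as a kind: `u` and `v` are the
coordinates of the embedding modulo the centre, `η` is its restriction to the centre and `J`
parametrizes the preimage of `Γ₂` modulo the centre. -/
structure KindData {a b : ℕ} (c : ℕ) {K : Type*} [Field K]
    (S : AddSubgroup (Matrix (Fin a) (Fin b) K)) where
  u : S × Matrix (Fin b) (Fin c) K →+ Matrix (Fin a) (Fin b) K
  v : S × Matrix (Fin b) (Fin c) K →+ Matrix (Fin b) (Fin c) K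
  η : Matrix (Fin a) (Fin c) K →+ Matrix (Fin a) (Fin c) K
  J : Matrix (Fin b) (Fin c) K →+ S × Matrix (Fin b) (Fin c) K
  η_inj : Function.Injective η
  comm : ∀ x y, u x * v y - u y * v x = η (x.1.1 * y.2 - y.1.1 * x.2)
  u_J : ∀ V, u (J V) = 0
  v_J : ∀ V, v (J V) = V
  eq_J : ∀ x, u x = 0 → x = J (v x)

variable {a b c : ℕ} {K : Type*} [Field K] {S : AddSubgroup (Matrix (Fin a) (Fin b) K)}

theorem KerTrivial.eq_zero_of_mul (hS : KerTrivial S) (B : Matrix (Fin b) (Fin c) K)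
    (h : ∀ U ∈ S, U * B = 0) : B = 0 := by
  ext i j
  exact congrFun (hS (fun k => B k j) fun U hU => funext fun i => congrFun (congrFun (h U hU) i) j) i

theorem SpanTop.eq_zero_of_mul (hS : SpanTop S) {m : ℕ} (B : Matrix (Fin m) (Fin a) K)
    (h : ∀ U ∈ S, B * U = 0) : B = 0 := by
  ext i j
  exact congrFun (hS (B i) fun U hU => congrFun (h U hU) i) j

namespace KindData

/-- The image of `J` is the graph of β over the second factor, that is, the image of 0 × M_{b×c}(K)
under (U, V) ↦ (U + β V, V); the symmetry of β makes this map respect commutators. -/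
def IsShear (D : KindData c S) : Prop :=
  ∃ β : Matrix (Fin b) (Fin c) K →+ S, (∀ V V', (β V).1 * V' = (β V').1 * V) ∧
    ∀ x, x ∈ Set.range D.J ↔ x.1 = β x.2

def IsSwap (D : KindData c S) : Prop := ∀ x, x ∈ Set.range D.J ↔ x.2 = 0

theorem J_injective (D : KindData c S) : Function.Injective D.J :=
  Function.LeftInverse.injective D.v_J

/-- The group Γ₂ is abelian, so commutators vanish on its preimage. -/
theorem isotropic (D : KindData c S) (V V' : Matrix (Fin b) (Fin c) K) :
    (D.J V).1.1 * (D.J V').2 = (D.J V').1.1 * (D.J V).2 := by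
  rw [← sub_eq_zero]
  apply D.η_inj
  rw [← D.comm, D.u_J, D.u_J, map_zero, Matrix.zero_mul, Matrix.zero_mul, sub_zero]

theorem mem_range_J (D : KindData c S) (x) : x ∈ Set.range D.J ↔ D.J (D.v x) = x := by
  constructor
  · rintro ⟨V, rfl⟩
    rw [D.v_J]
  · exact fun h => ⟨_, h⟩

/-- The map J ∘ v kills `u` and preserves `v`. After applying η, the first bracket therefore keeps
only -u(y) v(x) and the second only u(x) v(y). -/
theorem projection_comm (D : KindData c S) (x y : S × Matrix (Fin b) (Fin c) K) :
    ((D.J (D.v x)).1.1 * y.2 - y.1.1 * (D.J (D.v x)).2) +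
      (x.1.1 * (D.J (D.v y)).2 - (D.J (D.v y)).1.1 * x.2) = x.1.1 * y.2 - y.1.1 * x.2 := by
  apply D.η_inj
  rw [map_add, ← D.comm, ← D.comm, ← D.comm, D.u_J, D.u_J, D.v_J, D.v_J, Matrix.zero_mul,
    Matrix.zero_mul]
  abel

theorem isShear_of_fst_eq_zero [Finite K] (D : KindData c S) (h : ∀ V, (D.J V).1 = 0) :
    D.IsShear := by
  refine ⟨0, fun V V' => by simp, fun x => ⟨?_, fun hx => ?_⟩⟩
  · rintro ⟨V, rfl⟩
    simpa using h V
  · have hinj : Function.Injective fun V => (D.J V).2 := fun V V' hV =>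
      D.J_injective (Prod.ext ((h V).trans (h V').symm) hV)
    obtain ⟨V, hV⟩ := Finite.surjective_of_injective hinj x.2
    exact ⟨V, Prod.ext ((h V).trans (by simpa using hx.symm)) hV⟩

/-- The identity `projection_comm` is split along the two factors. On S × S it is the relation
excluded by `NoGamma`; on mixed pairs it says that the remaining diagonal corner is V ↦ T V and that
S → S is U ↦ U(1 - T); on the second factor it is the symmetry of β. Idempotence of the projection
passes to T. -/
theorem isShear_or_isSwap (D : KindData c S) (hc : 0 < c) (hker : KerTrivial S)
    (hγ : NoGamma S) (hid : NoIdem S) : D.IsShear ∨ D.IsSwap := by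
  let j0 : Fin c := ⟨0, hc⟩
  let P : S × Matrix (Fin b) (Fin c) K →+ S × Matrix (Fin b) (Fin c) K := D.J.comp D.v
  have hP : ∀ x, x ∈ Set.range D.J ↔ P x = x := D.mem_range_J
  have hPP : ∀ x, P (P x) = P x := fun x => by
    change D.J (D.v (D.J (D.v x))) = D.J (D.v x)
    rw [D.v_J]
  have hcomm : ∀ x y : S × Matrix (Fin b) (Fin c) K,
      ((P x).1.1 * y.2 - y.1.1 * (P x).2) + (x.1.1 * (P y).2 - (P y).1.1 * x.2) =
        x.1.1 * y.2 - y.1.1 * x.2 := D.projection_comm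
  let iS : S →+ S × Matrix (Fin b) (Fin c) K := AddMonoidHom.inl _ _
  let iM : Matrix (Fin b) (Fin c) K →+ S × Matrix (Fin b) (Fin c) K := AddMonoidHom.inr _ _
  -- the lower left component vanishes
  have hg : ∀ U, (P (iS U)).2 = 0 := by
    intro U
    ext i j
    let g : S →+ (Fin b → K) :=
      { toFun := fun U i => (P (iS U)).2 i j
        map_zero' := by rw [map_zero, map_zero]; rfl
        map_add' := fun U U' => by rw [map_add, map_add]; rfl }
    have h0 : g = 0 := hγ g fun U U' => by
      have h : ((P (iS U)).1.1 * (0 : Matrix (Fin b) (Fin c) K) - U'.1 * (P (iS U)).2) +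
          (U.1 * (P (iS U')).2 - (P (iS U')).1.1 * (0 : Matrix (Fin b) (Fin c) K)) =
          U.1 * (0 : Matrix (Fin b) (Fin c) K) - U'.1 * (0 : Matrix (Fin b) (Fin c) K) :=
        hcomm (iS U) (iS U')
      simp only [Matrix.mul_zero, zero_sub, sub_zero] at h
      have h : U.1 * (P (iS U')).2 = U'.1 * (P (iS U)).2 := by
        rw [← sub_eq_zero, sub_eq_neg_add]; simpa using h
      ext i
      exact congrFun (congrFun h i) j
    exact congrFun (DFunLike.congr_fun h0 U) i
  have hβ : ∀ V V', (P (iM V)).1.1 * V' = (P (iM V')).1.1 * V := by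
    intro V V'
    have h : ((P (iM V)).1.1 * V' - (0 : Matrix (Fin a) (Fin b) K) * (P (iM V)).2) +
        ((0 : Matrix (Fin a) (Fin b) K) * (P (iM V')).2 - (P (iM V')).1.1 * V) =
        (0 : Matrix (Fin a) (Fin b) K) * V' - (0 : Matrix (Fin a) (Fin b) K) * V :=
      hcomm (iM V) (iM V')
    simp only [Matrix.zero_mul, sub_zero, zero_sub] at h
    rw [← sub_eq_zero, sub_eq_add_neg]; simpa using h
  have hαδ : ∀ U V, U.1 * (P (iM V)).2 = (U.1 - (P (iS U)).1.1) * V := by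
    intro U V
    have h : ((P (iS U)).1.1 * V - (0 : Matrix (Fin a) (Fin b) K) * (P (iS U)).2) +
        (U.1 * (P (iM V)).2 - (P (iM V)).1.1 * (0 : Matrix (Fin b) (Fin c) K)) =
        U.1 * V - (0 : Matrix (Fin a) (Fin b) K) * (0 : Matrix (Fin b) (Fin c) K) :=
      hcomm (iS U) (iM V)
    simp only [Matrix.zero_mul, Matrix.mul_zero, sub_zero] at h
    rw [Matrix.sub_mul, ← h, add_sub_cancel_left]
  -- the lower right component is multiplication by a matrix
  let cm : (Fin b → K) → Matrix (Fin b) (Fin c) K := fun v => Matrix.of fun i j => if j = j0 then v i else 0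
  have hcm : ∀ (m : ℕ) (A : Matrix (Fin m) (Fin b) K) v i, (A * cm v) i j0 = (A *ᵥ v) i := by
    intro m A v i
    simp [mul_apply, cm, mulVec, dotProduct]
  have ht : ∀ (U : S) v, U.1 *ᵥ (fun i => (P (iM (cm v))).2 i j0) = (U.1 - (P (iS U)).1.1) *ᵥ v := by
    intro U v
    ext i
    have := congrFun (congrFun (hαδ U (cm v)) i) j0
    rw [hcm] at this
    rw [← this]
    rfl
  -- The projection is only additive. K-linearity of `t` holds because U (t v) is K-linear in v for
  -- every U in `S`, and `hker` separates vectors.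
  let t : (Fin b → K) →ₗ[K] (Fin b → K) :=
    { toFun := fun v i => (P (iM (cm v))).2 i j0
      map_add' := fun v w => by
        rw [← sub_eq_zero]
        refine hker _ fun U hU => ?_
        rw [mulVec_sub, mulVec_add, ht ⟨U, hU⟩, ht ⟨U, hU⟩, ht ⟨U, hU⟩, mulVec_add, sub_self]
      map_smul' := fun k v => by
        rw [← sub_eq_zero]
        refine hker _ fun U hU => ?_
        rw [mulVec_sub, mulVec_smul, ht ⟨U, hU⟩, RingHom.id_apply, ht ⟨U, hU⟩, mulVec_smul, sub_self] }
  let T : Matrix (Fin b) (Fin b) K := LinearMap.toMatrix' t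
  have hUT : ∀ U : S, U.1 * T = U.1 - (P (iS U)).1.1 := by
    intro U
    apply Matrix.toLin'.injective
    refine LinearMap.ext fun v => ?_
    rw [toLin'_apply, toLin'_apply, ← mulVec_mulVec, LinearMap.toMatrix'_mulVec]
    exact ht U v
  have hδ : ∀ V, (P (iM V)).2 = T * V := by
    intro V
    rw [← sub_eq_zero]
    refine hker.eq_zero_of_mul _ fun U hU => ?_
    rw [Matrix.mul_sub, hαδ ⟨U, hU⟩, ← Matrix.mul_assoc, hUT ⟨U, hU⟩, sub_self]
  have hsplit : ∀ x, P x = P (iS x.1) + P (iM x.2) := fun x => by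
    rw [← map_add]; congr 1; simp [iS, iM]
  have hTT : T * T = T := by
    apply Matrix.toLin'.injective
    refine LinearMap.ext fun v => ?_
    have h1 := congrArg Prod.snd (hPP (iM (cm v)))
    rw [hsplit (P _), Prod.snd_add, hg, zero_add, hδ, hδ, ← Matrix.mul_assoc] at h1
    ext i
    rw [toLin'_apply, toLin'_apply, ← hcm, ← hcm, h1]
  rcases hid T hTT (fun U hU => by rw [hUT ⟨U, hU⟩]; exact S.sub_mem hU (Subtype.property _)) with h | h
  · right
    intro x
    have hα : ∀ U, (P (iS U)).1 = U := fun U => by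
      have := hUT U
      rw [h, Matrix.mul_zero] at this
      exact Subtype.ext (sub_eq_zero.1 this.symm).symm
    rw [hP, hsplit]
    constructor
    · intro hx
      have := congrArg Prod.snd hx
      rw [Prod.snd_add, hg, hδ, h, Matrix.zero_mul, add_zero] at this
      exact this.symm
    · intro hx
      rw [hx, map_zero, map_zero, add_zero]
      exact Prod.ext (hα _) ((hg _).trans hx.symm)
  · left
    have hα : ∀ U, (P (iS U)).1 = 0 := fun U => by
      have := hUT U
      rw [h, Matrix.mul_one] at this
      exact Subtype.ext (sub_eq_self.1 this.symm)
    refine ⟨(AddMonoidHom.fst _ _).comp (P.comp iM), fun V V' => hβ V V', fun x => ?_⟩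
    rw [hP, hsplit]
    constructor
    · intro hx
      have := congrArg Prod.fst hx
      rw [Prod.fst_add, hα, zero_add] at this
      exact this.symm
    · intro hx
      refine Prod.ext ?_ ?_
      · rw [Prod.fst_add, hα, zero_add]; exact hx.symm
      · rw [Prod.snd_add, hg, zero_add, hδ, h, Matrix.one_mul]

/-- For b = 1 the products are columns times rows. If some J V has nonzero first component, isotropy
makes any J V' with first component zero vanish, so the first component embeds q^c elements into
`S`. -/
theorem isShear_of_card_lt [Finite K] {S : AddSubgroup (Matrix (Fin a) (Fin 1) K)}
    (D : KindData c S) (h : Nat.card S < Nat.card K ^ c) : D.IsShear := by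
  refine D.isShear_of_fst_eq_zero fun V => ?_
  by_contra hV
  have hinj : Function.Injective fun V' => (D.J V').1 := by
    intro V1 V2 h12
    have h0 : (D.J (V1 - V2)).1 = 0 := by
      rw [map_sub, Prod.fst_sub]; exact sub_eq_zero.2 h12
    have h1 := D.isotropic V (V1 - V2)
    rw [h0, ZeroMemClass.coe_zero, Matrix.zero_mul] at h1
    have h2 : (D.J (V1 - V2)).2 = 0 := by
      have hV' : (D.J V).1.1 ≠ 0 := fun h => hV (Subtype.ext h)
      obtain ⟨i, hi⟩ : ∃ i, (D.J V).1.1 i 0 ≠ 0 := by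
        by_contra hc
        push Not at hc
        exact hV' (by ext i j; rw [Subsingleton.elim j 0]; exact hc i)
      ext j k
      have := congrFun (congrFun h1 i) k
      rw [mul_apply, Fin.sum_univ_one] at this
      rw [Subsingleton.elim j 0]
      exact (mul_eq_zero.1 this).resolve_left hi
    exact sub_eq_zero.1 (D.J_injective (by rw [map_zero]; exact Prod.ext h0 h2))
  have := Nat.card_le_card_of_injective _ hinj
  rw [natCard_matrix, one_mul] at this
  omega

/-- Additive maps are linear here, so the image of `J` is a line in the plane S × K: it is either
the first axis or a graph over the second. -/
theorem isShear_or_isSwap_of_prime_field {p : ℕ} [Fact p.Prime] [Finite K]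
    (hK : Nat.card K = p) {S : AddSubgroup (Matrix (Fin a) (Fin 1) K)} (D : KindData 1 S)
    (h : Nat.card S = p) : D.IsShear ∨ D.IsSwap := by
  have hcard : ∀ k : K, ∃ n : ℕ, k = n := by
    have : CharP K p := by
      have := Fintype.ofFinite K
      have h1 : Fintype.card K = p ^ 1 := by rw [pow_one, ← Nat.card_eq_fintype_card, hK]
      exact charP_of_card_eq_prime_pow h1
    intro k
    have hb : Function.Bijective (ZMod.castHom (dvd_refl p) K) := by
      have := Fintype.ofFinite K
      rw [Fintype.bijective_iff_injective_and_card]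
      exact ⟨RingHom.injective _, by rw [ZMod.card, ← Nat.card_eq_fintype_card, hK]⟩
    obtain ⟨z, rfl⟩ := hb.2 k
    obtain ⟨n, rfl⟩ := ZMod.natCast_zmod_surjective z
    exact ⟨n, by simp⟩
  have hlin : ∀ {m n : ℕ} (f : Matrix (Fin 1) (Fin 1) K →+ Matrix (Fin m) (Fin n) K) (k : K) (V),
      f (k • V) = k • f V := by
    intro m n f k V
    obtain ⟨n, rfl⟩ := hcard k
    rw [Nat.cast_smul_eq_nsmul, Nat.cast_smul_eq_nsmul, map_nsmul]
  let f1 : Matrix (Fin 1) (Fin 1) K →+ Matrix (Fin a) (Fin 1) K :=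
    S.subtype.comp ((AddMonoidHom.fst _ _).comp D.J)
  let f2 : Matrix (Fin 1) (Fin 1) K →+ Matrix (Fin 1) (Fin 1) K := (AddMonoidHom.snd _ _).comp D.J
  have hone : ∀ V : Matrix (Fin 1) (Fin 1) K, V = V 0 0 • (1 : Matrix (Fin 1) (Fin 1) K) := by
    intro V; ext i j; rw [Subsingleton.elim i 0, Subsingleton.elim j 0]; simp
  by_cases h0 : f2 1 0 0 = 0
  · right
    have hz : ∀ V, (D.J V).2 = 0 := by
      intro V
      change f2 V = 0
      rw [hone V, hlin]
      ext i j
      rw [Subsingleton.elim i 0, Subsingleton.elim j 0]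
      simp [h0]
    have hb : Function.Bijective fun V => (D.J V).1 := by
      rw [Nat.bijective_iff_injective_and_card]
      refine ⟨fun V V' hV => D.J_injective (Prod.ext hV ((hz V).trans (hz V').symm)), ?_⟩
      rw [natCard_matrix, h, hK, one_mul, pow_one]
    intro x
    refine ⟨?_, fun hx => ?_⟩
    · rintro ⟨V, rfl⟩; exact hz V
    · obtain ⟨V, hV⟩ := hb.2 x.1
      exact ⟨V, Prod.ext hV ((hz V).trans hx.symm)⟩
  · left
    set k := f2 1 0 0
    have h2 : ∀ V, (D.J V).2 = k • V := by
      intro V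
      change f2 V = k • V
      conv_lhs => rw [hone V, hlin]
      ext i j
      rw [Subsingleton.elim i 0, Subsingleton.elim j 0]
      simp [k, mul_comm]
    let β : Matrix (Fin 1) (Fin 1) K →+ S :=
      ((AddMonoidHom.fst _ _).comp D.J).comp (DistribSMul.toAddMonoidHom _ k⁻¹)
    have hβ : ∀ V, (β V).1 = V 0 0 • (β 1).1 := by
      intro V
      conv_lhs => rw [hone V]
      exact hlin (S.subtype.comp β) _ _
    refine ⟨β, fun V V' => ?_, fun x => ⟨?_, fun hx => ?_⟩⟩
    · rw [hβ V, hβ V']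
      ext i j
      rw [Subsingleton.elim j 0, mul_apply, mul_apply, Fin.sum_univ_one, Fin.sum_univ_one]
      simp only [Matrix.smul_apply, smul_eq_mul]
      ring
    · rintro ⟨V, rfl⟩
      change _ = (D.J (k⁻¹ • (D.J V).2)).1
      rw [h2, smul_smul, inv_mul_cancel₀ h0, one_smul]
    · refine ⟨k⁻¹ • x.2, Prod.ext hx.symm ?_⟩
      rw [h2, smul_smul, mul_inv_cancel₀ h0, one_smul]

theorem natCard_annihilator_of_rows [Finite K] (L : Submodule K (Fin b → K)) :
    {B : Matrix (Fin b) (Fin c) K | ∀ y ∈ L, y ᵥ* B = 0}.ncard * Nat.card L ^ c =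
      Nat.card K ^ (b * c) := by
  let f : Matrix (Fin b) (Fin c) K →+ (L →ₗ[K] (Fin c → K)) :=
    { toFun := fun B => B.vecMulLinear ∘ₗ L.subtype
      map_zero' := by ext; simp
      map_add' := fun A B => by
        refine LinearMap.ext fun y => ?_
        exact vecMul_add A B y.1 }
  have hf : Function.Surjective f := by
    intro g
    obtain ⟨g', hg'⟩ := LinearMap.exists_extend g
    refine ⟨Matrix.of fun i j => g' (Pi.single i 1) j, ?_⟩
    refine LinearMap.ext fun y => ?_
    rw [← hg']
    change y.1 ᵥ* _ = g' y.1
    ext j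
    conv_rhs => rw [pi_eq_sum_univ' y.1]
    simp [vecMul, dotProduct]
  have h1 := natCard_ker_mul_of_surjective f hf
  have h2 : Nat.card (L →ₗ[K] (Fin c → K)) = Nat.card L ^ c := by
    have : Finite (L →ₗ[K] (Fin c → K)) := Finite.of_injective _ DFunLike.coe_injective
    rw [Module.natCard_eq_pow_finrank (K := K), Module.finrank_linearMap,
      Module.natCard_eq_pow_finrank (K := K) (V := L), ← pow_mul]
    simp
  rw [natCard_matrix, h2] at h1
  rw [← h1, ← Nat.card_coe_set_eq]
  congr 1
  refine Nat.card_congr (Equiv.subtypeEquivRight fun B => ?_)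
  constructor
  · intro h
    refine LinearMap.ext fun y => ?_
    exact h y.1 y.2
  · intro h y hy
    exact LinearMap.congr_fun h ⟨y, hy⟩

/-- Let T be the set of first components of `J` and L its K-span. By isotropy, elements of the image
with first component zero have second component annihilated by L, so at most q^(bc)/|L|^c of them
exist. Comparing cardinalities gives |T| ≥ |L|^c ≥ |L|, hence T = L is a K-subspace inside `S`, and
`NoLine` makes it zero. -/
theorem isShear_of_noLine [Finite K] {S : AddSubgroup (Matrix (Fin 1) (Fin b) K)} (hc : 0 < c)
    (D : KindData c S) (hS : NoLine S) : D.IsShear := by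
  let T : AddSubgroup (Fin b → K) :=
    { carrier := {y | ∃ V, (D.J V).1.1 0 = y}
      zero_mem' := ⟨0, by rw [map_zero]; rfl⟩
      add_mem' := by
        rintro _ _ ⟨V, rfl⟩ ⟨V', rfl⟩
        exact ⟨V + V', by rw [map_add]; rfl⟩
      neg_mem' := by
        rintro _ ⟨V, rfl⟩
        exact ⟨-V, by rw [map_neg]; rfl⟩ }
  let L : Submodule K (Fin b → K) := Submodule.span K T
  have hTL : (T : Set (Fin b → K)) ⊆ L := Submodule.subset_span
  let π : Matrix (Fin b) (Fin c) K →+ T :=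
    { toFun := fun V => ⟨(D.J V).1.1 0, V, rfl⟩
      map_zero' := Subtype.ext (congrArg (fun x => x.1.1 0) (map_zero D.J))
      map_add' := fun _ _ => Subtype.ext (congrArg (fun x => x.1.1 0) (map_add D.J _ _)) }
  have hπ : Function.Surjective π := by
    rintro ⟨y, V, rfl⟩
    exact ⟨V, rfl⟩
  have h1 := natCard_ker_mul_of_surjective π hπ
  have hfst : ∀ V, π V = 0 → (D.J V).1 = 0 := by
    intro V h
    apply Subtype.ext
    ext i j
    rw [Subsingleton.elim i 0]
    exact congrFun (congrArg Subtype.val h) j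
  have h2 : Nat.card π.ker ≤ {B : Matrix (Fin b) (Fin c) K | ∀ y ∈ L, y ᵥ* B = 0}.ncard := by
    rw [← Nat.card_coe_set_eq]
    refine Nat.card_le_card_of_injective (fun V => ⟨(D.J V.1).2, ?_⟩) ?_
    · intro y hy
      induction hy using Submodule.span_induction with
      | mem y hy =>
        obtain ⟨V', rfl⟩ := hy
        have := D.isotropic V' V.1
        rw [hfst V.1 V.2, ZeroMemClass.coe_zero, Matrix.zero_mul] at this
        exact congrFun this 0
      | zero => exact zero_vecMul _
      | add y z _ _ hy hz => rw [add_vecMul, hy, hz, add_zero]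
      | smul k y _ hy => rw [smul_vecMul, hy, smul_zero]
    · intro V V' h
      exact Subtype.ext (D.J_injective (Prod.ext ((hfst _ V.2).trans (hfst _ V'.2).symm)
        (congrArg Subtype.val h)))
  have h3 := natCard_annihilator_of_rows (c := c) L
  rw [natCard_matrix] at h1
  have h4 : Nat.card L ≤ Nat.card T := by
    have h5 : Nat.card L ^ c ≤ Nat.card T := by
      refine Nat.le_of_mul_le_mul_left ?_ (show 0 < Nat.card π.ker from Nat.card_pos)
      rw [h1, ← h3]
      exact Nat.mul_le_mul_right _ h2
    exact (Nat.le_self_pow hc.ne' _).trans h5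
  have h5 : (T : Set (Fin b → K)) = L := Set.eq_of_subset_of_ncard_le hTL (by
    rw [← Nat.card_coe_set_eq, ← Nat.card_coe_set_eq]; exact h4)
  refine D.isShear_of_fst_eq_zero fun V => Subtype.ext (hS _ fun k => ?_)
  have h6 : k • (D.J V).1.1 0 ∈ (T : Set (Fin b → K)) := by
    rw [h5]
    exact L.smul_mem k (hTL ⟨V, rfl⟩)
  obtain ⟨V', hV'⟩ := h6
  have : k • (D.J V).1.1 = (D.J V').1.1 := by
    ext i j
    rw [Subsingleton.elim i 0]
    exact congrFun hV'.symm j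
  rw [this]
  exact (D.J V').1.2

end KindData
end HeisNursery

/-! ### Swaps and the action of M_c(K) on S -/

namespace HeisNursery
open Matrix Module

variable {a b c : ℕ} {K : Type*} [Field K] {S : AddSubgroup (Matrix (Fin a) (Fin b) K)}

/-- The data of an automorphism of the kind of `S` that exchanges its two abelian factors. -/
def HasSwap {a b : ℕ} (c : ℕ) {K : Type*} [Field K]
    (S : AddSubgroup (Matrix (Fin a) (Fin b) K)) : Prop :=
  ∃ (F : S →+ Matrix (Fin b) (Fin c) K) (G : Matrix (Fin b) (Fin c) K →+ S)
    (H : Matrix (Fin a) (Fin c) K →+ Matrix (Fin a) (Fin c) K),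
    Function.Injective F ∧ Function.Injective G ∧ Function.Injective H ∧
      ∀ U V, H (U.1 * V) = (G V).1 * F U

/-- The commutator identity is evaluated at J V and (0, V'), where u(J V) = 0; the minus sign goes
into μ. -/
theorem KindData.IsSwap.exists_addEquiv {D : KindData c S} (h : D.IsSwap) :
    ∃ (j : Matrix (Fin b) (Fin c) K ≃+ S)
      (μ : Matrix (Fin b) (Fin c) K →+ Matrix (Fin a) (Fin b) K),
      ∀ V V', D.η ((j V).1 * V') = μ V' * V := by
  have h0 : ∀ V, (D.J V).2 = 0 := fun V => (h _).1 ⟨V, rfl⟩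
  refine ⟨AddEquiv.ofBijective ((AddMonoidHom.fst _ _).comp D.J) ⟨fun V V' hV => ?_, fun U => ?_⟩,
    -(D.u.comp (AddMonoidHom.inr _ _)), fun V V' => ?_⟩
  · exact D.J_injective (Prod.ext hV ((h0 V).trans (h0 V').symm))
  · obtain ⟨V, hV⟩ := (h (U, 0)).2 rfl
    exact ⟨V, congrArg Prod.fst hV⟩
  · have h1 := D.comm (D.J V) (0, V')
    rw [D.u_J, Matrix.zero_mul, D.v_J, h0, Matrix.mul_zero, sub_zero, zero_sub] at h1
    exact h1.symm.trans (Matrix.neg_mul _ _).symm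

theorem SpanTop.eq_top (hS : SpanTop S) (L : Submodule K (Fin a → K))
    (h : ∀ U ∈ S, ∀ v, U *ᵥ v ∈ L) : L = ⊤ := by
  by_contra hL
  obtain ⟨f, hf, hfL⟩ := Submodule.exists_le_ker_of_lt_top L (lt_top_iff_ne_top.2 hL)
  have hfy : ∀ v, f v = (fun i => f (Pi.single i 1)) ⬝ᵥ v := by
    intro v
    conv_lhs => rw [pi_eq_sum_univ' v]
    simp [dotProduct, mul_comm]
  have h0 := hS (fun i => f (Pi.single i 1)) fun U hU => by
    refine dotProduct_eq_zero _ fun v => ?_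
    rw [← dotProduct_mulVec, ← hfy]
    exact hfL (h U hU v)
  refine hf (LinearMap.ext fun v => ?_)
  rw [hfy, h0, zero_dotProduct]
  rfl

/-- Right multiplication of η(X) by g corresponds to an additive operator X ↦ η⁻¹(η(X) g), which
sends j(V) V' to j(V g) V'. Letting V' have a single nonzero column gives an operator on K^a, the
matrix Z g. -/
theorem exists_antihom [Finite K] (hc : 0 < c) (hS : SpanTop S)
    (j : Matrix (Fin b) (Fin c) K ≃+ S) (μ : Matrix (Fin b) (Fin c) K →+ Matrix (Fin a) (Fin b) K)
    (η : Matrix (Fin a) (Fin c) K →+ Matrix (Fin a) (Fin c) K) (hη : Function.Injective η)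
    (h : ∀ V V', η ((j V).1 * V') = μ V' * V) :
    ∃ Z : Matrix (Fin c) (Fin c) K → Matrix (Fin a) (Fin a) K,
      ∀ h V, Z h * (j V).1 = (j (V * h)).1 := by
  let j0 : Fin c := ⟨0, hc⟩
  let ηe := AddEquiv.ofBijective η (Finite.injective_iff_bijective.1 hη)
  let R : Matrix (Fin c) (Fin c) K → Matrix (Fin a) (Fin c) K → Matrix (Fin a) (Fin c) K :=
    fun h X => ηe.symm (ηe X * h)
  have hR : ∀ g V (V' : Matrix (Fin b) (Fin c) K), R g ((j V).1 * V') = (j (V * g)).1 * V' := by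
    intro g V V'
    apply ηe.injective
    rw [ηe.apply_symm_apply]
    change η _ * g = η _
    rw [h, h, Matrix.mul_assoc]
  have hRadd : ∀ g X Y, R g (X + Y) = R g X + R g Y := fun g X Y => by
    simp only [R, map_add, Matrix.add_mul]
  let cm : ∀ {m : ℕ}, (Fin m → K) → Matrix (Fin m) (Fin c) K :=
    fun v => Matrix.of fun i j => if j = j0 then v i else 0
  have hcmadd : ∀ {m : ℕ} (v w : Fin m → K), cm (v + w) = cm v + cm w := by
    intro m v w
    ext i j
    by_cases hj : j = j0 <;> simp [cm, hj]
  have hcm : ∀ {m n : ℕ} (A : Matrix (Fin m) (Fin n) K) v, A * cm v = cm (A *ᵥ v) := by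
    intro m n A v
    ext i j
    by_cases hj : j = j0 <;> simp [mul_apply, cm, mulVec, dotProduct, hj]
  have hcm0 : ∀ {m : ℕ} (v : Fin m → K) i, cm v i j0 = v i := by
    intro m v i
    simp [cm]
  let z : Matrix (Fin c) (Fin c) K → (Fin a → K) → (Fin a → K) := fun g y i => R g (cm y) i j0
  have hzadd : ∀ g y y', z g (y + y') = z g y + z g y' := by
    intro g y y'
    ext i
    simp only [z, hcmadd, hRadd]
    rfl
  have hz : ∀ g V v, z g ((j V).1 *ᵥ v) = (j (V * g)).1 *ᵥ v := by
    intro g V v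
    ext i
    simp only [z]
    rw [← hcm, hR, hcm, hcm0]
  have hzsmul : ∀ g (k : K) y, z g (k • y) = k • z g y := by
    intro g
    have hz0 : z g 0 = 0 := by
      have := hzadd g 0 0
      rw [add_zero] at this
      exact left_eq_add.1 this
    let L : Submodule K (Fin a → K) :=
      { carrier := {y | ∀ k : K, z g (k • y) = k • z g y}
        zero_mem' := fun k => by rw [smul_zero, hz0, smul_zero]
        add_mem' := fun {y y'} hy hy' k => by
          rw [smul_add, hzadd, hy k, hy' k, hzadd, smul_add]
        smul_mem' := fun k' y hy k => by rw [smul_smul, hy, hy, smul_smul] }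
    have hL : L = ⊤ := hS.eq_top L fun U hU v k => by
      obtain ⟨V, hV⟩ := j.surjective ⟨U, hU⟩
      have hV : (j V).1 = U := congrArg Subtype.val hV
      rw [← mulVec_smul, ← hV, hz, hz, mulVec_smul]
    intro k y
    exact (hL ▸ Submodule.mem_top : y ∈ L) k
  refine ⟨fun g => LinearMap.toMatrix' { toFun := z g, map_add' := hzadd g, map_smul' := hzsmul g },
    fun g V => ?_⟩
  refine Matrix.toLin'.injective (LinearMap.ext fun v => ?_)
  rw [toLin'_apply, toLin'_apply, ← mulVec_mulVec, LinearMap.toMatrix'_mulVec]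
  exact hz g V v

section Antihom

variable (hS : SpanTop S) (j : Matrix (Fin b) (Fin c) K ≃+ S)
  (Z : Matrix (Fin c) (Fin c) K → Matrix (Fin a) (Fin a) K)
  (hZ : ∀ h V, Z h * (j V).1 = (j (V * h)).1)

include hS in
theorem antihom_ext (A B : Matrix (Fin a) (Fin a) K) (h : ∀ V, A * (j V).1 = B * (j V).1) :
    A = B := by
  rw [← sub_eq_zero]
  refine hS.eq_zero_of_mul _ fun U hU => ?_
  obtain ⟨V, hV⟩ := j.surjective ⟨U, hU⟩
  have hV : (j V).1 = U := congrArg Subtype.val hV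
  rw [Matrix.sub_mul, ← hV, h, sub_self]

include hS hZ

theorem antihom_mul (h h' : Matrix (Fin c) (Fin c) K) : Z h * Z h' = Z (h' * h) :=
  antihom_ext hS j _ _ fun V => by
    rw [Matrix.mul_assoc, hZ, hZ, hZ, Matrix.mul_assoc]

theorem antihom_one : Z 1 = 1 :=
  antihom_ext hS j _ _ fun V => by rw [hZ, Matrix.mul_one, Matrix.one_mul]

theorem antihom_add (h h' : Matrix (Fin c) (Fin c) K) : Z (h + h') = Z h + Z h' :=
  antihom_ext hS j _ _ fun V => by
    rw [Matrix.add_mul, hZ, hZ, hZ, Matrix.mul_add, map_add]; rfl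

theorem antihom_zero : Z 0 = 0 :=
  antihom_ext hS j _ _ fun V => by
    rw [hZ, Matrix.mul_zero, Matrix.zero_mul, map_zero]; rfl

/-- The images of the matrix units split K^a into c summands, each isomorphic to the range of one
diagonal idempotent. -/
theorem antihom_rank (i0 : Fin c) : a = c * (Z (single i0 i0 1)).rank := by
  let T : Fin c → Fin c → (Fin a → K) →ₗ[K] (Fin a → K) := fun i k => (Z (single k i 1)).mulVecLin
  have hTT : ∀ i k l y, T i k (T k l y) = T i l y := by
    intro i k l y
    simp only [T, mulVecLin_apply, mulVec_mulVec, antihom_mul hS j Z hZ]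
    simp
  have hT0 : ∀ i k k' l y, k ≠ k' → T i k (T k' l y) = 0 := by
    intro i k k' l y hk
    simp only [T, mulVecLin_apply, mulVec_mulVec, antihom_mul hS j Z hZ]
    rw [single_mul_single_of_ne (h := hk.symm), antihom_zero hS j Z hZ, zero_mulVec]
  have hsum : ∀ y, ∑ i, T i i y = y := by
    intro y
    have h1 : ∀ s : Finset (Fin c), Z (∑ i ∈ s, single i i 1) = ∑ i ∈ s, Z (single i i 1) := by
      intro s
      induction s using Finset.induction_on with
      | empty => simp [antihom_zero hS j Z hZ]
      | insert x s hx ih => rw [Finset.sum_insert hx, Finset.sum_insert hx, antihom_add hS j Z hZ, ih]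
    have h2 : ∑ i, Z (single i i 1) = 1 := by
      rw [← h1, ← antihom_one hS j Z hZ]
      congr 1
      ext i k
      rw [Matrix.sum_apply, Matrix.one_apply]
      by_cases hik : i = k
      · subst hik
        simp [single_apply]
      · rw [if_neg hik]
        exact Finset.sum_eq_zero fun x _ => single_apply_of_ne _ _ _ _ _ (by aesop)
    simp only [T, mulVecLin_apply]
    rw [← Matrix.sum_mulVec, h2, one_mulVec]
  let R := LinearMap.range (T i0 i0)
  have hR : ∀ r : R, T i0 i0 r.1 = r.1 := by
    rintro ⟨_, y, rfl⟩
    exact hTT _ _ _ _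
  let f : (Fin a → K) ≃ₗ[K] (Fin c → R) :=
    { toFun := fun y i => ⟨T i0 i y, T i0 i y, hTT _ _ _ _⟩
      map_add' := fun y y' => by ext; simp
      map_smul' := fun k y => by ext; simp
      invFun := fun r => ∑ i, T i i0 (r i).1
      left_inv := fun y => by simp only [hTT, hsum]
      right_inv := fun r => by
        ext k : 2
        simp only
        rw [map_sum, Finset.sum_eq_single k, hTT, hR]
        · exact fun i _ hi => hT0 _ _ _ _ _ hi.symm
        · simp }
  have := f.finrank_eq
  have hR' : finrank K (Fin c → R) = c * finrank K R := by
    rw [Module.finrank_pi_fintype, Finset.sum_const, smul_eq_mul, Finset.card_univ,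
      Fintype.card_fin]
  rw [hR', Module.finrank_fin_fun] at this
  exact this

/-- The nilpotents are the images of the multiples t E₀₁. Their rank is that of the image of E₁₁,
which is a/c = 2, and inside `S` they kill exactly the j(V) whose column 0 vanishes. -/
theorem hasNilpotents_of_antihom [Finite K] {p e : ℕ} (hK : Nat.card K = p ^ e)
    (ha : a = 2 * c) (hc : 2 ≤ c) :
    HasNilpotents (p ^ (b * c * e)) (p ^ (b * e)) S := by
  let i0 : Fin c := ⟨0, by omega⟩
  let i1 : Fin c := ⟨1, by omega⟩
  have h01 : i0 ≠ i1 := by simp [i0, i1]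
  have hrank1 : (Z (single i1 i1 1)).rank = 2 := by
    have h := antihom_rank hS j Z hZ i1
    have h' : c * (Z (single i1 i1 1)).rank = c * 2 := by omega
    exact Nat.eq_of_mul_eq_mul_left (by omega) h'
  have hrank : ∀ t : K, t ≠ 0 → (Z (single i0 i1 t)).rank = 2 := by
    intro t ht
    apply le_antisymm
    · have h : Z (single i1 i1 1) * Z (single i0 i1 t) = Z (single i0 i1 t) := by
        rw [antihom_mul hS j Z hZ, single_mul_single_same, mul_one]
      rw [← h, ← hrank1]
      exact rank_mul_le_left _ _
    · have h : Z (single i0 i1 t) * Z (single i1 i0 t⁻¹) = Z (single i1 i1 1) := by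
        rw [antihom_mul hS j Z hZ, single_mul_single_same, inv_mul_cancel₀ ht]
      rw [← hrank1, ← h]
      exact rank_mul_le_left _ _
  refine ⟨fun t => Z (single i0 i1 t), fun t t' h => ?_, fun t => ⟨?_, hrank _ t.ne_zero, ?_, ?_⟩⟩
  · by_contra hne
    have h0 : (t : K) - t' ≠ 0 := sub_ne_zero.2 fun h => hne (Units.ext h)
    have h1 := hrank _ h0
    have h2 : Z (single i0 i1 (t : K)) = Z (single i0 i1 (t' : K)) + Z (single i0 i1 ((t : K) - t')) := by
      rw [← antihom_add hS j Z hZ, ← single_add, add_sub_cancel]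
    have h3 : Z (single i0 i1 ((t : K) - t')) = 0 := left_eq_add.1 (h.symm.trans h2)
    rw [h3, rank_zero] at h1
    omega
  · rw [antihom_mul hS j Z hZ, single_mul_single_of_ne _ _ _ _ h01.symm, antihom_zero hS j Z hZ]
  · intro U hU
    obtain ⟨V, hV⟩ := j.surjective ⟨U, hU⟩
    have hV : (j V).1 = U := congrArg Subtype.val hV
    rw [← hV, hZ]
    exact (j _).2
  · let f : Matrix (Fin b) (Fin c) K →+ (Fin b → K) :=
      { toFun := fun V i => V i i0
        map_zero' := rfl
        map_add' := fun _ _ => rfl }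
    have hf : Function.Surjective f := fun x => ⟨Matrix.of fun i _ => x i, rfl⟩
    have h1 := natCard_ker_mul_of_surjective f hf
    have h2 : {U | U ∈ S ∧ Z (single i0 i1 (t : K)) * U = 0} = (fun V => (j V).1) '' f.ker := by
      ext U
      constructor
      · rintro ⟨hU, h⟩
        obtain ⟨V, hV⟩ := j.surjective ⟨U, hU⟩
        have hV : (j V).1 = U := congrArg Subtype.val hV
        refine ⟨V, ?_, hV⟩
        rw [← hV, hZ] at h
        have h3 : V * single i0 i1 (t : K) = 0 := j.injective (Subtype.ext (by rw [h, map_zero]; rfl))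
        refine funext fun i => ?_
        have := congrFun (congrFun h3 i) i1
        rw [mul_single_apply_same, Matrix.zero_apply] at this
        exact (mul_eq_zero.1 this).resolve_right t.ne_zero
      · rintro ⟨V, hV, rfl⟩
        refine ⟨(j V).2, ?_⟩
        have h3 : V * single i0 i1 (t : K) = 0 := by
          ext i k
          by_cases hk : k = i1
          · subst hk
            rw [mul_single_apply_same]
            have : V i i0 = 0 := congrFun (show f V = 0 from hV) i
            rw [this, zero_mul]; rfl
          · rw [mul_single_apply_of_ne _ _ _ _ _ hk]; rfl
        rw [hZ, h3, map_zero]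
        rfl
    rw [h2, Set.ncard_image_of_injective _ (fun V V' h => j.injective (Subtype.ext h)),
      ← Nat.card_coe_set_eq]
    rw [natCard_matrix, Nat.card_fun, Nat.card_eq_fintype_card (α := Fin b), Fintype.card_fin, hK,
      ← pow_mul, ← pow_mul] at h1
    rw [mul_comm e, mul_comm e] at h1
    exact h1

omit hS in
theorem hasFieldStructure_of_antihom (hc : c = 1) : HasFieldStructure S := by
  subst hc
  let w : (Fin b → K) →+ Matrix (Fin b) (Fin 1) K :=
    { toFun := fun x => Matrix.of fun i _ => x i
      map_zero' := rfl
      map_add' := fun _ _ => rfl }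
  refine ⟨fun k => Z (k • 1), S.subtype.comp (j.toAddMonoidHom.comp w), ?_, fun U => ?_, fun k x => ?_⟩
  · intro x y h
    have h := j.injective (Subtype.ext h)
    exact funext fun i => congrFun (congrFun h i) 0
  · constructor
    · intro hU
      obtain ⟨V, hV⟩ := j.surjective ⟨U, hU⟩
      refine ⟨fun i => V i 0, ?_⟩
      have : w (fun i => V i 0) = V := by
        ext i k
        rw [Subsingleton.elim k 0]; rfl
      change (j (w _)).1 = U
      rw [this, hV]
    · rintro ⟨x, rfl⟩
      exact (j (w x)).2
  · change (j (w _)).1 = Z _ * (j (w x)).1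
    rw [hZ, Matrix.mul_smul, Matrix.mul_one]
    rfl

end Antihom

/-- A K-independent basis makes the product map S ⊗ M_{1×c}(K) → M_{a×c}(K), tensored over the prime
field, injective. After identification of the two factors through `j`, the flip of the tensor square
therefore acts on its image. -/
theorem hasSwap_of_hasIndepBasis {p ℓ : ℕ} [Fact p.Prime] [Algebra (ZMod p) K]
    {S : AddSubgroup (Matrix (Fin a) (Fin 1) K)} (j : Matrix (Fin 1) (Fin c) K ≃+ S)
    (h : HasIndepBasis p ℓ S) : HasSwap c S := by
  obtain ⟨u, hu, hind⟩ := h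
  have hu1 : ∀ x, u x = ∑ k, x k • u (Pi.single k 1) := fun x => by
    conv_lhs => rw [pi_eq_sum_univ' x, map_sum]
    simp
  have huinj : Function.Injective u := by
    rw [← LinearMap.ker_eq_bot, LinearMap.ker_eq_bot']
    intro x hx
    rw [hu1] at hx
    have hE := hind.restrict_scalars (R := ZMod p) (by
      intro x y hxy
      simpa [Algebra.smul_def] using hxy)
    exact funext fun k => Fintype.linearIndependent_iff.1 hE _ hx k
  let us : (Fin ℓ → ZMod p) →+ S := u.toAddMonoidHom.codRestrict S fun x => (hu _).2 ⟨x, rfl⟩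
  let w : (Fin ℓ → ZMod p) →ₗ[ZMod p] Matrix (Fin 1) (Fin c) K :=
    AddMonoidHom.toZModLinearMap p (j.symm.toAddMonoidHom.comp us)
  have hjw : ∀ x, (j (w x)).1 = u x := fun x => congrArg Subtype.val (j.apply_symm_apply (us x))
  have hwinj : Function.Injective w := fun x y hxy => huinj (by rw [← hjw, hxy, hjw])
  have hwsurj : Function.Surjective w := fun V => by
    obtain ⟨x, hx⟩ := (hu _).1 (j V).2
    exact ⟨x, j.injective (Subtype.ext ((hjw x).trans hx))⟩
  let ψ : (Fin ℓ → Fin ℓ → ZMod p) →ₗ[ZMod p] Matrix (Fin a) (Fin c) K :=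
    { toFun := fun A => ∑ k, u (Pi.single k 1) * w (A k)
      map_add' := fun A B => by simp [Matrix.mul_add, Finset.sum_add_distrib]
      map_smul' := fun t A => by simp [Finset.smul_sum] }
  have hψinj : Function.Injective ψ := by
    rw [← LinearMap.ker_eq_bot, LinearMap.ker_eq_bot']
    intro A hA
    have h1 : ∀ i, ∑ k, (w (A k)) 0 i • u (Pi.single k 1) = 0 := by
      intro i
      ext r s
      have := congrFun (congrFun hA r) i
      rw [Subsingleton.elim s 0]
      simpa [ψ, Matrix.sum_apply, mul_apply, mul_comm] using this
    funext k
    apply hwinj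
    change w (A k) = w 0
    rw [map_zero]
    ext r i
    rw [Subsingleton.elim r 0]
    exact Fintype.linearIndependent_iff.1 hind _ (h1 i) k
  obtain ⟨ρ, hρ⟩ := LinearMap.exists_leftInverse_of_injective ψ (LinearMap.ker_eq_bot.2 hψinj)
  have hρ : ∀ A, ρ (ψ A) = A := LinearMap.congr_fun hρ
  let T : (Fin ℓ → Fin ℓ → ZMod p) →ₗ[ZMod p] (Fin ℓ → Fin ℓ → ZMod p) :=
    { toFun := fun A k m => A m k
      map_add' := fun _ _ => rfl
      map_smul' := fun _ _ => rfl }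
  -- The flip on the image of ψ, extended by the identity on the kernel of the projector ψρ.
  let H : Matrix (Fin a) (Fin c) K →ₗ[ZMod p] Matrix (Fin a) (Fin c) K :=
    ψ ∘ₗ T ∘ₗ ρ + (LinearMap.id - ψ ∘ₗ ρ)
  have hH : ∀ X, H X = ψ (T (ρ X)) + (X - ψ (ρ X)) := fun _ => rfl
  refine ⟨j.symm.toAddMonoidHom, j.toAddMonoidHom, H.toAddMonoidHom, j.symm.injective, j.injective,
    ?_, ?_⟩
  · change Function.Injective H
    rw [← LinearMap.ker_eq_bot, LinearMap.ker_eq_bot']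
    intro X hX
    have h1 : T (ρ X) = 0 := by
      have := congrArg ρ hX
      rwa [hH, map_add, map_sub, hρ, hρ, sub_self, add_zero, map_zero] at this
    have h2 : ρ X = 0 := congrArg T h1
    rw [hH, h2] at hX
    simpa using hX
  · intro U V
    obtain ⟨V', rfl⟩ := j.surjective U
    obtain ⟨x, rfl⟩ := hwsurj V
    obtain ⟨y, rfl⟩ := hwsurj V'
    change H _ = (j (w x)).1 * j.symm (j (w y))
    rw [j.symm_apply_apply, hjw, hjw]
    have key : ∀ x y, u x * w y = ψ fun k => x k • y := by
      intro x y
      rw [hu1, Matrix.sum_mul]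
      simp only [ψ, LinearMap.coe_mk, AddHom.coe_mk, map_smul, Matrix.mul_smul, Matrix.smul_mul]
    rw [hH, key, key, hρ, sub_self, add_zero]
    congr 1
    funext k m
    simp [T, mul_comm]

end HeisNursery

/-! ### Galois expansions and swaps for b = 1 -/

namespace HeisNursery
open Matrix Module

section Galois

variable {p : ℕ} [Fact p.Prime] {K : Type*} [Field K] [Finite K] [Algebra (ZMod p) K]

omit [Finite K] in
theorem linearIndependent_galois :
    LinearIndependent K fun σ : K ≃ₐ[ZMod p] K => σ.toLinearMap :=
  (linearIndependent_toLinearMap (ZMod p) K K).comp (fun σ : K ≃ₐ[ZMod p] K => σ.toAlgHom)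
    fun _ _ h => AlgEquiv.ext fun x => DFunLike.congr_fun h x

theorem galois_coeff_eq_zero (m : (K ≃ₐ[ZMod p] K) → K) (h : ∀ k, ∑ σ, m σ * σ k = 0) (σ) :
    m σ = 0 := by
  have h0 : ∑ σ : K ≃ₐ[ZMod p] K, m σ • σ.toLinearMap = 0 := by
    refine LinearMap.ext fun k => ?_
    rw [LinearMap.sum_apply]
    exact h k
  have hind := linearIndependent_galois (p := p) (K := K)
  rw [Fintype.linearIndependent_iff] at hind
  exact hind m h0 σ

/-- The automorphisms are K-independent by Dedekind's lemma, and their number equals the K-dimension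
of the space of additive maps K → K. -/
theorem exists_galois_expansion (f : K →+ K) :
    ∃ m : (K ≃ₐ[ZMod p] K) → K, ∀ k, f k = ∑ σ, m σ * σ k := by
  have hfin : FiniteDimensional K (K →ₗ[ZMod p] K) :=
    have : Finite (K →ₗ[ZMod p] K) := Finite.of_injective _ DFunLike.coe_injective
    inferInstance
  have h := linearIndependent_galois (p := p) (K := K)|>.span_eq_top_of_card_eq_finrank' (by
    rw [Module.finrank_linearMap_self, ← Nat.card_eq_fintype_card, IsGalois.card_aut_eq_finrank])
  have hf : AddMonoidHom.toZModLinearMap p f ∈ Submodule.span K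
      (Set.range fun σ : K ≃ₐ[ZMod p] K => σ.toLinearMap) := h ▸ Submodule.mem_top
  obtain ⟨m, hm⟩ := (Submodule.mem_span_range_iff_exists_fun K).1 hf
  refine ⟨m, fun k => ?_⟩
  have := LinearMap.congr_fun hm k
  simpa [LinearMap.sum_apply] using this.symm

theorem exists_galois_matrix_expansion {a c : ℕ}
    (f : Matrix (Fin 1) (Fin c) K →+ Matrix (Fin a) (Fin 1) K) :
    ∃ M : (K ≃ₐ[ZMod p] K) → Matrix (Fin a) (Fin c) K, ∀ V, f V = ∑ σ, M σ * (V.map σ)ᵀ := by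
  have h : ∀ (r : Fin a) (n : Fin c), ∃ m : (K ≃ₐ[ZMod p] K) → K,
      ∀ k, f (single 0 n k) r 0 = ∑ σ, m σ * σ k := fun r n =>
    exists_galois_expansion
      { toFun := fun k => f (single 0 n k) r 0
        map_zero' := by rw [single_zero, map_zero]; rfl
        map_add' := fun k k' => by rw [single_add, map_add]; rfl }
  choose m hm using h
  refine ⟨fun σ => Matrix.of fun r n => m r n σ, fun V => ?_⟩
  have hV : V = ∑ n, single 0 n (V 0 n) := by
    ext i k
    rw [Subsingleton.elim i 0, Matrix.sum_apply, Finset.sum_eq_single k]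
    · simp
    · intro n _ hn
      exact single_apply_of_ne _ _ _ _ _ (by simp [hn])
    · simp
  ext r s
  rw [Subsingleton.elim s 0]
  conv_lhs => rw [hV, map_sum]
  rw [Matrix.sum_apply, Matrix.sum_apply]
  simp only [hm, mul_apply, of_apply, transpose_apply, map_apply]
  exact Finset.sum_comm

theorem galois_matrix_coeff_eq_zero {a c : ℕ} (M : (K ≃ₐ[ZMod p] K) → Matrix (Fin a) (Fin c) K)
    (h : ∀ V : Matrix (Fin 1) (Fin c) K, ∑ σ, M σ * (V.map σ)ᵀ = 0) (σ) : M σ = 0 := by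
  ext r n
  refine galois_coeff_eq_zero (fun σ => M σ r n) (fun k => ?_) σ
  have := congrFun (congrFun (h (single 0 n k)) r) 0
  rw [Matrix.sum_apply] at this
  rw [Matrix.zero_apply] at this
  rw [← this]
  refine Finset.sum_congr rfl fun σ _ => ?_
  rw [mul_apply, Finset.sum_eq_single n]
  · simp
  · intro i _ hi
    simp [hi.symm]
  · simp

end Galois

/-- Expand j(V) = ∑ M_σ σ(V)ᵀ. Each nonzero M_σ intertwines Z with a Galois twist of M_c(K), so it
contributes c dimensions independently of the others; since a = 2c there are exactly two such σ, τ.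
Thus X = M_σ P + M_τ R gives coordinates (P, R) on M_{a×c}(K), in which the exchange can be written
down. -/
theorem hasSwap_of_two_mul {p a c : ℕ} [Fact p.Prime] {K : Type*} [Field K] [Finite K]
    [Algebra (ZMod p) K] {S : AddSubgroup (Matrix (Fin a) (Fin 1) K)} (hS : SpanTop S)
    (j : Matrix (Fin 1) (Fin c) K ≃+ S)
    (Z : Matrix (Fin c) (Fin c) K → Matrix (Fin a) (Fin a) K)
    (hZ : ∀ h V, Z h * (j V).1 = (j (V * h)).1) (hc : 0 < c) (ha : a = 2 * c) : HasSwap c S := by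
  classical
  obtain ⟨M, hM⟩ := exists_galois_matrix_expansion (p := p) (S.subtype.comp j.toAddMonoidHom)
  have hM : ∀ V, (j V).1 = ∑ σ, M σ * (V.map σ)ᵀ := hM
  have hZM : ∀ h σ, Z h * M σ = M σ * (h.map σ)ᵀ := by
    intro h σ
    rw [← sub_eq_zero]
    refine galois_matrix_coeff_eq_zero (fun σ => Z h * M σ - M σ * (h.map σ)ᵀ) (fun V => ?_) σ
    have h1 := hZ h V
    rw [hM, hM, Matrix.mul_sum] at h1
    simp only [Matrix.sub_mul, Finset.sum_sub_distrib]
    rw [sub_eq_zero]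
    simp only [Matrix.mul_assoc]
    rw [h1]
    refine Finset.sum_congr rfl fun σ _ => ?_
    rw [← transpose_mul, Matrix.map_mul]
  have hind : ∀ y : (K ≃ₐ[ZMod p] K) → Fin c → K, ∑ σ, M σ *ᵥ y σ = 0 →
      ∀ σ, M σ ≠ 0 → y σ = 0 := by
    intro y hy σ hσ
    obtain ⟨r, n, hrn⟩ : ∃ r n, M σ r n ≠ 0 := by
      by_contra hc
      push Not at hc
      exact hσ (Matrix.ext hc)
    funext m
    -- Applying Z to k times a matrix unit multiplies the summand of σ by σ(k); the independence of
    -- automorphisms, with k varying, separates the summands.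
    have h1 : M σ r n * y σ m = 0 := by
      refine galois_coeff_eq_zero (fun σ => M σ r n * y σ m) (fun k => ?_) σ
      have h2 : ∑ σ, Z (single m n k) *ᵥ (M σ *ᵥ y σ) = 0 := by
        have := congrArg (Z (single m n k) *ᵥ ·) hy
        simpa [mulVec_sum] using this
      have h3 := congrFun h2 r
      rw [Finset.sum_apply, Pi.zero_apply] at h3
      rw [← h3]
      refine Finset.sum_congr rfl fun σ _ => ?_
      rw [mulVec_mulVec, hZM, ← mulVec_mulVec]
      have h4 : ((single m n k).map σ)ᵀ *ᵥ y σ = Pi.single n (σ k * y σ m) := by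
        have : (single m n k).map σ = single m n (σ k) := by
          ext i l
          simp only [map_apply, single_apply]
          split_ifs <;> simp
        rw [this, transpose_single]
        ext i
        rw [single_mulVec]
        simp [Function.update_apply, Pi.single_apply]
      rw [h4, mulVec_single]
      simp
      ring
    exact (mul_eq_zero.1 h1).resolve_left hrn
  -- exactly two of the coefficients are nonzero
  let I : Finset (K ≃ₐ[ZMod p] K) := Finset.univ.filter fun σ => M σ ≠ 0
  have hsumI : ∀ y : (K ≃ₐ[ZMod p] K) → Fin c → K,
      ∑ σ : I, M σ.1 *ᵥ y σ = ∑ σ, M σ *ᵥ y σ := by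
    intro y
    rw [Finset.sum_coe_sort I fun σ => M σ *ᵥ y σ]
    refine Finset.sum_subset (Finset.subset_univ _) fun σ _ hσ => ?_
    have : M σ = 0 := by simpa [I] using hσ
    rw [this, zero_mulVec]
  let f : (I → Fin c → K) →ₗ[K] (Fin a → K) :=
    { toFun := fun y => ∑ σ : I, M σ.1 *ᵥ y σ
      map_add' := fun y z => by simp [mulVec_add, Finset.sum_add_distrib]
      map_smul' := fun k y => by simp [mulVec_smul, Finset.smul_sum] }
  have hfinj : Function.Injective f := by
    rw [← LinearMap.ker_eq_bot, LinearMap.ker_eq_bot']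
    intro y hy
    let y' : (K ≃ₐ[ZMod p] K) → Fin c → K := fun σ => if h : σ ∈ I then y ⟨σ, h⟩ else 0
    have hy' : ∀ σ : I, y' σ = y σ := fun σ => by simp [y']
    have h1 := hsumI y'
    simp only [hy'] at h1
    funext σ
    rw [← hy']
    exact hind y' (h1.symm.trans hy) σ (Finset.mem_filter.1 σ.2).2
  have hfsurj : Function.Surjective f := by
    rw [← LinearMap.range_eq_top]
    refine hS.eq_top _ fun U hU v => ?_
    obtain ⟨V, hV⟩ := j.surjective ⟨U, hU⟩
    have hV : (j V).1 = U := congrArg Subtype.val hV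
    refine ⟨fun σ => (V.map σ.1)ᵀ *ᵥ v, ?_⟩
    rw [← hV, hM, Matrix.sum_mulVec]
    change ∑ σ : I, M σ.1 *ᵥ _ = _
    rw [hsumI fun σ => (V.map σ)ᵀ *ᵥ v]
    simp
  have hcard : I.card = 2 := by
    have := (LinearEquiv.ofBijective f ⟨hfinj, hfsurj⟩).finrank_eq
    have h1 : finrank K (I → Fin c → K) = I.card * c := by
      rw [Module.finrank_pi_fintype]
      simp
    rw [h1, Module.finrank_fin_fun, ha] at this
    exact Nat.eq_of_mul_eq_mul_right hc this
  obtain ⟨σ, τ, hστ, hI⟩ := Finset.card_eq_two.1 hcard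
  have hσ : M σ ≠ 0 := by
    have : σ ∈ I := by rw [hI]; simp
    simpa [I] using this
  have hτ : M τ ≠ 0 := by
    have : τ ∈ I := by rw [hI]; simp
    simpa [I] using this
  have hother : ∀ ρ, ρ ≠ σ → ρ ≠ τ → M ρ = 0 := by
    intro ρ h1 h2
    have : ρ ∉ I := by rw [hI]; simp [h1, h2]
    simpa [I] using this
  have hjM : ∀ V, (j V).1 = M σ * (V.map σ)ᵀ + M τ * (V.map τ)ᵀ := by
    intro V
    rw [hM, ← Finset.sum_subset (Finset.subset_univ {σ, τ}), Finset.sum_pair hστ]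
    intro ρ _ hρ
    have hρ : ρ ≠ σ ∧ ρ ≠ τ := by simpa using hρ
    rw [hother ρ hρ.1 hρ.2, Matrix.zero_mul]
  let ψ : Matrix (Fin c) (Fin c) K × Matrix (Fin c) (Fin c) K →+ Matrix (Fin a) (Fin c) K :=
    { toFun := fun P => M σ * P.1 + M τ * P.2
      map_zero' := by simp
      map_add' := fun P Q => by
        simp only [Prod.fst_add, Prod.snd_add, Matrix.mul_add]
        abel }
  have hψ : Function.Bijective ψ := by
    rw [Nat.bijective_iff_injective_and_card]
    constructor
    · rw [injective_iff_map_eq_zero]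
      rintro ⟨P, R⟩ h
      have h : M σ * P + M τ * R = 0 := h
      have hcol : ∀ v, P *ᵥ v = 0 ∧ R *ᵥ v = 0 := by
        intro v
        have h1 : M σ *ᵥ (P *ᵥ v) + M τ *ᵥ (R *ᵥ v) = 0 := by
          rw [mulVec_mulVec, mulVec_mulVec, ← add_mulVec, h, zero_mulVec]
        let y : (K ≃ₐ[ZMod p] K) → Fin c → K :=
          fun ρ => if ρ = σ then P *ᵥ v else if ρ = τ then R *ᵥ v else 0
        have h2 : ∑ ρ, M ρ *ᵥ y ρ = 0 := by
          rw [← Finset.sum_subset (Finset.subset_univ {σ, τ}), Finset.sum_pair hστ]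
          · simpa [y, hστ.symm] using h1
          · intro ρ _ hρ
            have hρ : ρ ≠ σ ∧ ρ ≠ τ := by simpa using hρ
            rw [hother ρ hρ.1 hρ.2, zero_mulVec]
        refine ⟨?_, ?_⟩
        · simpa [y] using hind y h2 σ hσ
        · simpa [y, hστ.symm] using hind y h2 τ hτ
      exact Prod.ext (matrix_ext_mulVec fun v => by rw [(hcol v).1]; simp)
        (matrix_ext_mulVec fun v => by rw [(hcol v).2]; simp)
    · rw [Nat.card_prod, natCard_matrix, natCard_matrix, ← pow_add, ha]
      ring_nf
  let ψe := AddEquiv.ofBijective ψ hψ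
  have hψe : ∀ P R, ψe (P, R) = M σ * P + M τ * R := fun P R => rfl
  -- The twists are crossed so that the coordinates of j(V') V go to σ(V)ᵀ στ(V') and τ(V)ᵀ τσ(V').
  -- These are the coordinates of j(V) στ(V') because the Galois group is commutative.
  let T : Matrix (Fin c) (Fin c) K × Matrix (Fin c) (Fin c) K →+
      Matrix (Fin c) (Fin c) K × Matrix (Fin c) (Fin c) K :=
    { toFun := fun P => ((P.2.map σ)ᵀ, (P.1.map τ)ᵀ)
      map_zero' := by ext <;> simp
      map_add' := fun P Q => by ext <;> simp }
  have hmap : ∀ (ρ : K ≃ₐ[ZMod p] K) {m n : ℕ}, Function.Injective fun P : Matrix (Fin m) (Fin n) K =>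
      P.map ρ := fun ρ m n P Q h =>
    Matrix.ext fun i k => ρ.injective (congrFun (congrFun h i) k)
  have hT : Function.Injective T := by
    rintro ⟨P, R⟩ ⟨P', R'⟩ h
    have h1 := congrArg Prod.fst h
    have h2 := congrArg Prod.snd h
    exact Prod.ext (hmap τ (transpose_injective h2)) (hmap σ (transpose_injective h1))
  have hcomm : σ * τ = τ * σ := by
    obtain ⟨g, hg⟩ := IsCyclic.exists_generator (α := K ≃ₐ[ZMod p] K)
    obtain ⟨m, rfl⟩ := hg σ
    obtain ⟨n, rfl⟩ := hg τ
    exact ((Commute.refl g).zpow_zpow m n)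
  let F : Matrix (Fin 1) (Fin c) K →+ Matrix (Fin 1) (Fin c) K :=
    { toFun := fun V => (V.map τ).map σ
      map_zero' := by ext; simp
      map_add' := fun _ _ => by ext; simp }
  refine ⟨F.comp j.symm.toAddMonoidHom, j.toAddMonoidHom,
    (ψe.toAddMonoidHom.comp T).comp ψe.symm.toAddMonoidHom, ((hmap σ).comp (hmap τ)).comp j.symm.injective,
    j.injective, (ψe.injective.comp hT).comp ψe.symm.injective, fun U V => ?_⟩
  obtain ⟨V', rfl⟩ := j.surjective U
  change ψe (T (ψe.symm ((j V').1 * V))) = (j V).1 * ((j.symm (j V')).map τ).map σ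
  have h1 : ψe ((V'.map σ)ᵀ * V, (V'.map τ)ᵀ * V) = (j V').1 * V := by
    rw [hψe, hjM, Matrix.add_mul, Matrix.mul_assoc, Matrix.mul_assoc]
  rw [← h1, ψe.symm_apply_apply, j.symm_apply_apply, hjM, Matrix.add_mul]
  change M σ * _ + M τ * _ = _
  rw [Matrix.mul_assoc, Matrix.mul_assoc]
  have key : ∀ ρ π : K ≃ₐ[ZMod p] K, (((V'.map π)ᵀ * V).map ρ)ᵀ = (V.map ρ)ᵀ * (V'.map π).map ρ := by
    intro ρ π
    rw [Matrix.map_mul, transpose_mul]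
    rfl
  congr 2
  · exact key σ τ
  · have h2 : (V'.map τ).map σ = (V'.map σ).map τ :=
      Matrix.ext fun i k => DFunLike.congr_fun hcomm (V' i k)
    rw [h2]
    exact key τ σ

end HeisNursery

/-! ### Coordinates on the Heisenberg group and on kinds -/

namespace HeisNursery
open Matrix Module

section Coordinates

variable {a b c : ℕ} {K : Type*} [Field K]

def heisMk (U : Matrix (Fin a) (Fin b) K) (V : Matrix (Fin b) (Fin c) K)
    (W : Matrix (Fin a) (Fin c) K) : heis a b c K :=
  ⟨⟨blockMat U V W, blockMat (-U) (-V) (-W + U * V),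
    by rw [blockMat_mul, ← blockMat_zero]; congr 1 <;> simp,
    by rw [blockMat_mul, ← blockMat_zero]; congr 1 <;> simp⟩, U, V, W, rfl⟩

def uCoord (g : heis a b c K) : Matrix (Fin a) (Fin b) K :=
  Matrix.of fun i j => (g.1 : Matrix (Idx a b c) (Idx a b c) K) (.inl i) (.inr (.inl j))

def vCoord (g : heis a b c K) : Matrix (Fin b) (Fin c) K :=
  Matrix.of fun i j => (g.1 : Matrix (Idx a b c) (Idx a b c) K) (.inr (.inl i)) (.inr (.inr j))

def wCoord (g : heis a b c K) : Matrix (Fin a) (Fin c) K :=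
  Matrix.of fun i j => (g.1 : Matrix (Idx a b c) (Idx a b c) K) (.inl i) (.inr (.inr j))

variable (U U' : Matrix (Fin a) (Fin b) K) (V V' : Matrix (Fin b) (Fin c) K)
  (W W' : Matrix (Fin a) (Fin c) K)

@[simp] theorem uCoord_heisMk : uCoord (heisMk U V W) = U := rfl

@[simp] theorem vCoord_heisMk : vCoord (heisMk U V W) = V := rfl

theorem heisMk_eta (g : heis a b c K) : heisMk (uCoord g) (vCoord g) (wCoord g) = g := by
  obtain ⟨U, V, W, h⟩ := g.2
  refine Subtype.ext (Units.ext (Eq.trans (b := blockMat U V W) ?_ h.symm))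
  change blockMat _ _ _ = blockMat _ _ _
  congr 1 <;> ext i j <;> simp [uCoord, vCoord, wCoord, h, blockMat]

theorem heisMk_mul : heisMk U V W * heisMk U' V' W' =
    heisMk (U + U') (V + V') (W + W' + U * V') :=
  Subtype.ext (Units.ext (blockMat_mul U U' V V' W W'))

theorem heisMk_zero : (heisMk 0 0 0 : heis a b c K) = 1 :=
  Subtype.ext (Units.ext blockMat_zero)

theorem uCoord_mul (g h : heis a b c K) : uCoord (g * h) = uCoord g + uCoord h := by
  conv_lhs => rw [← heisMk_eta g, ← heisMk_eta h, heisMk_mul]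
  rfl

theorem vCoord_mul (g h : heis a b c K) : vCoord (g * h) = vCoord g + vCoord h := by
  conv_lhs => rw [← heisMk_eta g, ← heisMk_eta h, heisMk_mul]
  rfl

theorem wCoord_mul (g h : heis a b c K) :
    wCoord (g * h) = wCoord g + wCoord h + uCoord g * vCoord h := by
  conv_lhs => rw [← heisMk_eta g, ← heisMk_eta h, heisMk_mul]
  rfl

theorem mem_Gamma₂ (g : heis a b c K) : g ∈ Gamma₂ a b c K ↔ uCoord g = 0 := by
  constructor
  · rintro ⟨V, W, h⟩
    ext i j
    simp [uCoord, h, blockMat]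
  · intro h
    refine ⟨vCoord g, wCoord g, ?_⟩
    conv_lhs => rw [← heisMk_eta g, h]
    rfl

def uHom (a b c : ℕ) (K : Type*) [Field K] :
    heis a b c K →* Multiplicative (Matrix (Fin a) (Fin b) K) where
  toFun g := Multiplicative.ofAdd (uCoord g)
  map_one' := by rw [← heisMk_zero]; rfl
  map_mul' g h := by rw [uCoord_mul]; rfl

end Coordinates

section Kinds

variable {a b : ℕ} (c : ℕ) {K : Type*} [Field K]

/-- The subgroup of the matrices whose upper block lies in `S`. -/
def kind (S : AddSubgroup (Matrix (Fin a) (Fin b) K)) : Subgroup (heis a b c K) :=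
  S.toSubgroup.comap (uHom a b c K)

theorem mem_kind (S : AddSubgroup (Matrix (Fin a) (Fin b) K)) (g : heis a b c K) :
    g ∈ kind c S ↔ uCoord g ∈ S := Iff.rfl

theorem kind_injective : Function.Injective (kind c : AddSubgroup (Matrix (Fin a) (Fin b) K) → _) := by
  intro S T h
  ext U
  have : heisMk U 0 0 ∈ kind c S ↔ heisMk U 0 0 ∈ kind c T := by rw [h]
  exact this

theorem relIndex_kind (S : AddSubgroup (Matrix (Fin a) (Fin b) K)) :
    (Gamma₂ a b c K).relIndex (kind c S) = Nat.card S := by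
  let f : kind c S →* Multiplicative (Matrix (Fin a) (Fin b) K) :=
    (uHom a b c K).comp (kind c S).subtype
  have h1 : (Gamma₂ a b c K).subgroupOf (kind c S) = f.ker := by
    ext g
    rw [Subgroup.mem_subgroupOf, mem_Gamma₂]
    rfl
  rw [Subgroup.relIndex, h1, Subgroup.index_ker]
  refine Nat.card_congr (Equiv.subtypeEquiv Multiplicative.toAdd fun x => ?_)
  constructor
  · rintro ⟨g, rfl⟩
    exact g.2
  · intro hx
    exact ⟨⟨heisMk x.toAdd 0 0, hx⟩, rfl⟩

theorem kinder_eq_image (m : ℕ) : kinder a b c K m = kind c '' Gr a b K m := by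
  ext Q
  constructor
  · rintro ⟨hQ, hm⟩
    let S : AddSubgroup (Matrix (Fin a) (Fin b) K) := Subgroup.toAddSubgroup' (Q.map (uHom a b c K))
    have hS : kind c S = Q := by
      ext g
      rw [mem_kind]
      constructor
      · rintro ⟨h, hh, hg⟩
        have hg : uCoord h = uCoord g := hg
        have h1 : h⁻¹ * g ∈ Gamma₂ a b c K := by
          rw [mem_Gamma₂]
          have h2 := uCoord_mul h (h⁻¹ * g)
          rw [mul_inv_cancel_left, hg] at h2
          exact left_eq_add.1 h2
        have := Q.mul_mem hh (hQ h1)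
        rwa [mul_inv_cancel_left] at this
      · intro hg
        exact ⟨g, hg, rfl⟩
    refine ⟨S, ?_, hS⟩
    change Nat.card S = m
    rw [← relIndex_kind c, hS, hm]
  · rintro ⟨S, hS, rfl⟩
    refine ⟨fun g hg => ?_, ?_⟩
    · rw [mem_kind, (mem_Gamma₂ g).1 hg]
      exact S.zero_mem
    · rw [relIndex_kind]
      exact hS

theorem ncard_kinder (m : ℕ) : (kinder a b c K m).ncard = (Gr a b K m).ncard := by
  rw [kinder_eq_image, Set.ncard_image_of_injective _ (kind_injective c)]

theorem ncard_kinder_sep (m : ℕ) (P : Subgroup (heis a b c K) → Prop) :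
    {Q ∈ kinder a b c K m | P Q}.ncard = {S ∈ Gr a b K m | P (kind c S)}.ncard := by
  rw [kinder_eq_image, ← Set.ncard_image_of_injective _ (kind_injective c)]
  congr 1
  ext Q
  constructor
  · rintro ⟨⟨S, hS, rfl⟩, hP⟩
    exact ⟨S, ⟨hS, hP⟩, rfl⟩
  · rintro ⟨S, ⟨hS, hP⟩, rfl⟩
    exact ⟨⟨S, hS, rfl⟩, hP⟩

end Kinds

section Orbit

variable {a b c : ℕ} {K : Type*} [Field K]

theorem map_Gamma₂_of_uCoord {Q : Subgroup (heis a b c K)} {ι : Q →* heis a b c K}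
    (hι : IsKindEmbedding ι) (α : Q ≃* Q) (h : ∀ g, uCoord g.1 = 0 ↔ uCoord (ι (α g)) = 0) :
    (((Gamma₂ a b c K).subgroupOf Q).map α.toMonoidHom).map ι = Gamma₂ a b c K := by
  ext g
  constructor
  · rintro ⟨_, ⟨g, hg, rfl⟩, rfl⟩
    rw [mem_Gamma₂]
    exact (h g).1 ((mem_Gamma₂ _).1 hg)
  · intro hg
    obtain ⟨k, rfl⟩ := hι.2 hg
    refine ⟨k, ⟨α.symm k, ?_, α.apply_symm_apply k⟩, rfl⟩
    change _ ∈ Gamma₂ a b c K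
    have := (h (α.symm k)).2 (by rw [α.apply_symm_apply]; exact (mem_Gamma₂ _).1 hg)
    exact (mem_Gamma₂ _).2 this

/-- For the converse inclusion, a member of the orbit given by α is the preimage of Γ₂ under the
inclusion composed with α⁻¹. -/
theorem EmbeddingsConjugate.singleOrbit {Q : Subgroup (heis a b c K)} (hQ : Gamma₂ a b c K ≤ Q)
    (h : EmbeddingsConjugate Q) : SingleOrbit Q := by
  ext A
  constructor
  · rintro ⟨ι, hι, rfl⟩
    obtain ⟨α, hα⟩ := h ι hι
    refine ⟨α, ?_⟩
    conv_lhs => rw [← hα]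
    exact Subgroup.comap_map_eq_self_of_injective hι.1 _
  · rintro ⟨α, rfl⟩
    refine ⟨Q.subtype.comp α.symm.toMonoidHom, ⟨?_, ?_⟩, ?_⟩
    · exact Subtype.val_injective.comp α.symm.injective
    · intro g hg
      exact ⟨α ⟨g, hQ hg⟩, by simp⟩
    · rw [← Subgroup.comap_comap]
      exact (Subgroup.comap_equiv_eq_map_symm α.symm _).symm

end Orbit

end HeisNursery

/-! ### Linearizing embeddings and lifting to automorphisms -/

namespace HeisNursery
open Matrix Module

section Embedding

variable {a b c : ℕ} {K : Type*} [Field K] {S : AddSubgroup (Matrix (Fin a) (Fin b) K)}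

def kindMk (x : S × Matrix (Fin b) (Fin c) K) (W : Matrix (Fin a) (Fin c) K) : kind c S :=
  ⟨heisMk x.1.1 x.2 W, x.1.2⟩

theorem kindMk_mul (x y : S × Matrix (Fin b) (Fin c) K) (W W' : Matrix (Fin a) (Fin c) K) :
    kindMk x W * kindMk y W' = kindMk (x + y) (W + W' + x.1.1 * y.2) :=
  Subtype.ext (heisMk_mul _ _ _ _ _ _)

theorem kindMk_surjective (g : kind c S) : ∃ x W, kindMk x W = g :=
  ⟨(⟨uCoord g.1, g.2⟩, vCoord g.1), wCoord g.1, Subtype.ext (heisMk_eta g.1)⟩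

theorem kindMk_inj {x y : S × Matrix (Fin b) (Fin c) K} {W W' : Matrix (Fin a) (Fin c) K} :
    kindMk x W = kindMk y W' ↔ x = y ∧ W = W' := by
  refine ⟨fun h => ?_, by rintro ⟨rfl, rfl⟩; rfl⟩
  have h1 : heisMk x.1.1 x.2 W = heisMk y.1.1 y.2 W' := congrArg Subtype.val h
  exact ⟨Prod.ext (Subtype.ext (congrArg uCoord h1)) (congrArg vCoord h1), congrArg wCoord h1⟩

theorem kindMk_eq (x : S × Matrix (Fin b) (Fin c) K) (W : Matrix (Fin a) (Fin c) K) :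
    kindMk x W = kindMk x 0 * kindMk 0 W := by
  rw [kindMk_mul]
  congr 1 <;> simp

/-- An automorphism of a kind given in coordinates. -/
theorem exists_mulEquiv_kind [Finite K]
    (L : S × Matrix (Fin b) (Fin c) K →+ S × Matrix (Fin b) (Fin c) K)
    (N : Matrix (Fin a) (Fin c) K →+ Matrix (Fin a) (Fin c) K)
    (τ : S × Matrix (Fin b) (Fin c) K → Matrix (Fin a) (Fin c) K)
    (hL : Function.Injective L) (hN : Function.Injective N)
    (h : ∀ x y, N (x.1.1 * y.2) + τ (x + y) = τ x + τ y + (L x).1.1 * (L y).2) :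
    ∃ α : kind c S ≃* kind c S, ∀ x W, α (kindMk x W) = kindMk (L x) (N W + τ x) := by
  let f : kind c S → kind c S := fun g => kindMk
    (L (⟨uCoord g.1, g.2⟩, vCoord g.1)) (N (wCoord g.1) + τ (⟨uCoord g.1, g.2⟩, vCoord g.1))
  have hf : ∀ x W, f (kindMk x W) = kindMk (L x) (N W + τ x) := fun x W => rfl
  let F : kind c S →* kind c S := MonoidHom.mk' f fun g g' => by
    obtain ⟨x, W, rfl⟩ := kindMk_surjective g
    obtain ⟨y, W', rfl⟩ := kindMk_surjective g'
    rw [kindMk_mul, hf, hf, hf, kindMk_mul, kindMk_inj]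
    refine ⟨map_add _ _ _, ?_⟩
    rw [map_add, map_add, add_assoc _ (N (_ * _)), h]
    abel
  have hF : Function.Injective F := by
    intro g g' hg
    obtain ⟨x, W, rfl⟩ := kindMk_surjective g
    obtain ⟨y, W', rfl⟩ := kindMk_surjective g'
    have hg : f (kindMk x W) = f (kindMk y W') := hg
    rw [hf, hf, kindMk_inj] at hg
    obtain rfl := hL hg.1
    rw [kindMk_inj]
    exact ⟨rfl, hN (add_right_cancel hg.2)⟩
  have hfin : Finite (kind c S) := by
    have : Function.Surjective fun y : (S × Matrix (Fin b) (Fin c) K) × Matrix (Fin a) (Fin c) K =>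
        (kindMk y.1 y.2 : kind c S) := fun g => by
      obtain ⟨x, W, rfl⟩ := kindMk_surjective g
      exact ⟨(x, W), rfl⟩
    exact Finite.of_surjective _ this
  exact ⟨MulEquiv.ofBijective F (Finite.injective_iff_bijective.1 hF), hf⟩

variable [Finite K] (hc : 0 < c) (hS : KerTrivial S) (ι : kind c S →* heis a b c K)
  (hι : IsKindEmbedding ι)
include hc hS hι

/-- The preimage of an element (0, 0, W') commutes with the whole kind, so by `KerTrivial` it lies
in the block `W`. This gives an injection of that finite block into itself, hence a bijection, and
every W is reached. -/
theorem exists_map_center (W : Matrix (Fin a) (Fin c) K) :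
    ∃ W', ι (kindMk 0 W) = heisMk 0 0 W' := by
  have h : ∀ W', ∃ W, ι (kindMk 0 W) = heisMk 0 0 W' := by
    intro W'
    obtain ⟨g, hg⟩ := hι.2 ((mem_Gamma₂ (heisMk (0 : Matrix (Fin a) (Fin b) K)
      (0 : Matrix (Fin b) (Fin c) K) W')).2 rfl)
    obtain ⟨x, W, rfl⟩ := kindMk_surjective g
    have hcomm : ∀ y, kindMk x W * kindMk y 0 = kindMk y 0 * kindMk x W := by
      intro y
      apply hι.1
      rw [map_mul, map_mul, hg, ← heisMk_eta (ι (kindMk y 0)), heisMk_mul, heisMk_mul]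
      congr 1 <;> simp [add_comm]
    have hform : ∀ y : S × Matrix (Fin b) (Fin c) K, x.1.1 * y.2 = y.1.1 * x.2 := by
      intro y
      have := hcomm y
      rw [kindMk_mul, kindMk_mul, kindMk_inj] at this
      simpa using this.2
    have h2 : x.2 = 0 := hS.eq_zero_of_mul _ fun U hU => by
      have := hform (⟨U, hU⟩, 0)
      rw [Matrix.mul_zero] at this
      exact this.symm
    have h1 : x.1.1 = 0 := by
      ext i j
      have := congrFun (congrFun (hform (0, single j ⟨0, hc⟩ 1)) i) ⟨0, hc⟩
      simpa using this
    refine ⟨W, ?_⟩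
    have : x = 0 := Prod.ext (Subtype.ext h1) h2
    rw [← hg, this]
  choose κ hκ using h
  have hinj : Function.Injective κ := by
    intro W₁ W₂ h
    have := (hκ W₁).symm.trans ((congrArg (fun W => ι (kindMk 0 W)) h).trans (hκ W₂))
    exact congrArg wCoord this
  obtain ⟨W', rfl⟩ := Finite.surjective_of_injective hinj W
  exact ⟨W', hκ W'⟩

/-- The linear data of an embedding of a kind as a kind. -/
theorem exists_kindData : ∃ D : KindData c S,
    ∀ x W, uCoord (ι (kindMk x W)) = 0 ↔ x ∈ Set.range D.J := by
  have hcen := exists_map_center hc hS ι hι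
  have hu0 : ∀ W, uCoord (ι (kindMk 0 W)) = 0 := fun W => by
    obtain ⟨W', h⟩ := hcen W
    rw [h, uCoord_heisMk]
  have hv0 : ∀ W, vCoord (ι (kindMk 0 W)) = 0 := fun W => by
    obtain ⟨W', h⟩ := hcen W
    rw [h, vCoord_heisMk]
  have hu : ∀ x W, uCoord (ι (kindMk x W)) = uCoord (ι (kindMk x 0)) := fun x W => by
    rw [kindMk_eq x W, map_mul, uCoord_mul, hu0, add_zero]
  have hv : ∀ x W, vCoord (ι (kindMk x W)) = vCoord (ι (kindMk x 0)) := fun x W => by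
    rw [kindMk_eq x W, map_mul, vCoord_mul, hv0, add_zero]
  let u : S × Matrix (Fin b) (Fin c) K →+ Matrix (Fin a) (Fin b) K :=
    AddMonoidHom.mk' (fun x => uCoord (ι (kindMk x 0))) fun x y => by
      rw [← uCoord_mul, ← map_mul, kindMk_mul]
      exact (hu _ _).symm
  let v : S × Matrix (Fin b) (Fin c) K →+ Matrix (Fin b) (Fin c) K :=
    AddMonoidHom.mk' (fun x => vCoord (ι (kindMk x 0))) fun x y => by
      rw [← vCoord_mul, ← map_mul, kindMk_mul]
      exact (hv _ _).symm
  have hux : ∀ x W, uCoord (ι (kindMk x W)) = u x := hu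
  have hvx : ∀ x W, vCoord (ι (kindMk x W)) = v x := hv
  let η : Matrix (Fin a) (Fin c) K →+ Matrix (Fin a) (Fin c) K :=
    AddMonoidHom.mk' (fun W => wCoord (ι (kindMk 0 W))) fun W W' => by
      have h := wCoord_mul (ι (kindMk 0 W)) (ι (kindMk 0 W'))
      rw [hu0, Matrix.zero_mul, add_zero, ← map_mul, kindMk_mul] at h
      rw [← h]
      simp
  have hη : ∀ W, ι (kindMk 0 W) = heisMk 0 0 (η W) := fun W => by
    rw [← heisMk_eta (ι (kindMk 0 W)), hu0, hv0]
    rfl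
  have hη_inj : Function.Injective η := fun W W' h => by
    have : ι (kindMk 0 W) = ι (kindMk 0 W') := by rw [hη, hη, h]
    exact (kindMk_inj.1 (hι.1 this)).2
  have hinj : ∀ x, u x = 0 → v x = 0 → x = 0 := by
    intro x h1 h2
    obtain ⟨W, hW⟩ := Finite.surjective_of_injective hη_inj (wCoord (ι (kindMk x 0)))
    have : ι (kindMk x 0) = ι (kindMk 0 W) := by
      rw [hη, hW, ← heisMk_eta (ι (kindMk x 0)), hux, hvx, h1, h2]
      rfl
    exact (kindMk_inj.1 (hι.1 this)).1
  have hJ : ∀ V, ∃ x, u x = 0 ∧ v x = V := by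
    intro V
    obtain ⟨g, hg⟩ := hι.2 ((mem_Gamma₂ (heisMk (0 : Matrix (Fin a) (Fin b) K) V
      (0 : Matrix (Fin a) (Fin c) K))).2 rfl)
    obtain ⟨x, W, rfl⟩ := kindMk_surjective g
    exact ⟨x, by rw [← hux x W, hg]; rfl, by rw [← hvx x W, hg]; rfl⟩
  choose J huJ hvJ using hJ
  have heq : ∀ x y, u x = u y → v x = v y → x = y := fun x y h1 h2 =>
    sub_eq_zero.1 (hinj _ (by rw [map_sub, h1, sub_self]) (by rw [map_sub, h2, sub_self]))
  let D : KindData c S :=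
    { u := u
      v := v
      η := η
      J := AddMonoidHom.mk' J fun V V' => heq _ _
        (by rw [map_add, huJ, huJ, huJ, add_zero]) (by rw [map_add, hvJ, hvJ, hvJ])
      η_inj := hη_inj
      comm := fun x y => by
        have h : kindMk x 0 * kindMk y 0 =
            kindMk y 0 * kindMk x 0 * kindMk 0 (x.1.1 * y.2 - y.1.1 * x.2) := by
          rw [kindMk_mul, kindMk_mul, kindMk_mul, kindMk_inj]
          refine ⟨by rw [add_zero, add_comm], ?_⟩
          simp
        have h := congrArg (fun g => wCoord (ι g)) h
        simp only [map_mul, wCoord_mul, hux, hvx, map_zero, Matrix.mul_zero, add_zero] at h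
        have h' : wCoord (ι (kindMk x 0)) + wCoord (ι (kindMk y 0)) + u x * v y =
          wCoord (ι (kindMk y 0)) + wCoord (ι (kindMk x 0)) + u y * v x +
            η (x.1.1 * y.2 - y.1.1 * x.2) := h
        rw [add_comm (wCoord (ι (kindMk y 0))), add_assoc _ (u y * v x)] at h'
        rw [add_left_cancel h', add_sub_cancel_left]
      u_J := huJ
      v_J := hvJ
      eq_J := fun x hx => heq _ _ (hx.trans (huJ _).symm) (hvJ _).symm }
  refine ⟨D, fun x W => ?_⟩
  rw [hux]
  constructor
  · intro hx
    exact ⟨D.v x, (D.eq_J x hx).symm⟩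
  · rintro ⟨V, rfl⟩
    exact D.u_J V

omit hc hS in
/-- An embedding of shear or swap type is conjugate to the inclusion once the relevant
automorphism exists. -/
theorem exists_aut_of_linear {D : KindData c S}
    (hD : ∀ x W, uCoord (ι (kindMk x W)) = 0 ↔ x ∈ Set.range D.J)
    (L : S × Matrix (Fin b) (Fin c) K →+ S × Matrix (Fin b) (Fin c) K)
    (N : Matrix (Fin a) (Fin c) K →+ Matrix (Fin a) (Fin c) K)
    (τ : S × Matrix (Fin b) (Fin c) K → Matrix (Fin a) (Fin c) K)
    (hL : Function.Injective L) (hN : Function.Injective N)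
    (h : ∀ x y, N (x.1.1 * y.2) + τ (x + y) = τ x + τ y + (L x).1.1 * (L y).2)
    (hLJ : ∀ x, x.1 = 0 ↔ L x ∈ Set.range D.J) :
    ∃ α : kind c S ≃* kind c S,
      (((Gamma₂ a b c K).subgroupOf (kind c S)).map α.toMonoidHom).map ι = Gamma₂ a b c K := by
  obtain ⟨α, hα⟩ := exists_mulEquiv_kind L N τ hL hN h
  refine ⟨α, map_Gamma₂_of_uCoord hι α fun g => ?_⟩
  obtain ⟨x, W, rfl⟩ := kindMk_surjective g
  rw [hα, hD, ← hLJ]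
  exact ⟨fun h => Subtype.ext h, fun h => congrArg Subtype.val h⟩

omit hc hS in
-- The automorphism is (U, V, W) ↦ (G V, F U, H(U V - W)); exchanging the factors reverses the sign
-- of commutators.
theorem exists_aut_of_isSwap {D : KindData c S}
    (hD : ∀ x W, uCoord (ι (kindMk x W)) = 0 ↔ x ∈ Set.range D.J) (hswap : D.IsSwap)
    (h : HasSwap c S) :
    ∃ α : kind c S ≃* kind c S,
      (((Gamma₂ a b c K).subgroupOf (kind c S)).map α.toMonoidHom).map ι = Gamma₂ a b c K := by
  obtain ⟨F, G, H, hF, hG, hH, hFGH⟩ := h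
  refine exists_aut_of_linear ι hι hD
    ((G.comp (AddMonoidHom.snd _ _)).prod (F.comp (AddMonoidHom.fst _ _))) (-H)
    (fun x => H (x.1.1 * x.2)) ?_ (neg_injective.comp hH) ?_ ?_
  · intro x y hxy
    exact Prod.ext (hF (congrArg Prod.snd hxy)) (hG (congrArg Prod.fst hxy))
  · intro x y
    change -H (x.1.1 * y.2) + H ((x.1.1 + y.1.1) * (x.2 + y.2)) = _ + (G x.2).1 * F y.1
    rw [← hFGH, ← map_neg, ← map_add, ← map_add, ← map_add, Matrix.add_mul, Matrix.mul_add,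
      Matrix.mul_add]
    congr 1
    abel
  · intro x
    rw [hswap]
    change _ ↔ F x.1 = 0
    rw [map_eq_zero_iff _ hF]

omit [Finite K] hc hS hι in
-- Halving B(x, x) is impossible in characteristic 2. Instead, let C be the strictly upper
-- triangular part of B in an ordered basis; B is alternating and symmetric, so it is C plus its
-- transpose, and τ(x) = C(x, x).
theorem exists_quadratic_of_alternating {E M W : Type*} [Field E] [AddCommGroup M] [AddCommGroup W]
    [Module E M] [Module E W] (B : M →ₗ[E] M →ₗ[E] W) (hB : ∀ x, B x x = 0)
    (hsymm : ∀ x y, B x y = B y x) :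
    ∃ τ : M → W, ∀ x y, τ (x + y) = τ x + τ y + B x y := by
  classical
  let e := Basis.ofVectorSpace E M
  let _ : LinearOrder (Basis.ofVectorSpaceIndex E M) := linearOrderOfSTO WellOrderingRel
  let C : M →ₗ[E] M →ₗ[E] W :=
    e.constr E fun i => e.constr E fun k => if i < k then B (e i) (e k) else 0
  have hCe : ∀ i k, C (e i) (e k) = if i < k then B (e i) (e k) else 0 := fun i k => by
    simp only [C, Basis.constr_basis]
  have hC : C + C.flip = B := by
    refine e.ext fun i => e.ext fun k => ?_
    rw [LinearMap.add_apply, LinearMap.add_apply, LinearMap.flip_apply, hCe, hCe]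
    rcases lt_trichotomy i k with h | h | h
    · rw [if_pos h, if_neg h.not_gt, add_zero]
    · subst h
      rw [if_neg (lt_irrefl _), add_zero, hB]
    · rw [if_neg h.not_gt, if_pos h, zero_add, hsymm]
  refine ⟨fun x => C x x, fun x y => ?_⟩
  have h : B x y = C x y + C y x := by
    rw [← hC, LinearMap.add_apply, LinearMap.add_apply, LinearMap.flip_apply]
  simp only [h, map_add, LinearMap.add_apply]
  abel

omit hc hS in
-- The shear multiplies correctly once the symmetric form β(V) V' is the polarization of some τ(V),
-- which corrects the block `W`. If 2 is invertible, τ(V) = β(V) V / 2 works.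
theorem exists_aut_of_isShear {p : ℕ} [Fact p.Prime] [Algebra (ZMod p) K] {D : KindData c S}
    (hD : ∀ x W, uCoord (ι (kindMk x W)) = 0 ↔ x ∈ Set.range D.J) (hshear : D.IsShear) :
    ∃ α : kind c S ≃* kind c S,
      (((Gamma₂ a b c K).subgroupOf (kind c S)).map α.toMonoidHom).map ι = Gamma₂ a b c K := by
  obtain ⟨β, hsymm, hβ⟩ := hshear
  have hτ : ∃ τ : Matrix (Fin b) (Fin c) K → Matrix (Fin a) (Fin c) K,
      ∀ V V', τ (V + V') = τ V + τ V' + (β V).1 * V' := by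
    by_cases h2 : (2 : K) = 0
    · have hdouble : ∀ {m n : ℕ} (A : Matrix (Fin m) (Fin n) K), A + A = 0 := fun A => by
        rw [← two_smul K, h2, zero_smul]
      -- In characteristic 2 every element of Γ₂ squares to 1. The element (β V, V, 0) is mapped
      -- into Γ₂, and β(V) V is the block `W` of its square.
      have halt : ∀ V, (β V).1 * V = 0 := by
        intro V
        let x : S × Matrix (Fin b) (Fin c) K := (β V, V)
        have hu : uCoord (ι (kindMk x 0)) = 0 := (hD x 0).2 ((hβ x).2 rfl)
        have hsq : ι (kindMk x 0 * kindMk x 0) = ι 1 := by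
          rw [map_mul, map_one, ← heisMk_eta (ι (kindMk x 0)), heisMk_mul, hu, hdouble, hdouble,
            hdouble, Matrix.zero_mul, add_zero, heisMk_zero]
        have h1 : kindMk x 0 * kindMk x 0 = kindMk 0 0 :=
          (hι.1 hsq).trans (Subtype.ext heisMk_zero.symm)
        rw [kindMk_mul, kindMk_inj] at h1
        simpa [x] using h1.2
      let B : Matrix (Fin b) (Fin c) K →ₗ[ZMod p] Matrix (Fin b) (Fin c) K →ₗ[ZMod p]
          Matrix (Fin a) (Fin c) K :=
        LinearMap.mk₂ (ZMod p) (fun V V' => (β V).1 * V')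
          (fun V₁ V₂ V' => by rw [map_add]; exact Matrix.add_mul _ _ _)
          (fun t V V' => by
            have h := ZMod.map_smul (S.subtype.comp β) t V
            have h : (β (t • V)).1 = t • (β V).1 := h
            rw [h, Matrix.smul_mul])
          (fun V V₁ V₂ => Matrix.mul_add _ _ _)
          (fun t V V' => Matrix.mul_smul _ _ _)
      exact exists_quadratic_of_alternating B halt hsymm
    · refine ⟨fun V => (2 : K)⁻¹ • ((β V).1 * V), fun V V' => ?_⟩
      have h1 : (β (V + V')).1 * (V + V') =
          (β V).1 * V + (β V').1 * V' + (2 : K) • ((β V).1 * V') := by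
        rw [map_add]
        change ((β V).1 + (β V').1) * (V + V') = _
        rw [Matrix.add_mul, Matrix.mul_add, Matrix.mul_add, hsymm V' V, two_smul]
        abel
      beta_reduce
      rw [h1, smul_add, smul_add, smul_smul, inv_mul_cancel₀ h2, one_smul]
  obtain ⟨τ, hτ⟩ := hτ
  refine exists_aut_of_linear ι hι hD
    ((AddMonoidHom.fst _ _ + β.comp (AddMonoidHom.snd _ _)).prod (AddMonoidHom.snd _ _))
    (AddMonoidHom.id _) (fun x => τ x.2) ?_ Function.injective_id ?_ ?_
  · rintro ⟨U, V⟩ ⟨U', V'⟩ h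
    have h1 : U + β V = U' + β V' := congrArg Prod.fst h
    have h2 : V = V' := congrArg Prod.snd h
    subst h2
    rw [add_right_cancel h1]
  · intro x y
    change x.1.1 * y.2 + τ (x.2 + y.2) = τ x.2 + τ y.2 + (x.1.1 + (β x.2).1) * y.2
    rw [hτ, Matrix.add_mul]
    abel
  · intro x
    rw [hβ]
    change _ ↔ x.1 + β x.2 = β x.2
    rw [add_eq_right]

end Embedding

end HeisNursery

/-! ### Numerical inequalities -/

namespace HeisNursery
open Matrix Module

section Numerics

/-- `ℓ` is close to `a b e / 2`. -/
def NearHalf (ℓ n : ℕ) : Prop :=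
  (2 * ℓ ≤ n + 1 ∧ n ≤ 2 * ℓ + 1) ∨ (100 * ℓ ≤ 51 * n ∧ 49 * n ≤ 100 * ℓ)

theorem nearHalf_of_abs_le {ℓ n : ℕ} (h : |(ℓ : ℝ) - (n : ℝ) / 2| ≤ max (1 / 2) (1 / 100 * (n : ℝ))) :
    NearHalf ℓ n := by
  rcases le_max_iff.1 h with h | h <;> obtain ⟨h1, h2⟩ := abs_le.1 h
  · left
    constructor
    · have : (2 * ℓ : ℝ) ≤ n + 1 := by linarith
      exact_mod_cast this
    · have : (n : ℝ) ≤ 2 * ℓ + 1 := by linarith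
      exact_mod_cast this
  · right
    constructor
    · have : (100 * ℓ : ℝ) ≤ 51 * n := by linarith
      exact_mod_cast this
    · have : (49 * n : ℝ) ≤ 100 * ℓ := by linarith
      exact_mod_cast this

variable {a b c e ℓ : ℕ}

theorem NearHalf.lt {n : ℕ} (h : NearHalf ℓ n) (hn : 2 ≤ n) : ℓ < n := by
  rcases h with h | h <;> omega

theorem NearHalf.le_mul (h : NearHalf ℓ (a * b * e)) (ha : 0 < a) (hae : 3 ≤ a * e) :
    b ≤ a * ℓ := by
  have h1 : 3 * b ≤ a * b * e := by nlinarith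
  have h2 : b ≤ ℓ := by rcases h with h | h <;> omega
  nlinarith

theorem NearHalf.add_mul_le (h : NearHalf ℓ (1 * b * e)) (hb : 0 < b) (he : 3 ≤ e) :
    ℓ + 1 * b ≤ 1 * b * e := by
  have h1 : 3 * b ≤ 1 * b * e := by nlinarith
  rcases h with h | h <;> omega

theorem NearHalf.mul_le (h : NearHalf ℓ (a * b * e)) (ha : 2 ≤ a) (hb : 0 < b)
    (hbe : 3 ≤ b * b * e) : a ≤ b * ℓ := by
  have h0 : a * 3 ≤ b * (a * b * e) := by
    calc a * 3 ≤ a * (b * b * e) := Nat.mul_le_mul_left _ hbe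
      _ = _ := by ring
  have h0' : 2 * a + b ≤ b * (a * b * e) := by
    rcases Nat.lt_or_ge b 2 with h1 | h1
    · have : b = 1 := by omega
      subst this
      omega
    · have he : 1 ≤ e := Nat.pos_of_ne_zero (by rintro rfl; simp at hbe)
      have h2 : 2 * a + b ≤ b * (a * b) := by
        have h3 : 2 * b ≤ a * b := Nat.mul_le_mul_right _ ha
        have h4 : a * 2 ≤ a * b := Nat.mul_le_mul_left _ h1
        have h5 : 2 * (a * b) ≤ b * (a * b) := Nat.mul_le_mul_right _ h1
        omega
      calc _ ≤ b * (a * b) := h2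
        _ ≤ b * (a * b) * e := Nat.le_mul_of_pos_right _ he
        _ = _ := by ring
  rcases h with h | h
  · have : b * (a * b * e) ≤ b * (2 * ℓ + 1) := Nat.mul_le_mul_left _ h.2
    nlinarith
  · have : b * (49 * (a * b * e)) ≤ b * (100 * ℓ) := Nat.mul_le_mul_left _ h.2
    nlinarith

/-- At the excluded parameters the inequality would read 8 ≤ 6. -/
theorem NearHalf.noGamma (h : NearHalf ℓ (a * b * e)) (ha : 2 ≤ a) (hb : 0 < b)
    (hae : 3 ≤ a * e) (hex : ¬(a = 3 ∧ b = 1 ∧ e = 1 ∧ ℓ = 1)) :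
    a * (b + 1) + 2 * ℓ ≤ 2 * a * ℓ := by
  have he : 1 ≤ e := Nat.pos_of_ne_zero (by rintro rfl; simp at hae)
  rcases Nat.lt_or_ge a 4 with h4 | h4
  · interval_cases a
    · have he2 : 2 ≤ e := by omega
      have h1 : b * 2 ≤ b * e := Nat.mul_le_mul_left _ he2
      have h2 : b + 1 ≤ ℓ := by
        have h3 : 2 * b * e = 2 * (b * e) := by ring
        rw [NearHalf, h3] at h
        rcases h with h | h <;> omega
      omega
    · have h1 : b * 1 ≤ b * e := Nat.mul_le_mul_left _ he
      have h3 : 3 * b * e = 3 * (b * e) := by ring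
      rw [NearHalf, h3] at h
      by_cases hb1 : b = 1 ∧ e = 1
      · obtain ⟨rfl, rfl⟩ := hb1
        simp at hex
        rcases h with h | h <;> omega
      · have h2 : 2 ≤ b * e := by
          by_contra h2
          exact hb1 (mul_eq_one.1 (by omega))
        rcases h with h | h <;> omega
  · have h1 : a * b ≤ a * b * e := Nat.le_mul_of_pos_right _ he
    have h2 : 4 * b ≤ a * b := Nat.mul_le_mul_right _ h4
    have h3 : a * 1 ≤ a * b := Nat.mul_le_mul_left _ hb
    have h4 : a * b + a + 2 * ℓ ≤ 2 * a * ℓ := by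
      rcases h with h | h
      · have h5 : a * b ≤ 2 * ℓ + 1 := h1.trans h.2
        have h6 : a * (2 * ℓ) = 2 * a * ℓ := by ring
        nlinarith
      · nlinarith
    nlinarith

/-- Whichever of X, Y belongs to the larger of r, s is at most 1/25 of its range by `h`; the other
is bounded trivially. -/
theorem mul_le_of_add_le {N r s X Y : ℤ} (hN : 0 ≤ N) (hr : 0 ≤ r) (hs : 0 ≤ s) (hX : 0 < X)
    (hY : 0 < Y) (h : 50 * (X + Y) ≤ N * (r + s)) (hXr : X ≤ N * r) (hYs : Y ≤ N * s) :
    25 * (X * Y) ≤ N * N * (r * s) := by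
  have hNr : 0 ≤ N * r := mul_nonneg hN hr
  have hNs : 0 ≤ N * s := mul_nonneg hN hs
  rw [mul_add] at h
  rcases le_total r s with hle | hle
  · have h1 : N * r ≤ N * s := mul_le_mul_of_nonneg_left hle hN
    calc 25 * (X * Y) = X * (25 * Y) := by ring
      _ ≤ (N * r) * (N * s) := mul_le_mul hXr (by linarith) (by linarith) hNr
      _ = _ := by ring
  · have h1 : N * s ≤ N * r := mul_le_mul_of_nonneg_left hle hN
    calc 25 * (X * Y) = (25 * X) * Y := by ring
      _ ≤ (N * r) * (N * s) := mul_le_mul (by linarith) hYs hY.le hNr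
      _ = _ := by ring

/-- The margin is thin: for N = 3, e = f = 1 it is 200 against 216. This is where N ≥ 3, that is ae
> 2, enters. -/
theorem add_le_of_two_mul_le {N e f : ℤ} (hN : 3 ≤ N) (he : 1 ≤ e) (h : 2 * e ≤ N)
    (hf2 : 2 * f ≤ e + 1) : 25 * (4 * e + 2 * e + 2 * f) ≤ 24 * (N * N) := by
  have h1 : N * (2 * e) ≤ N * N := mul_le_mul_of_nonneg_left h (by linarith)
  rcases lt_or_ge e 3 with h3 | h3
  · have h2 : e = 1 ∨ e = 2 := by omega
    rcases h2 with rfl | rfl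
    · nlinarith
    · have : f ≤ 1 := by omega
      nlinarith
  · have h4 : 2 * e * (2 * e) ≤ N * (2 * e) := mul_le_mul_of_nonneg_right h (by linarith)
    nlinarith

/-- Put N = ae, s = b - r, u = ℓ - t, X = 2t - Nr, Y = 2u - Ns and f = (e+1)/2. The claim becomes XY
+ 4e rs + 2e + 2f ≤ N² rs. Since X + Y = 2ℓ - abe is small, XY is at most 1/25 of the right side;
the other terms fit into the remaining 24/25. -/
theorem NearHalf.noIdem (h : NearHalf ℓ (a * b * e)) (ha : 2 ≤ a) (hae : 3 ≤ a * e) (r t : ℕ)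
    (hr : 1 ≤ r) (hrb : r < b) (htℓ : t ≤ ℓ) (ht : t ≤ a * r * e)
    (hu : ℓ ≤ t + a * (b - r) * e) :
    2 * r * b * e + 2 * t * ℓ + a * r * t * e + a * b * (ℓ - t) * e + e + (e + 1) / 2 ≤
      2 * r * r * e + 2 * t * t + a * r * (ℓ - t) * e + a * b * ℓ * e := by
  obtain ⟨u, rfl⟩ := Nat.exists_eq_add_of_le htℓ
  obtain ⟨s, rfl, hs⟩ : ∃ s, b = r + s ∧ 1 ≤ s := ⟨b - r, by omega, by omega⟩
  rw [Nat.add_sub_cancel_left] at *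
  have hu : u ≤ a * s * e := by omega
  have he : 1 ≤ e := Nat.pos_of_ne_zero (by rintro rfl; simp at hae)
  obtain ⟨N, hN⟩ : ∃ N : ℤ, N = a * e := ⟨_, rfl⟩
  obtain ⟨X, hX⟩ : ∃ X : ℤ, X = 2 * t - N * r := ⟨_, rfl⟩
  obtain ⟨Y, hY⟩ : ∃ Y : ℤ, Y = 2 * u - N * s := ⟨_, rfl⟩
  obtain ⟨f, hf⟩ : ∃ f : ℕ, f = (e + 1) / 2 := ⟨_, rfl⟩
  have hN3 : 3 ≤ N := by rw [hN]; exact_mod_cast hae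
  have hrs : (1 : ℤ) ≤ r * s := by exact_mod_cast Nat.mul_pos hr hs
  have hXr : X ≤ N * r ∧ -(N * r) ≤ X := by
    have h1 : (t : ℤ) ≤ N * r := by
      have : (t : ℤ) ≤ a * r * e := by exact_mod_cast ht
      rw [hN]; linarith
    constructor <;> linarith [Int.natCast_nonneg t]
  have hYs : Y ≤ N * s ∧ -(N * s) ≤ Y := by
    have h1 : (u : ℤ) ≤ N * s := by
      have : (u : ℤ) ≤ a * s * e := by exact_mod_cast hu
      rw [hN]; linarith
    constructor <;> linarith [Int.natCast_nonneg u]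
  have hn : ((a * (r + s) * e : ℕ) : ℤ) = N * (r + s) := by rw [hN]; push_cast; ring
  have hXY : X + Y = 2 * ((t + u : ℕ) : ℤ) - ((a * (r + s) * e : ℕ) : ℤ) := by
    rw [hX, hY, hn]; push_cast; ring
  have hNrs : 0 ≤ N * N * (r * s) := by positivity
  have hcases : 25 * (X * Y) ≤ N * N * (r * s) := by
    by_cases hpos : 0 < X * Y
    · have h0 := pos_and_pos_or_neg_and_neg_of_mul_pos hpos
      rcases h with h | h
      · have h1 : X + Y ≤ 1 ∧ -1 ≤ X + Y := by rw [hXY]; omega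
        rcases h0 with h2 | h2 <;> omega
      · have h1 : 50 * (X + Y) ≤ N * (r + s) ∧ -(N * (r + s)) ≤ 50 * (X + Y) := by
          rw [hXY, ← hn]
          omega
        rcases h0 with h2 | h2
        · exact mul_le_of_add_le (by linarith) (by positivity) (by positivity) h2.1 h2.2 h1.1
            hXr.1 hYs.1
        · rw [← neg_mul_neg X Y]
          exact mul_le_of_add_le (by linarith) (by positivity) (by positivity) (by linarith)
            (by linarith) (by linarith) (by linarith) (by linarith)
    · linarith
  have hlarge : 25 * (4 * (e : ℤ) + 2 * e + 2 * f) * (r * s) ≤ 24 * (N * N) * (r * s) := by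
    refine mul_le_mul_of_nonneg_right (add_le_of_two_mul_le hN3 (by exact_mod_cast he) ?_ ?_)
      (by linarith)
    · rw [hN]
      exact_mod_cast Nat.mul_le_mul_right e ha
    · omega
  have hef : (2 * (e : ℤ) + 2 * f) * 1 ≤ (2 * e + 2 * f) * (r * s) :=
    mul_le_mul_of_nonneg_left hrs (by positivity)
  have hXYv : X * Y = 4 * t * u - 2 * N * (t * s + r * u) + N * N * (r * s) := by
    rw [hX, hY]; ring
  have hfin : 2 * (e : ℤ) * (r * s) + 2 * t * u + e + f ≤ N * (t * s + r * u) := by linarith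
  rw [← hf]
  zify
  rw [hN] at hfin
  linarith

/-- With m = bce ≥ 2, near-halfness compares m with mr/2, and only r = 2 fits. -/
theorem NearHalf.eq_two {r : ℕ} (h : NearHalf (b * c * e) (a * b * e)) (ha : a = c * r)
    (hm : 2 ≤ b * c * e) : a = 2 * c := by
  have h1 : a * b * e = (b * c * e) * r := by rw [ha]; ring
  rw [NearHalf, h1] at h
  generalize b * c * e = m at *
  have : r = 2 := by
    by_contra hr
    rcases Nat.lt_or_gt_of_ne hr with hr | hr
    · have : m * r ≤ m * 1 := Nat.mul_le_mul_left _ (by omega)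
      rcases h with h | h <;> omega
    · have : m * 3 ≤ m * r := Nat.mul_le_mul_left _ hr
      rcases h with h | h <;> omega
  rw [ha, this, mul_comm]

theorem nilpotents_numerics (hc : 2 ≤ c) (hb : 4 ≤ b * b * e) :
    4 * (2 * c) * e + 2 * (b * e) * (b * c * e) + 2 * c * b * (b * c * e - b * e) * e ≤
      8 * e + 2 * (b * e) * (b * e) + 2 * b * (b * c * e - 2 * (b * e)) * e +
        2 * c * b * (b * c * e) * e := by
  obtain ⟨d, rfl⟩ := Nat.exists_eq_add_of_le hc
  have h1 : b * (2 + d) * e - b * e = b * e * (1 + d) := by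
    rw [Nat.sub_eq_iff_eq_add (by nlinarith)]; ring
  have h2 : b * (2 + d) * e - 2 * (b * e) = b * e * d := by
    rw [Nat.sub_eq_iff_eq_add (by nlinarith)]; ring
  rw [h1, h2]
  have h3 : 4 * (2 * e * (1 + d)) ≤ b * b * e * (2 * e * (1 + d)) := Nat.mul_le_mul_right _ hb
  nlinarith

end Numerics

end HeisNursery

/-! ### Assembling the exceptional sets -/

namespace HeisNursery
open Matrix Module

section Rare

variable {a b : ℕ} {K : Type*} [Field K]

/-- The property `A` holds with probability at most `C / |K|` for a random `S` of order `m`. -/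
def Rare (m C : ℕ) (A : AddSubgroup (Matrix (Fin a) (Fin b) K) → Prop) : Prop :=
  {S | S ∈ Gr a b K m ∧ A S}.ncard * Nat.card K ≤ C * (Gr a b K m).ncard

variable [Finite K] {m C C' : ℕ} {A B : AddSubgroup (Matrix (Fin a) (Fin b) K) → Prop}

theorem finite_Gr : (Gr a b K m).Finite :=
  have : Finite (AddSubgroup (Matrix (Fin a) (Fin b) K)) :=
    Finite.of_injective (fun S => (S : Set (Matrix (Fin a) (Fin b) K))) SetLike.coe_injective
  Set.toFinite _

theorem Rare.mono (h : Rare m C B) (hAB : ∀ S ∈ Gr a b K m, A S → B S) : Rare m C A :=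
  (Nat.mul_le_mul_right _ (Set.ncard_le_ncard
    (show {S | S ∈ Gr a b K m ∧ A S} ⊆ {S | S ∈ Gr a b K m ∧ B S} from
      fun S hS => ⟨hS.1, hAB S hS.1 hS.2⟩)
    (finite_Gr.subset fun _ hS => hS.1))).trans h

theorem Rare.or (hA : Rare m C A) (hB : Rare m C' B) : Rare m (C + C') fun S => A S ∨ B S := by
  rw [Rare, add_mul]
  refine le_trans ?_ (add_le_add hA hB)
  rw [← add_mul]
  refine Nat.mul_le_mul_right _ ?_
  refine le_trans (Set.ncard_le_ncard ?_ ?_) (Set.ncard_union_le _ _)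
  · rintro S ⟨hS, h | h⟩
    · exact Or.inl ⟨hS, h⟩
    · exact Or.inr ⟨hS, h⟩
  · exact (finite_Gr.subset fun _ hS => hS.1).union (finite_Gr.subset fun _ hS => hS.1)

omit [Finite K] in
theorem Rare.const_mono (h : Rare m C A) (hC : C ≤ C') : Rare m C' A :=
  le_trans h (Nat.mul_le_mul_right _ hC)

end Rare

section Main

variable {p e ℓ a b c : ℕ} [Fact p.Prime] {K : Type*} [Field K] [Finite K] [Algebra (ZMod p) K]

theorem embeddingsConjugate_kind (p : ℕ) [Fact p.Prime] [Algebra (ZMod p) K] (hc : 0 < c)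
    {S : AddSubgroup (Matrix (Fin a) (Fin b) K)} (hS : KerTrivial S)
    (h : ∀ D : KindData c S, D.IsShear ∨ D.IsSwap ∧ HasSwap c S) :
    EmbeddingsConjugate (kind c S) := by
  intro ι hι
  obtain ⟨D, hD⟩ := exists_kindData hc hS ι hι
  rcases h D with h | ⟨h, h'⟩
  · exact exists_aut_of_isShear (p := p) ι hι hD h
  · exact exists_aut_of_isSwap ι hι hD h h'

omit [Finite K] [Algebra (ZMod p) K] in
theorem card_eq_of_addEquiv {S : AddSubgroup (Matrix (Fin a) (Fin b) K)} (hK : Nat.card K = p ^ e)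
    (hS : Nat.card S = p ^ ℓ) (j : Matrix (Fin b) (Fin c) K ≃+ S) : ℓ = b * c * e := by
  have h := Nat.card_congr j.toEquiv
  rw [natCard_matrix, hK, hS, ← pow_mul] at h
  rw [← Nat.pow_right_injective (Fact.out : p.Prime).two_le h, mul_comm]

variable (hK : Nat.card K = p ^ e)
include hK

theorem rare_of_one (hb : 0 < b) (hc : 0 < c) (he : 3 ≤ e) (h : NearHalf ℓ (1 * b * e)) :
    Rare (p ^ ℓ) 8 fun S : AddSubgroup (Matrix (Fin 1) (Fin b) K) =>
      ¬EmbeddingsConjugate (kind c S) := by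
  have hn : 2 ≤ 1 * b * e := by nlinarith
  have h1 : Rare (p ^ ℓ) 4 fun S : AddSubgroup (Matrix (Fin 1) (Fin b) K) => ¬KerTrivial S :=
    ncard_not_kerTrivial_mul_le hK (h.lt hn) (h.le_mul one_pos (by omega))
  have h2 : Rare (p ^ ℓ) 4 fun S : AddSubgroup (Matrix (Fin 1) (Fin b) K) => ¬NoLine S :=
    ncard_not_noLine_mul_le hK (h.add_mul_le hb he) (by omega)
  refine (h1.or h2).mono fun S hS hbad => ?_
  by_contra hgood
  push Not at hgood
  exact hbad (embeddingsConjugate_kind p hc hgood.1 fun D => Or.inl (D.isShear_of_noLine hc hgood.2))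

/-- These parameters escape the count for `NoGamma`. For c > 1 the group `S` is too small for
anything but a shear; for c = 1 everything is linear over the prime field. -/
theorem rare_of_three (hc : 0 < c) (he : e = 1) :
    Rare (p ^ 1) 8 fun S : AddSubgroup (Matrix (Fin 3) (Fin 1) K) =>
      ¬EmbeddingsConjugate (kind c S) := by
  have h1 : Rare (p ^ 1) 4 fun S : AddSubgroup (Matrix (Fin 3) (Fin 1) K) => ¬KerTrivial S :=
    ncard_not_kerTrivial_mul_le hK (by omega) (by omega)
  have h2 : Rare (p ^ 1) 4 fun S : AddSubgroup (Matrix (Fin 3) (Fin 1) K) => ¬HasIndepBasis p 1 S :=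
    ncard_not_hasIndepBasis_mul_le hK (by omega) (by omega)
  subst he
  refine (h1.or h2).mono fun S hS hbad => ?_
  by_contra hgood
  push Not at hgood
  refine hbad (embeddingsConjugate_kind p hc hgood.1 fun D => ?_)
  have hS : Nat.card S = p ^ 1 := hS
  rcases Nat.lt_or_ge 1 c with hc1 | hc1
  · left
    refine D.isShear_of_card_lt ?_
    rw [hS, hK, ← pow_mul]
    exact Nat.pow_lt_pow_right (Fact.out : p.Prime).one_lt (by omega)
  · obtain rfl : c = 1 := by omega
    rw [pow_one] at hS hK
    refine (D.isShear_or_isSwap_of_prime_field hK hS).imp_right fun h => ⟨h, ?_⟩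
    obtain ⟨j, -, -⟩ := h.exists_addEquiv
    exact hasSwap_of_hasIndepBasis j hgood.2

theorem rare_hasFieldStructure (ha : a = 2) (hℓ : ℓ = b * e) (hb : 0 < b) (he : 2 ≤ e)
    (hbe : 4 ≤ b * b * e) : Rare (p ^ ℓ) 256
      fun S : AddSubgroup (Matrix (Fin a) (Fin b) K) => SpanTop S ∧ HasFieldStructure S := by
  subst ha hℓ
  exact ncard_hasFieldStructure_mul_le hK hb he hbe

theorem rare_not_hasSwap (ha : 2 ≤ a) (hb : 0 < b) (hc : 0 < c) (hae : 3 ≤ a * e)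
    (h : NearHalf ℓ (a * b * e)) :
    Rare (p ^ ℓ) 324 fun S : AddSubgroup (Matrix (Fin a) (Fin b) K) =>
      ∃ D : KindData c S, D.IsSwap ∧ ¬HasSwap c S := by
  have he : 1 ≤ e := Nat.pos_of_ne_zero (by rintro rfl; simp at hae)
  have hn : 2 ≤ a * b * e := by nlinarith
  -- Here a ≤ bℓ may fail, so `SpanTop` is not available; instead ℓ ≤ a makes a K-independent basis
  -- generic.
  by_cases hsmall : b = 1 ∧ (e = 1 ∨ e = 2 ∧ ℓ ≤ a)
  · obtain ⟨rfl, hsmall⟩ := hsmall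
    have hℓa : ℓ ≤ a * 1 := by
      rcases hsmall with rfl | ⟨-, h'⟩
      · have := h.lt hn
        omega
      · omega
    have h1 : Rare (p ^ ℓ) 4 fun S : AddSubgroup (Matrix (Fin a) (Fin 1) K) =>
        ¬HasIndepBasis p ℓ S := ncard_not_hasIndepBasis_mul_le hK (h.lt hn) hℓa
    refine (h1.mono ?_).const_mono (by omega)
    rintro S hS ⟨D, hD, hno⟩ hind
    obtain ⟨j, -, -⟩ := hD.exists_addEquiv
    exact hno (hasSwap_of_hasIndepBasis j hind)
  · have habℓ : a ≤ b * ℓ := by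
      by_cases hbe : 3 ≤ b * b * e
      · exact h.mul_le ha hb hbe
      · have hb1 : b = 1 := by nlinarith
        subst hb1
        have : ¬(e = 1 ∨ e = 2 ∧ ℓ ≤ a) := fun h => hsmall ⟨rfl, h⟩
        omega
    have hbe : 2 ≤ b * e := by
      by_contra hbe
      have h2 : b * e = 1 := by nlinarith
      have := mul_eq_one.1 h2
      exact hsmall ⟨this.1, Or.inl this.2⟩
    have h1 : Rare (p ^ ℓ) 4 fun S : AddSubgroup (Matrix (Fin a) (Fin b) K) => ¬SpanTop S :=
      ncard_not_spanTop_mul_le hK (h.lt hn) habℓ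
    have key : ∀ S ∈ Gr a b K (p ^ ℓ), SpanTop S → (∃ D : KindData c S, D.IsSwap) →
        ℓ = b * c * e ∧ a = 2 * c ∧ ∃ (j : Matrix (Fin b) (Fin c) K ≃+ S)
          (Z : Matrix (Fin c) (Fin c) K → Matrix (Fin a) (Fin a) K),
          ∀ h V, Z h * (j V).1 = (j (V * h)).1 := by
      rintro S hS hspan ⟨D, hD⟩
      obtain ⟨j, μ, hj⟩ := hD.exists_addEquiv
      obtain ⟨Z, hZ⟩ := exists_antihom hc hspan j μ D.η D.η_inj hj
      obtain rfl := card_eq_of_addEquiv hK hS j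
      refine ⟨rfl, h.eq_two (antihom_rank hspan j Z hZ ⟨0, hc⟩) ?_, j, Z, hZ⟩
      nlinarith
    rcases Nat.lt_or_ge b 2 with hb2 | hb2
    · obtain rfl : b = 1 := by omega
      refine (h1.mono ?_).const_mono (by omega)
      rintro S hS ⟨D, hD, hno⟩ hspan
      obtain ⟨-, ha2, j, Z, hZ⟩ := key S hS hspan ⟨D, hD⟩
      exact hno (hasSwap_of_two_mul (p := p) hspan j Z hZ hc ha2)
    · have hbbe : 4 ≤ b * b * e := by nlinarith
      -- For all other parameters, `SpanTop` already excludes swaps.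
      by_cases hpar : ℓ = b * c * e ∧ a = 2 * c
      · rcases Nat.lt_or_ge c 2 with hc2 | hc2
        · obtain rfl : c = 1 := by omega
          have h2 := rare_hasFieldStructure hK hpar.2 (hpar.1.trans (by rw [mul_one])) hb
            (by rw [hpar.2] at hae; omega) hbbe
          refine ((h1.or h2).mono ?_).const_mono (by omega)
          rintro S hS ⟨D, hD, hno⟩
          by_cases hspan : SpanTop S
          · obtain ⟨-, -, j, Z, hZ⟩ := key S hS hspan ⟨D, hD⟩
            exact Or.inr ⟨hspan, hasFieldStructure_of_antihom j Z hZ rfl⟩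
          · exact Or.inl hspan
        · obtain ⟨rfl, rfl⟩ := hpar
          have h2 : Rare (p ^ (b * c * e)) 64
              fun S : AddSubgroup (Matrix (Fin (2 * c)) (Fin b) K) =>
                HasNilpotents (p ^ (b * c * e)) (p ^ (b * e)) S :=
            ncard_hasNilpotents_mul_le hK (h.lt hn) (b * e) (by nlinarith)
              (nilpotents_numerics hc2 hbbe)
          refine ((h1.or h2).mono ?_).const_mono (by omega)
          rintro S hS ⟨D, hD, hno⟩
          by_cases hspan : SpanTop S
          · obtain ⟨-, -, j, Z, hZ⟩ := key S hS hspan ⟨D, hD⟩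
            exact Or.inr (hasNilpotents_of_antihom hspan j Z hZ hK rfl hc2)
          · exact Or.inl hspan
      · refine (h1.mono ?_).const_mono (by omega)
        rintro S hS ⟨D, hD, hno⟩ hspan
        have := key S hS hspan ⟨D, hD⟩
        exact hpar ⟨this.1, this.2.1⟩

theorem rare_of_two_le (ha : 2 ≤ a) (hb : 0 < b) (hc : 0 < c) (hae : 3 ≤ a * e)
    (h : NearHalf ℓ (a * b * e)) (hex : ¬(a = 3 ∧ b = 1 ∧ e = 1 ∧ ℓ = 1)) :
    Rare (p ^ ℓ) (4 + 16 * b + 64 * (a * b * b) + 324)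
      fun S : AddSubgroup (Matrix (Fin a) (Fin b) K) => ¬EmbeddingsConjugate (kind c S) := by
  have hn : 2 ≤ a * b * e := by nlinarith
  have h1 : Rare (p ^ ℓ) 4 fun S : AddSubgroup (Matrix (Fin a) (Fin b) K) => ¬KerTrivial S :=
    ncard_not_kerTrivial_mul_le hK (h.lt hn) (h.le_mul (by omega) hae)
  have h2 : Rare (p ^ ℓ) (16 * b) fun S : AddSubgroup (Matrix (Fin a) (Fin b) K) => ¬NoGamma S :=
    ncard_not_noGamma_mul_le hK (h.lt hn) ha (h.noGamma ha hb hae hex)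
  have h3 : Rare (p ^ ℓ) (64 * (a * b * b)) fun S : AddSubgroup (Matrix (Fin a) (Fin b) K) =>
      ¬NoIdem S := ncard_not_noIdem_mul_le hK (h.lt hn) (h.noIdem ha hae)
  refine (((h1.or h2).or h3).or (rare_not_hasSwap (c := c) hK ha hb hc hae h)).mono
    fun S hS hbad => ?_
  by_contra hgood
  push Not at hgood
  obtain ⟨⟨⟨hker, hγ⟩, hid⟩, hsw⟩ := hgood
  exact hbad (embeddingsConjugate_kind p hc hker fun D =>
    (D.isShear_or_isSwap hc hker hγ hid).imp_right fun h => ⟨h, hsw D h⟩)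

theorem rare_not_embeddingsConjugate (ha : 0 < a) (hb : 0 < b) (hc : 0 < c) (hae : 3 ≤ a * e)
    (h : NearHalf ℓ (a * b * e)) :
    Rare (p ^ ℓ) (4 + 16 * b + 64 * (a * b * b) + 324)
      fun S : AddSubgroup (Matrix (Fin a) (Fin b) K) => ¬EmbeddingsConjugate (kind c S) := by
  rcases Nat.lt_or_ge a 2 with ha2 | ha2
  · obtain rfl : a = 1 := by omega
    exact (rare_of_one hK hb hc (by omega) h).const_mono (by omega)
  · by_cases hex : a = 3 ∧ b = 1 ∧ e = 1 ∧ ℓ = 1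
    · obtain ⟨rfl, rfl, he, rfl⟩ := hex
      exact (rare_of_three hK hc he).const_mono (by omega)
    · exact rare_of_two_le hK ha2 hb hc hae h hex

end Main

end HeisNursery

theorem mainTheorem11 :
    ∃ δ : ℝ, 0 < δ ∧ ∀ a b c : ℕ, ∃ C : ℝ,
      ∀ (p e ℓ : ℕ) (K : Type*) [Field K] [Finite K], p.Prime → Nat.card K = p ^ e →
        1 < a * b * c * e → 2 < a * e →
        |(ℓ : ℝ) - (a * b * e : ℝ) / 2| ≤ max (1 / 2) (δ * (a * b * e : ℝ)) →
        (1 - C / (Nat.card K : ℝ)) * ((HeisNursery.kinder a b c K (p ^ ℓ)).ncard : ℝ) ≤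
          (({Q ∈ HeisNursery.kinder a b c K (p ^ ℓ) |
            HeisNursery.EmbeddingsConjugate Q ∧ HeisNursery.SingleOrbit Q}).ncard : ℝ) := by
  -- With δ = 1/100 the deviation |2ℓ - abe| is at most abe/50 outside the rounding case, as needed
  -- for the factor 1/25 in `mul_le_of_add_le`.
  refine ⟨1 / 100, by norm_num, fun a b c =>
    ⟨((4 + 16 * b + 64 * (a * b * b) + 324 : ℕ) : ℝ), ?_⟩⟩
  intro p e ℓ K _ _ hp hK habce hae hℓ
  have := Fact.mk hp
  have hchar : CharP K p := by
    have := Fintype.ofFinite K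
    exact charP_of_card_eq_prime_pow (by rw [← Nat.card_eq_fintype_card, hK])
  let _ : Algebra (ZMod p) K := ZMod.algebra K p
  have ha : 0 < a := Nat.pos_of_ne_zero (by rintro rfl; simp at hae)
  have hb : 0 < b := Nat.pos_of_ne_zero (by rintro rfl; simp at habce)
  have hc : 0 < c := Nat.pos_of_ne_zero (by rintro rfl; simp at habce)
  have hnear : HeisNursery.NearHalf ℓ (a * b * e) :=
    HeisNursery.nearHalf_of_abs_le (by push_cast; exact hℓ)
  have hrare := HeisNursery.rare_not_embeddingsConjugate (p := p) (c := c) hK ha hb hc hae hnear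
  generalize 4 + 16 * b + 64 * (a * b * b) + 324 = C at *
  rw [HeisNursery.ncard_kinder_sep, HeisNursery.ncard_kinder]
  rw [HeisNursery.Rare] at hrare
  have hle : (HeisNursery.Gr a b K (p ^ ℓ)).ncard ≤
      {S | S ∈ HeisNursery.Gr a b K (p ^ ℓ) ∧
        ¬HeisNursery.EmbeddingsConjugate (HeisNursery.kind c S)}.ncard +
      {S ∈ HeisNursery.Gr a b K (p ^ ℓ) | HeisNursery.EmbeddingsConjugate (HeisNursery.kind c S) ∧
        HeisNursery.SingleOrbit (HeisNursery.kind c S)}.ncard := by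
    refine le_trans (Set.ncard_le_ncard ?_ ?_) (Set.ncard_union_le _ _)
    · intro S hS
      by_cases h : HeisNursery.EmbeddingsConjugate (HeisNursery.kind c S)
      · refine Or.inr ⟨hS, h, h.singleOrbit fun g hg => ?_⟩
        rw [HeisNursery.mem_kind, (HeisNursery.mem_Gamma₂ g).1 hg]
        exact S.zero_mem
      · exact Or.inl ⟨hS, h⟩
    · exact (HeisNursery.finite_Gr.subset fun _ hS => hS.1).union
        (HeisNursery.finite_Gr.subset fun _ hS => hS.1)
  have hq : (0 : ℝ) < Nat.card K := by exact_mod_cast Nat.card_pos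
  generalize (HeisNursery.Gr a b K (p ^ ℓ)).ncard = N at *
  generalize Set.ncard {S | _ ∧ ¬_} = M at *
  generalize Set.ncard _ = G at *
  have h1 : (M : ℝ) * Nat.card K ≤ C * N := by exact_mod_cast hrare
  have h2 : (N : ℝ) ≤ M + G := by exact_mod_cast hle
  have h3 : (M : ℝ) ≤ C * N / Nat.card K := (le_div_iff₀ hq).2 h1
  have h4 : (1 - (C : ℝ) / Nat.card K) * N = N - C * N / Nat.card K := by ring
  rw [h4]
  linarith
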